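/- **Setting.** Let $0<\sigma<R$ and let $\Phi$ be an even pair potential, twice continuously differentiable on $\{|r|>\sigma\}$, with $\Phi(r)=0$ for $|r|>R$ and $\Phi(r)\to+\infty$ as $r\downarrow\sigma$ (hard core of length $\sigma$). Consider $n_1+n_2$ ordered particles on the line with labels $-n_1,\dots,-1,1,\dots,n_2$ (the label after $-1$ is $1$) and phase points $x_i=(q_i,p_i)$, in which only neighbours interact, so that the Hamiltonian is $\sum_i p_i^2/2+\sum_{(j,j+1)}\Phi(q_j-q_{j+1})$. The allowed configurations are those with $q_j+\sigma<q_{j+1}$ for all neighbours; $C_{n_1+n_2}$ is the space of bounded functions on the phase space that are continuous on the allowed configurations and zero on the others. Let $S_{n_1+n_2}(t)$, $t\in\mathbb R$, be the group $(S_{n_1+n_2}(t)b)(x)=b(X(t,x))$ on allowed configurations (and $0$ elsewhere), where $X(t,x)$ is the solution of the Hamilton equations with $X(0,x)=x$. Put $$\mathcal L_{\rm int}(j,j+1)=-\frac{\partial\Phi(q_j-q_{j+1})}{\partial q_j}\Big(\frac{\partial}{\partial p_j}-\frac{\partial}{\partial p_{j+1}}\Big),\qquad \mathcal L_{n_1+n_2}=\sum_j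 p_j\frac{\partial}{\partial q_j}+\sum_{(j,j+1)}\mathcal L_{\rm int}(j,j+1).$$ **Hierarchy.** The Cauchy problem for double sequences $B(t)=\{B_{s_1+s_2}(t)\}_{s_1,s_2\ge 0}$, $B_{s_1+s_2}(t)\in C_{s_1+s_2}$, $t\in\mathbb R$, is $B(0)=B^0$ and $$\partial_t B_{s_1+s_2}(t)=\mathcal L_{s_1+s_2}B_{s_1+s_2}(t)+\mathcal L_{\rm int}(-s_1,-s_1+1)B_{s_1-1+s_2}(t,x_{-s_1+1},\dots,x_{s_2})+\mathcal L_{\rm int}(s_2-1,s_2)B_{s_1+s_2-1}(t,x_{-s_1},\dots,x_{s_2-1})$$ on the allowed configurations, for all $s_1,s_2\ge0$, where the second (third) term is absent if $s_1=0$ ($s_2=0$) or $s_1+s_2<2$, and $\pm1$ is the neighbour of $\mp1$. (For $s_1=s_2=0$ the equation says that $B_0(t)$ is constant.) A *classical solution* is one for which each $B_{s_1+s_2}(t,x)$ is continuously differentiable jointly in $t\in\mathbb R$ and allowed $x$ and the equations hold pointwise. A *generalized solution* is one for which each $B_{s_1+s_2}(t,x)$ is jointly continuous in $t\in\mathbb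 R$ and allowed $x$, and, for every continuously differentiable $f$ with compact support in the allowed configurations, $t\mapsto\int B_{s_1+s_2}(t)f\,dx$ is differentiable and its derivative is the right-hand side paired with $f$, the operators $\mathcal L_{s_1+s_2}$, $\mathcal L_{\rm int}$ being moved to $f$ as their formal adjoints $-\mathcal L_{s_1+s_2}$, $-\mathcal L_{\rm int}$. **Expansions.** A family of generating operators consists, for $t\in\mathbb R$, $0\le n_1\le s_1$, $0\le n_2\le s_2$, of linear operators $$\mathfrak A_{1+s_1-n_1+s_2-n_2}\big(t,-s_1,\dots,-(n_1+1),\{-n_1,\dots,n_2\},n_2+1,\dots,s_2\big):C_{n_1+n_2}\to C_{s_1+s_2},$$ and the expansions are $$B_{s_1+s_2}(t)=\sum_{n_1=0}^{s_1}\sum_{n_2=0}^{s_2}\mathfrak A_{1+s_1-n_1+s_2-n_2}(t,-s_1,\dots,\{-n_1,\dots,n_2\},\dots,s_2)\,B^0_{n_1+n_2}(x_{-n_1},\dots,x_{n_2}).\qquad(1)$$ The family solves the cluster expansions on $b\in C_{n_1+n_2}$ if, for all $t\in\mathbb R$, $s_1\ge n_1$, $s_2\ge n_2$, on the allowed configurations,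 $$S_{s_1+s_2}(t)\,b=\sum_{\mathrm P}\ \prod_{X_i\in\mathrm P}\mathfrak A_{|X_i|}(t,X_i)\,b,\qquad(2)$$ where $b$ is regarded as a function of $x_{-s_1},\dots,x_{s_2}$ that depends on $x_{-n_1},\dots,x_{n_2}$ only, and $\mathrm P$ runs over all partitions of the ordered set $(-s_1,\dots,-(n_1+1),\{-n_1,\dots,n_2\},n_2+1,\dots,s_2)$, in which $\{-n_1,\dots,n_2\}$ counts as one element, into nonempty blocks of consecutive elements. The operators of the blocks act on different variables: the block that contains the cluster acts on $b$, and every other block, of $k$ particles, acts on the constant $1$ by the operator of order $k$ of the family, which, the particles being identical, is up to renumbering $\mathfrak A_k(t,\{1\},2,\dots,k)$ to the right of the cluster and $\mathfrak A_k(t,-k,\dots,-2,\{-1\})$ to the left of it. **Criterion.** Let $\mathfrak A$ be a family of generating operators. 1. The expansions (1) are a generalized solution of the Cauchy problem for every initial sequence $B^0$, $B^0_{n_1+n_2}\in C_{n_1+n_2}$, if and only if $\mathfrak A$ solves the cluster expansions (2) on all $b\in C_{n_1+n_2}$, $n_1,n_2\ge0$. 2. The expansions (1) are a classical solution of the Cauchy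 problem for every such $B^0$ whose members are continuously differentiable on the allowed configurations, if and only if $\mathfrak A$ solves the cluster expansions (2) on all $b\in C_{n_1+n_2}$, $n_1,n_2\ge0$, that are continuously differentiable on the allowed configurations. -/

import Mathlib

open MeasureTheory Filter Topology Finset

namespace TopInt

/-- Phase space of `N` particles on the line: coordinates `x.1` and momenta `x.2`. The particles
are listed from left to right. In a system of `n₁ + n₂` particles labelled `-n₁, …, -1, 1, …, n₂`,
the particle in position `0` carries the label `-n₁` and the last one the label `n₂`. -/
abbrev Phase (N : ℕ) : Type := (Fin N → ℝ) × (Fin N → ℝ)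

/-- The `k` consecutive particles that start in position `o` (used only if `o + k ≤ N`). -/
def window {N : ℕ} (o k : ℕ) (x : Phase N) : Phase k :=
  (fun j => if h : o + j < N then x.1 ⟨o + j, h⟩ else 0,
   fun j => if h : o + j < N then x.2 ⟨o + j, h⟩ else 0)

/-- Allowed configurations: neighbours are further apart than the length `σ` of the hard core. -/
def Allowed (σ : ℝ) (N : ℕ) : Set (Phase N) :=
  {x | ∀ (j : ℕ) (h : j + 1 < N), x.1 ⟨j, by omega⟩ + σ < x.1 ⟨j + 1, h⟩}

/-- Even pair potential of range `R` with a hard core of length `σ`, at which it becomes `+∞`;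
its values on `[-σ, σ]` are irrelevant. -/
structure IsPotential (Φ : ℝ → ℝ) (σ R : ℝ) : Prop where
  core_pos : 0 < σ
  core_lt : σ < R
  even : ∀ r, Φ (-r) = Φ r
  smooth : ContDiffOn ℝ 2 Φ {r | σ < |r|}
  short_range : ∀ r, R < |r| → Φ r = 0
  core : Tendsto Φ (𝓝[>] σ) atTop

/-- `∂Φ(q_j - q_{j+1})/∂q_j` for the neighbours in positions `j` and `j + 1`
(zero if there is no such pair). -/
noncomputable def dPhi (Φ : ℝ → ℝ) {N : ℕ} (j : ℕ) (q : Fin N → ℝ) : ℝ :=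
  if h : j + 1 < N then deriv Φ (q ⟨j, by omega⟩ - q ⟨j + 1, h⟩) else 0

/-- The Hamiltonian vector field of `∑ p_j² / 2 + ∑ Φ(q_j - q_{j+1})`. -/
noncomputable def hamiltonField (Φ : ℝ → ℝ) {N : ℕ} (x : Phase N) : Phase N :=
  (x.2, fun j => (if (j : ℕ) = 0 then 0 else dPhi Φ ((j : ℕ) - 1) x.1) - dPhi Φ (j : ℕ) x.1)

/-- `X` is a global solution of the Hamilton equations. -/
def IsTrajectory (Φ : ℝ → ℝ) (σ : ℝ) {N : ℕ} (X : ℝ → Phase N) : Prop :=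
  (∀ t, X t ∈ Allowed σ N) ∧ ∀ t, HasDerivAt X (hamiltonField Φ (X t)) t

open Classical in
/-- The solution `t ↦ X(t, x)` of the Hamilton equations with `X(0, x) = x`. -/
noncomputable def flow (Φ : ℝ → ℝ) (σ : ℝ) {N : ℕ} (x : Phase N) : ℝ → Phase N :=
  if h : ∃ X : ℝ → Phase N, IsTrajectory Φ σ X ∧ X 0 = x then h.choose else fun _ => x

open Classical in
/-- The group `S*(t)` of the Liouville equation. -/
noncomputable def SStar (Φ : ℝ → ℝ) (σ : ℝ) {N : ℕ} (t : ℝ) (f : Phase N → ℝ) : Phase N → ℝ :=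
  fun x => if x ∈ Allowed σ N then f (flow Φ σ x (-t)) else 0

/-- The adjoint group `S(t) = S*(-t)`, which acts on observables. -/
noncomputable def S (Φ : ℝ → ℝ) (σ : ℝ) {N : ℕ} (t : ℝ) (b : Phase N → ℝ) : Phase N → ℝ :=
  SStar Φ σ (-t) b

/-- `∂f/∂q_j`. -/
noncomputable def dq {N : ℕ} (j : Fin N) (f : Phase N → ℝ) (x : Phase N) : ℝ :=
  fderiv ℝ f x (Pi.single j 1, 0)

/-- `∂f/∂p_j`. -/
noncomputable def dp {N : ℕ} (j : Fin N) (f : Phase N → ℝ) (x : Phase N) : ℝ :=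
  fderiv ℝ f x (0, Pi.single j 1)

/-- The interaction part `L*_int(j, j+1)` of the Liouville operator, for the neighbours in positions
`j` and `j + 1` (zero if there is no such pair). -/
noncomputable def LStarInt (Φ : ℝ → ℝ) {N : ℕ} (j : ℕ) (f : Phase N → ℝ) (x : Phase N) : ℝ :=
  if h : j + 1 < N then dPhi Φ j x.1 * (dp ⟨j, by omega⟩ f x - dp ⟨j + 1, h⟩ f x) else 0

/-- The Liouville operator `L*` of `N` particles. -/
noncomputable def LStar (Φ : ℝ → ℝ) {N : ℕ} (f : Phase N → ℝ) (x : Phase N) : ℝ :=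
  (∑ j : Fin N, -(x.2 j * dq j f x)) + ∑ j ∈ range (N - 1), LStarInt Φ j f x

/-- The space of bounded functions, continuous on the allowed configurations and equal to zero on
the forbidden ones. -/
def Obs (σ : ℝ) (N : ℕ) : Submodule ℝ (Phase N → ℝ) where
  carrier := {b | ContinuousOn b (Allowed σ N) ∧ (∃ C, ∀ x, |b x| ≤ C) ∧
    ∀ x, x ∉ Allowed σ N → b x = 0}
  add_mem' := by
    rintro a b ⟨ha, ⟨C, hC⟩, ha0⟩ ⟨hb, ⟨D, hD⟩, hb0⟩
    refine ⟨ha.add hb, ⟨C + D, fun x => ?_⟩, fun x hx => ?_⟩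
    · exact (abs_add_le _ _).trans (add_le_add (hC x) (hD x))
    · simp [ha0 x hx, hb0 x hx]
  zero_mem' := ⟨continuousOn_const, ⟨0, fun x => by simp⟩, fun x _ => rfl⟩
  smul_mem' := by
    rintro c b ⟨hb, ⟨D, hD⟩, hb0⟩
    refine ⟨continuousOn_const.smul hb, ⟨|c| * D, fun x => ?_⟩, fun x hx => ?_⟩
    · simpa [abs_mul] using mul_le_mul_of_nonneg_left (hD x) (abs_nonneg c)
    · simp [hb0 x hx]

open Classical in
/-- The observable that equals `1` on all allowed configurations. -/
noncomputable def unitObs (σ : ℝ) (N : ℕ) : Obs σ N :=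
  ⟨fun x => if x ∈ Allowed σ N then 1 else 0,
    (continuousOn_const (c := (1 : ℝ))).congr fun x hx => if_pos hx,
    ⟨1, fun x => by by_cases hx : x ∈ Allowed σ N <;> simp [hx]⟩, fun x hx => if_neg hx⟩

/-- Double sequences of observables `b = (b_{n₁+n₂})`. -/
abbrev ObsSeq (σ : ℝ) : Type := (n : ℕ × ℕ) → Obs σ (n.1 + n.2)

/-- All members of the sequence are continuously differentiable on the allowed configurations. -/
def ObsSeq.IsC1 {σ : ℝ} (b : ObsSeq σ) : Prop :=
  ∀ n : ℕ × ℕ, ContDiffOn ℝ 1 (b n : Phase (n.1 + n.2) → ℝ) (Allowed σ (n.1 + n.2))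

/-- The creation operator `a⁺₊`: `(a⁺₊ b)_{n₁+n₂}(x_{-n₁}, …, x_{n₂}) =
b_{n₁+n₂-1}(x_{-n₁}, …, x_{n₂-1})`, and zero if `n₂ = 0`. -/
noncomputable def aPlus {σ : ℝ} (b : ObsSeq σ) (n : ℕ × ℕ) (x : Phase (n.1 + n.2)) : ℝ :=
  if n.2 = 0 then 0
  else (b (n.1, n.2 - 1) : Phase (n.1 + (n.2 - 1)) → ℝ) (window 0 (n.1 + (n.2 - 1)) x)

/-- The creation operator `a⁺₋`: `(a⁺₋ b)_{n₁+n₂}(x_{-n₁}, …, x_{n₂}) =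
b_{n₁-1+n₂}(x_{-(n₁-1)}, …, x_{n₂})`, and zero if `n₁ = 0`. -/
noncomputable def aMinus {σ : ℝ} (b : ObsSeq σ) (n : ℕ × ℕ) (x : Phase (n.1 + n.2)) : ℝ :=
  if n.1 = 0 then 0
  else (b (n.1 - 1, n.2) : Phase (n.1 - 1 + n.2) → ℝ) (window 1 (n.1 - 1 + n.2) x)

/-- Right-hand side of the hierarchy for reduced observables, with `L = -L*`, `L_int = -L*_int`:
`(L B)_{s₁+s₂} + L_int(-s₁, -s₁+1) B_{s₁-1+s₂} + L_int(s₂-1, s₂) B_{s₁+s₂-1}`.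
The two outermost pairs are in positions `(0, 1)` and `(s₁+s₂-2, s₁+s₂-1)`. -/
noncomputable def generator (Φ : ℝ → ℝ) {σ : ℝ} (B : ObsSeq σ) (s : ℕ × ℕ)
    (x : Phase (s.1 + s.2)) : ℝ :=
  -LStar Φ (B s : Phase (s.1 + s.2) → ℝ) x - LStarInt Φ 0 (aMinus B s) x
    - LStarInt Φ (s.1 + s.2 - 2) (aPlus B s) x

/-- Classical solutions of the Cauchy problem for the hierarchy with initial data `B₀`. -/
structure IsClassicalSolution (Φ : ℝ → ℝ) {σ : ℝ} (B₀ : ObsSeq σ) (B : ℝ → ObsSeq σ) : Prop where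
  smooth : ∀ s : ℕ × ℕ, ContDiffOn ℝ 1
    (fun z : ℝ × Phase (s.1 + s.2) => (B z.1 s : Phase (s.1 + s.2) → ℝ) z.2)
    (Set.univ ×ˢ Allowed σ (s.1 + s.2))
  initial : B 0 = B₀
  equation : ∀ (s : ℕ × ℕ) (t : ℝ), ∀ x ∈ Allowed σ (s.1 + s.2),
    HasDerivAt (fun τ => (B τ s : Phase (s.1 + s.2) → ℝ) x) (generator Φ (B t) s x) t

/-- Generalized solutions of the Cauchy problem for the hierarchy with initial data `B₀`:
jointly continuous on the allowed configurations, and the hierarchy holds after pairing with test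
functions, where `L*`, `L*_int` are the adjoints of `L`, `L_int`. -/
structure IsGeneralizedSolution (Φ : ℝ → ℝ) {σ : ℝ} (B₀ : ObsSeq σ) (B : ℝ → ObsSeq σ) :
    Prop where
  continuous : ∀ s : ℕ × ℕ, ContinuousOn
    (fun z : ℝ × Phase (s.1 + s.2) => (B z.1 s : Phase (s.1 + s.2) → ℝ) z.2)
    (Set.univ ×ˢ Allowed σ (s.1 + s.2))
  initial : B 0 = B₀
  equation : ∀ (s : ℕ × ℕ) (f : Phase (s.1 + s.2) → ℝ), ContDiff ℝ 1 f → HasCompactSupport f →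
    tsupport f ⊆ Allowed σ (s.1 + s.2) → ∀ t : ℝ,
    HasDerivAt (fun τ => ∫ x, (B τ s : Phase (s.1 + s.2) → ℝ) x * f x)
      ((∫ x, (B t s : Phase (s.1 + s.2) → ℝ) x * LStar Φ f x)
        + (∫ x, aMinus (B t) s x * LStarInt Φ 0 f x)
        + ∫ x, aPlus (B t) s x * LStarInt Φ (s.1 + s.2 - 2) f x) t

/-- Families of generating operators. For `n₁ ≤ s₁`, `n₂ ≤ s₂`, `A t (s₁, s₂) (n₁, n₂)` is the
operator `A_{1+s₁-n₁+s₂-n₂}(t, -s₁, …, -(n₁+1), {-n₁, …, n₂}, n₂+1, …, s₂)`; it maps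
observables of the cluster `{-n₁, …, n₂}` to observables of the particles `-s₁, …, s₂`. -/
abbrev GenOps (σ : ℝ) : Type :=
  ℝ → (s n : ℕ × ℕ) → (Obs σ (n.1 + n.2) →ₗ[ℝ] Obs σ (s.1 + s.2))

/-- The expansions `B_{s₁+s₂}(t) = ∑_{n₁ ≤ s₁} ∑_{n₂ ≤ s₂} A_{1+s₁-n₁+s₂-n₂}(t) B⁰_{n₁+n₂}`. -/
noncomputable def expansion {σ : ℝ} (A : GenOps σ) (B₀ : ObsSeq σ) (t : ℝ) : ObsSeq σ :=
  fun s => ∑ n₁ ∈ range (s.1 + 1), ∑ n₂ ∈ range (s.2 + 1), A t s (n₁, n₂) (B₀ (n₁, n₂))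

/-- Consider the ordered set `(-(n₁+k₁), …, -(n₁+1), {-n₁, …, n₂}, n₂+1, …, n₂+k₂)`, whose
`k₁ + 1 + k₂` elements are `k₁` particles, the cluster and `k₂` particles, and a partition `c` of it
into consecutive blocks. The operators of the blocks act on different variables, so their product
maps an observable `b` of the cluster to the product of the following factors: the block with the
cluster contributes its operator applied to `b`; every other block, of `k` particles, contributes
its operator of order `k` applied to the constant `1`. As the particles are identical, the latter
operator is, up to the numbering of the particles, the one of `(-k, …, -2, {-1})` to the left of the
cluster and the one of `({1}, 2, …, k)` to the right. -/
noncomputable def blockFactor {σ : ℝ} (A : GenOps σ) (t : ℝ) (n k : ℕ × ℕ)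
    (b : Obs σ (n.1 + n.2)) (c : Composition (k.1 + 1 + k.2)) (i : Fin c.length)
    (x : Phase (n.1 + k.1 + (n.2 + k.2))) : ℝ :=
  if c.sizeUpTo (i + 1) ≤ k.1 then
    (A t (c.blocksFun i, 0) (1, 0) (unitObs σ (1 + 0)) : Phase (c.blocksFun i + 0) → ℝ)
      (window (c.sizeUpTo i) _ x)
  else if c.sizeUpTo i ≤ k.1 then
    (A t (n.1 + (k.1 - c.sizeUpTo i), n.2 + (c.sizeUpTo (i + 1) - (k.1 + 1))) n b :
        Phase (n.1 + (k.1 - c.sizeUpTo i) + (n.2 + (c.sizeUpTo (i + 1) - (k.1 + 1)))) → ℝ)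
      (window (c.sizeUpTo i) _ x)
  else
    (A t (0, c.blocksFun i) (0, 1) (unitObs σ (0 + 1)) : Phase (0 + c.blocksFun i) → ℝ)
      (window (c.sizeUpTo i - 1 + (n.1 + n.2)) _ x)

/-- The cluster expansion of `S_{s₁+s₂}(t)`, `s = n + k`, with the cluster `{-n₁, …, n₂}`, applied
to an observable `b` of the cluster (a function of the variables in positions `k₁, …, k₁+n₁+n₂-1`),
holds on the allowed configurations: the sum is over all ordered partitions. -/
def ClusterExpansionAt (Φ : ℝ → ℝ) {σ : ℝ} (A : GenOps σ) (t : ℝ) (n k : ℕ × ℕ)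
    (b : Obs σ (n.1 + n.2)) : Prop :=
  ∀ x ∈ Allowed σ (n.1 + k.1 + (n.2 + k.2)),
    S Φ σ t (fun y => (b : Phase (n.1 + n.2) → ℝ) (window k.1 (n.1 + n.2) y)) x =
      ∑ c : Composition (k.1 + 1 + k.2), ∏ i : Fin c.length, blockFactor A t n k b c i x

end TopInt

/-! ### Autonomous equations with a continuously differentiable field: cut-offs, uniqueness,
existence -/

section ODE

variable {E : Type*} [NormedAddCommGroup E] [NormedSpace ℝ E]

/-! Write a₋ and a₊ for `am` and `ap`, which regard an observable of all particles but the leftmost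
(rightmost) one as an observable of all of them. The substitution B = (1 - a₋)(1 - a₊)D turns the
hierarchy into uncoupled Liouville equations. Indeed, if every D_s is transported by its own
Hamiltonian flow, then a₋D is transported by the flow of a system that lacks the leftmost particle.
On functions that do not depend on that particle, the generators of the two systems differ only by
the interaction of the outermost pair, and this difference is the inhomogeneous term of the
hierarchy (`hasDerivAt_window`, `hasDerivAt_integral_window`). A function a₋a₋D depends on neither
particle of the leftmost pair, so this interaction annihilates it, and the remaining terms recombine
into the hierarchy for B (`hasDerivAt_diff_evolve`, `hasDerivAt_integral_diff_evolve`).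

The operator (1 - a₋)(1 - a₊) is `diff`. Its inverse is the product of two geometric series, which
are finite sums on every member (`cum`). Hence (1 - a₋)(1 - a₊)S(t)(1 - a₊)⁻¹(1 - a₋)⁻¹B⁰ solves the
Cauchy problem. The solution is unique, because the hierarchy is triangular in the number of
particles: if two solutions agree for fewer particles, their difference solves a Liouville equation
with zero initial data (`isGeneralizedSolution_iff`, `isClassicalSolution_iff`).

Both sides of each equivalence then say that, on allowed configurations, the operator of the family
applied to b is the corresponding member of (1 - a₋)(1 - a₊)S(t)b, with b extended to all larger
systems. For the expansions, this follows by testing with sequences that have one nonzero member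
(`expansion_eq_solution_iff`). For the cluster expansions, S(t)1 = 1 forces the operators of the
blocks without the cluster to map 1 to 1 if the block is a singleton and to 0 otherwise. Only the
block with the cluster then matters, the sum over partitions becomes `cum`, and `diff` inverts it
(`clusterExpansions_iff`).

The analytic basis is the flow. It is global because energy conservation keeps particles away from
the hard core, it is continuously differentiable by the implicit function theorem, and it preserves
volume. Generalized solutions are only continuous, so for them the transport equation is handled by
moving the flow to the test functions (`hasDerivAt_integral_comp_mul`,
`eq_zero_of_hasDerivAt_integral`). -/

theorem exists_cutoff [FiniteDimensional ℝ E] {K U : Set E} (hK : IsCompact K) (hU : IsOpen U)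
    (hKU : K ⊆ U) : ∃ χ : E → ℝ, ContDiff ℝ 1 χ ∧ HasCompactSupport χ ∧ tsupport χ ⊆ U ∧
      (∀ x, 0 ≤ χ x ∧ χ x ≤ 1) ∧ ∀ x ∈ K, χ x = 1 := by
  obtain ⟨L, hL, hKL, hLU⟩ := exists_compact_between hK hU hKU
  obtain ⟨f, hf1, hf0, hf⟩ := exists_contMDiffMap_one_nhds_of_subset_interior (n := 1)
    (modelWithCornersSelf ℝ E) hK.isClosed hKL
  have hsupp : tsupport f ⊆ L := by
    refine closure_minimal (fun x hx => ?_) hL.isClosed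
    by_contra h
    exact hx (hf0 x h)
  refine ⟨f, f.contMDiff.contDiff, ?_, hsupp.trans hLU, hf, fun x hx => ?_⟩
  · exact hL.of_isClosed_subset (isClosed_tsupport _) hsupp
  · exact (hf1.self_of_nhdsSet) x hx

theorem contDiff_of_contDiffOn_of_tsupport {F : Type*} [NormedAddCommGroup F] [NormedSpace ℝ F]
    {U : Set E} (hU : IsOpen U) {g : E → F}
    (hg : ContDiffOn ℝ 1 g U) (hs : tsupport g ⊆ U) : ContDiff ℝ 1 g := by
  rw [contDiff_iff_contDiffAt]
  intro x
  by_cases hx : x ∈ U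
  · exact hg.contDiffAt (hU.mem_nhds hx)
  · have : g =ᶠ[𝓝 x] 0 := notMem_tsupport_iff_eventuallyEq.1 fun h => hx (hs h)
    exact (contDiffAt_const (c := (0 : F))).congr_of_eventuallyEq this

/-- The field is defined and regular only on U, and need not be bounded there. Multiplication by a
cut-off gives a globally Lipschitz field with the same solutions as long as they stay in K. -/
theorem exists_contDiff_field_eqOn [FiniteDimensional ℝ E] {K U : Set E} (hK : IsCompact K)
    (hU : IsOpen U) (hKU : K ⊆ U) {v : E → E} (hv : ContDiffOn ℝ 1 v U) :
    ∃ χ : E → ℝ, (∀ x, 0 ≤ χ x ∧ χ x ≤ 1) ∧ (∀ x ∈ K, χ x = 1) ∧ tsupport χ ⊆ U ∧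
      ContDiff ℝ 1 (fun x => χ x • v x) ∧ HasCompactSupport (fun x => χ x • v x) := by
  obtain ⟨χ, h1, h2, h3, h4, h5⟩ := exists_cutoff hK hU hKU
  refine ⟨χ, h4, h5, h3, ?_, h2.smul_right⟩
  refine contDiff_of_contDiffOn_of_tsupport hU (h1.contDiffOn.smul hv) ?_
  exact (tsupport_smul_subset_left χ v).trans h3

/-- Two solutions of an autonomous equation with a continuously differentiable field that agree
at one time agree everywhere. -/
theorem ODE_solution_unique_of_contDiffOn [FiniteDimensional ℝ E] {U : Set E} (hU : IsOpen U)
    {v : E → E} (hv : ContDiffOn ℝ 1 v U) {X Y : ℝ → E} {a b t₀ : ℝ} (ht₀ : t₀ ∈ Set.Ioo a b)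
    (hX : ∀ t ∈ Set.Ioo a b, HasDerivAt X (v (X t)) t ∧ X t ∈ U)
    (hY : ∀ t ∈ Set.Ioo a b, HasDerivAt Y (v (Y t)) t ∧ Y t ∈ U)
    (h : X t₀ = Y t₀) : Set.EqOn X Y (Set.Ioo a b) := by
  intro t ht
  obtain ⟨c, d, hsub, ht', ht₀'⟩ : ∃ c d, Set.Icc c d ⊆ Set.Ioo a b ∧ t ∈ Set.Ioo c d ∧
      t₀ ∈ Set.Ioo c d := by
    refine ⟨(a + min t t₀) / 2, (max t t₀ + b) / 2, ?_, ?_, ?_⟩ <;>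
    simp only [Set.mem_Ioo] at ht ht₀ ⊢
    · intro s hs
      simp only [Set.mem_Icc, Set.mem_Ioo] at hs ⊢
      have : a < min t t₀ := lt_min ht.1 ht₀.1
      have : max t t₀ < b := max_lt ht.2 ht₀.2
      constructor <;> linarith [hs.1, hs.2]
    all_goals
      have h1 : a < min t t₀ := lt_min ht.1 ht₀.1
      have h2 : max t t₀ < b := max_lt ht.2 ht₀.2
      have h3 := min_le_left t t₀
      have h4 := min_le_right t t₀
      have h5 := le_max_left t t₀
      have h6 := le_max_right t t₀
      constructor <;> linarith
  have cX : ContinuousOn X (Set.Icc c d) :=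
    fun s hs => ((hX s (hsub hs)).1.continuousAt).continuousWithinAt
  have cY : ContinuousOn Y (Set.Icc c d) :=
    fun s hs => ((hY s (hsub hs)).1.continuousAt).continuousWithinAt
  -- Both curves trace compact subsets of U over a compact time interval; there the field may be
  -- replaced by a cut-off one, for which global Lipschitz uniqueness applies.
  have hK : IsCompact (X '' Set.Icc c d ∪ Y '' Set.Icc c d) :=
    (isCompact_Icc.image_of_continuousOn cX).union (isCompact_Icc.image_of_continuousOn cY)
  have hKU : X '' Set.Icc c d ∪ Y '' Set.Icc c d ⊆ U := by
    rintro _ (⟨s, hs, rfl⟩ | ⟨s, hs, rfl⟩)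
    exacts [(hX s (hsub hs)).2, (hY s (hsub hs)).2]
  obtain ⟨χ, -, h1, -, hw, hc⟩ := exists_contDiff_field_eqOn hK hU hKU hv
  obtain ⟨C, hC⟩ := hw.lipschitzWith_of_hasCompactSupport hc one_ne_zero
  refine ODE_solution_unique_of_mem_Ioo (v := fun _ x => χ x • v x) (s := fun _ => Set.univ)
    (fun _ _ => hC.lipschitzOnWith) ht₀' (fun s hs => ⟨?_, trivial⟩) (fun s hs => ⟨?_, trivial⟩)
    h ht'
  · have hs' := Set.Ioo_subset_Icc_self hs
    rw [h1 _ (Or.inl ⟨s, hs', rfl⟩), one_smul]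
    exact (hX s (hsub hs')).1
  · have hs' := Set.Ioo_subset_Icc_self hs
    rw [h1 _ (Or.inr ⟨s, hs', rfl⟩), one_smul]
    exact (hY s (hsub hs')).1

theorem ODE_exists_of_hasCompactSupport [CompleteSpace E] {w : E → E} (hw : ContDiff ℝ 1 w)
    (hc : HasCompactSupport w) (x : E) (T : ℝ) (hT : 0 < T) :
    ∃ X : ℝ → E, X 0 = x ∧ ∀ t ∈ Set.Ioo (-T) T, HasDerivAt X (w (X t)) t := by
  obtain ⟨C, hC⟩ := hw.lipschitzWith_of_hasCompactSupport hc one_ne_zero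
  obtain ⟨D, hD⟩ := hc.exists_bound_of_continuous hw.continuous
  have hD0 : 0 ≤ D := (norm_nonneg _).trans (hD x)
  have h0 : (0 : ℝ) ∈ Set.Icc (-T) T := ⟨by linarith, hT.le⟩
  -- With speed at most D, a curve moves by at most D * T in time T. With this radius the condition
  -- on the length of the time interval holds for every T.
  have pl : IsPicardLindelof (fun _ => w) (⟨0, h0⟩ : Set.Icc (-T) T) x
      (⟨D * T, by positivity⟩ : NNReal) 0 ⟨D, hD0⟩ C :=
    { lipschitzOnWith := fun _ _ => hC.lipschitzOnWith
      continuousOn := fun _ _ => continuousOn_const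
      norm_le := fun _ _ y _ => hD y
      mul_max_le := by
        simp only [sub_zero, zero_sub, neg_neg, max_self, NNReal.coe_zero]
        exact le_rfl }
  obtain ⟨X, hX0, hX⟩ := pl.exists_eq_forall_mem_Icc_hasDerivWithinAt₀
  exact ⟨X, hX0, fun t ht => (hX t (Set.Ioo_subset_Icc_self ht)).hasDerivAt
    (Icc_mem_nhds ht.1 ht.2)⟩

end ODE

/-! ### Global solutions, and the operators on curve spaces used for smooth dependence on initial
data -/

section ODE

variable {E : Type*} [NormedAddCommGroup E] [NormedSpace ℝ E]

/-- Global solutions exist if solutions of the equations with cut-off fields `χ • v` stay in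
compact sets during bounded time intervals. -/
theorem ODE_exists_global [FiniteDimensional ℝ E] {U : Set E} (hU : IsOpen U)
    {v : E → E} (hv : ContDiffOn ℝ 1 v U) {x : E} (hx : x ∈ U)
    (H : ∀ T > 0, ∃ K ⊆ U, IsCompact K ∧ ∀ χ : E → ℝ, (∀ y, 0 ≤ χ y ∧ χ y ≤ 1) →
      ∀ X : ℝ → E, X 0 = x → (∀ t ∈ Set.Ioo (-T) T, X t ∈ U ∧ HasDerivAt X (χ (X t) • v (X t)) t) →
        ∀ t ∈ Set.Ioo (-T) T, X t ∈ K) :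
    ∃ X : ℝ → E, X 0 = x ∧ (∀ t, X t ∈ U) ∧ ∀ t, HasDerivAt X (v (X t)) t := by
  have key : ∀ T > 0, ∃ X : ℝ → E, X 0 = x ∧
      ∀ t ∈ Set.Ioo (-T) T, HasDerivAt X (v (X t)) t ∧ X t ∈ U := by
    intro T hT
    obtain ⟨K, hKU, hK, hKX⟩ := H T hT
    obtain ⟨χ, h01, h1, hs, hw, hc⟩ := exists_contDiff_field_eqOn hK hU hKU hv
    obtain ⟨X, hX0, hX⟩ := ODE_exists_of_hasCompactSupport hw hc x T hT
    -- Where χ vanishes the cut-off equation has stationary solutions. A solution that reached a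
    -- point outside U would by uniqueness have been there at time 0, but it starts in U.
    have hXU : ∀ t ∈ Set.Ioo (-T) T, X t ∈ U := by
      intro t ht
      by_contra hXt
      have hχ : χ (X t) = 0 := by
        by_contra h
        exact hXt (hs (subset_tsupport χ h))
      have h0 : (0 : ℝ) ∈ Set.Ioo (-T) T := ⟨by linarith, hT⟩
      have := ODE_solution_unique_of_contDiffOn isOpen_univ hw.contDiffOn (Y := fun _ => X t) ht
        (fun s hs => ⟨hX s hs, trivial⟩)
        (fun s hs => ⟨by simpa [hχ] using hasDerivAt_const s (X t), trivial⟩) rfl h0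
      simp only [hX0] at this
      exact hXt (this ▸ hx)
    have hXK := hKX χ h01 X hX0 fun t ht => ⟨hXU t ht, hX t ht⟩
    refine ⟨X, hX0, fun t ht => ⟨?_, hXU t ht⟩⟩
    simpa [h1 _ (hXK t ht)] using hX t ht
  choose! X hX0 hX using key
  have agree : ∀ S T : ℝ, 0 < S → S ≤ T → Set.EqOn (X S) (X T) (Set.Ioo (-S) S) := by
    intro S T hS hST
    refine ODE_solution_unique_of_contDiffOn hU hv (t₀ := 0) ⟨by linarith, hS⟩ (hX S hS)
      (fun t ht => hX T (hS.trans_le hST) t ⟨by linarith [ht.1], by linarith [ht.2]⟩) ?_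
    rw [hX0 S hS, hX0 T (hS.trans_le hST)]
  have hmem : ∀ t : ℝ, t ∈ Set.Ioo (-(|t| + 1)) (|t| + 1) := fun t =>
    ⟨by linarith [neg_abs_le t], by linarith [le_abs_self t]⟩
  refine ⟨fun t => X (|t| + 1) t, by simp [hX0], fun t => (hX _ (by positivity) t (hmem t)).2,
    fun t => ?_⟩
  -- The patched curve uses a different solution at every time. Near t all of them agree with the
  -- single solution on the interval of half-length |t| + 2, because |s| + 1 < |t| + 2 for nearby s.
  have h2 : t ∈ Set.Ioo (-(|t| + 1 + 1)) (|t| + 1 + 1) :=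
    ⟨by linarith [(hmem t).1], by linarith [(hmem t).2]⟩
  have hd := (hX (|t| + 1 + 1) (by positivity) t h2).1
  rw [← agree (|t| + 1) (|t| + 1 + 1) (by positivity) (by linarith) (hmem t)] at hd
  refine hd.congr_of_eventuallyEq ?_
  filter_upwards [Ioo_mem_nhds (hmem t).1 (hmem t).2] with s hs
  refine agree (|s| + 1) (|t| + 1 + 1) (by positivity) ?_ (hmem s)
  have := abs_lt.2 hs
  linarith

/-- The superposition operator `α ↦ w ∘ α` on continuous curves. -/
theorem contDiff_superposition {I : Type*} [TopologicalSpace I] [CompactSpace I] {w : E → E}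
    (hw : ContDiff ℝ 1 w) (hc : HasCompactSupport w) :
    ContDiff ℝ 1 fun α : C(I, E) => (⟨w, hw.continuous⟩ : C(E, E)).comp α := by
  let M : C(I, E →L[ℝ] E) →L[ℝ] C(I, E) →L[ℝ] C(I, E) :=
    LinearMap.mkContinuous₂
      (LinearMap.mk₂ ℝ (fun (B : C(I, E →L[ℝ] E)) (h : C(I, E)) => (⟨fun s => B s (h s), by fun_prop⟩ : C(I, E)))
        (fun _ _ _ => by ext; simp) (fun _ _ _ => by ext; simp) (fun _ _ _ => by ext; simp)
        (fun _ _ _ => by ext; simp)) 1 (fun B h => by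
          rw [ContinuousMap.norm_le _ (by positivity)]
          intro s
          rw [one_mul]
          exact ((B s).le_opNorm (h s)).trans (mul_le_mul (B.norm_coe_le_norm s)
            (h.norm_coe_le_norm s) (norm_nonneg _) ((norm_nonneg _).trans (B.norm_coe_le_norm s))))
  have hM : ∀ B h s, M B h s = B s (h s) := fun _ _ _ => rfl
  have hdw : Continuous (fderiv ℝ w) := hw.continuous_fderiv one_ne_zero
  -- Uniform continuity of the derivative makes the remainder in the mean value inequality small
  -- uniformly along the curve, as the supremum norm requires.
  have hu : UniformContinuous (fderiv ℝ w) :=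
    hdw.uniformContinuous_of_tendsto_cocompact (hc.fderiv ℝ).is_zero_at_infty
  rw [contDiff_one_iff_hasFDerivAt]
  refine ⟨fun α => M ((⟨fderiv ℝ w, hdw⟩ : C(E, E →L[ℝ] E)).comp α),
    M.continuous.comp (ContinuousMap.continuous_postcomp _), fun α => ?_⟩
  rw [hasFDerivAt_iff_isLittleO_nhds_zero, Asymptotics.isLittleO_iff]
  intro ε hε
  obtain ⟨δ, hδ, hδε⟩ := Metric.uniformContinuous_iff.1 hu ε hε
  filter_upwards [Metric.ball_mem_nhds (0 : C(I, E)) hδ] with h hh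
  rw [mem_ball_zero_iff] at hh
  rw [ContinuousMap.norm_le _ (by positivity)]
  intro s
  have hs : ‖h s‖ ≤ ‖h‖ := h.norm_coe_le_norm s
  have := (convex_ball (α s) δ).norm_image_sub_le_of_norm_hasFDerivWithin_le' (f := w)
    (f' := fderiv ℝ w) (φ := fderiv ℝ w (α s)) (C := ε) (x := α s) (y := α s + h s)
    (fun y _ => ((hw.differentiable one_ne_zero) y).hasFDerivAt.hasFDerivWithinAt)
    (fun y hy => by
      rw [← dist_eq_norm]
      exact (hδε (Metric.mem_ball.1 hy)).le)
    (Metric.mem_ball_self hδ) (by simpa using hs.trans_lt hh)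
  simp only [ContinuousMap.sub_apply, ContinuousMap.comp_apply, ContinuousMap.add_apply, hM,
    ContinuousMap.coe_mk]
  refine le_trans ?_ (mul_le_mul_of_nonneg_left hs hε.le)
  simpa using this

/-- Integration of continuous curves from the time `0`. -/
theorem exists_integration_clm [CompleteSpace E] :
    ∃ J : C(Set.Icc (-1 : ℝ) 1, E) →L[ℝ] C(Set.Icc (-1 : ℝ) 1, E), ∀ α s,
      J α s = ∫ r in (0 : ℝ)..s, α (Set.projIcc (-1) 1 (by norm_num) r) := by
  have hc : ∀ α : C(Set.Icc (-1 : ℝ) 1, E),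
      Continuous fun r => α (Set.projIcc (-1) 1 (by norm_num) r) := fun α =>
    α.continuous.comp continuous_projIcc
  refine ⟨LinearMap.mkContinuous
    { toFun := fun α => ⟨fun s => ∫ r in (0 : ℝ)..s, α (Set.projIcc (-1) 1 (by norm_num) r),
        (intervalIntegral.continuous_primitive (fun _ _ => (hc α).intervalIntegrable _ _) 0).comp
          continuous_subtype_val⟩
      map_add' := fun α β => ?_
      map_smul' := fun c α => ?_ } 1 fun α => ?_, fun α s => rfl⟩
  · ext s
    exact intervalIntegral.integral_add ((hc α).intervalIntegrable _ _)
      ((hc β).intervalIntegrable _ _)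
  · ext s
    exact intervalIntegral.integral_smul _ _
  · rw [ContinuousMap.norm_le _ (by positivity)]
    intro s
    have := intervalIntegral.norm_integral_le_of_norm_le_const (a := 0) (b := (s : ℝ))
      (f := fun r => α (Set.projIcc (-1) 1 (by norm_num) r)) (C := ‖α‖)
      fun r _ => α.norm_coe_le_norm _
    refine this.trans ?_
    rw [one_mul, sub_zero]
    exact mul_le_of_le_one_right (norm_nonneg _) (abs_le.2 s.2)

end ODE

/-! ### Complete flows: group property, differentiability, transport of functions -/

section ODE

variable {E : Type*} [NormedAddCommGroup E] [NormedSpace ℝ E]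

/-- `X` is a complete flow on the open set `U`, generated by the continuously differentiable
vector field `v`. -/
structure IsCompleteFlow (U : Set E) (v : E → E) (X : ℝ → E → E) : Prop where
  isOpen : IsOpen U
  field : ContDiffOn ℝ 1 v U
  mem : ∀ t, ∀ x ∈ U, X t x ∈ U
  zero : ∀ x ∈ U, X 0 x = x
  hasDerivAt : ∀ t, ∀ x ∈ U, HasDerivAt (fun τ => X τ x) (v (X t x)) t

namespace IsCompleteFlow

variable [FiniteDimensional ℝ E] {U : Set E} {v : E → E} {X : ℝ → E → E}

theorem eq_of_hasDerivAt (h : IsCompleteFlow U v X) {Y : ℝ → E} (hYU : ∀ t, Y t ∈ U)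
    (hY : ∀ t, HasDerivAt Y (v (Y t)) t) (t : ℝ) : X t (Y 0) = Y t := by
  refine ODE_solution_unique_of_contDiffOn h.isOpen h.field (t₀ := 0)
    (a := -(|t| + 1)) (b := |t| + 1) (X := fun t => X t (Y 0)) ?_
    (fun s _ => ⟨h.hasDerivAt s _ (hYU 0), h.mem s _ (hYU 0)⟩)
    (fun s _ => ⟨hY s, hYU s⟩) (h.zero _ (hYU 0)) ?_
  · have := abs_nonneg t
    constructor <;> linarith
  · constructor
    · linarith [neg_abs_le t]
    · linarith [le_abs_self t]

theorem add (h : IsCompleteFlow U v X) (s t : ℝ) {x : E} (hx : x ∈ U) :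
    X (s + t) x = X s (X t x) := by
  have := h.eq_of_hasDerivAt (Y := fun s => X (s + t) x) (fun s => h.mem _ _ hx)
    (fun s => (h.hasDerivAt (s + t) x hx).comp_add_const s t) s
  simpa using this.symm

theorem neg_apply (h : IsCompleteFlow U v X) (t : ℝ) {x : E} (hx : x ∈ U) :
    X (-t) (X t x) = x := by
  rw [← h.add _ _ hx, neg_add_cancel, h.zero _ hx]

theorem apply_neg (h : IsCompleteFlow U v X) (t : ℝ) {x : E} (hx : x ∈ U) :
    X t (X (-t) x) = x := by
  rw [← h.add _ _ hx, add_neg_cancel, h.zero _ hx]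

/-- For fixed (τ, x), the rescaled trajectory s ↦ X(τ s, x) is a zero α of α - x - τ∫w(α). At τ = 0
the derivative of this expression in α is the identity, so the implicit function theorem on the
space of curves on [-1, 1] gives a zero that depends continuously differentiably on (τ, x). -/
theorem contDiffAt_zero (h : IsCompleteFlow U v X) {x₀ : E} (hx₀ : x₀ ∈ U) :
    ContDiffAt ℝ 1 (fun z : ℝ × E => X z.1 z.2) (0, x₀) := by
  obtain ⟨r, hr, hrU⟩ := Metric.nhds_basis_closedBall.mem_iff.1 (h.isOpen.mem_nhds hx₀)
  obtain ⟨χ, -, h1, -, hw, hc⟩ :=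
    exists_contDiff_field_eqOn (isCompact_closedBall x₀ r) h.isOpen hrU h.field
  set w : E → E := fun x => χ x • v x with hwdef
  have hwv : ∀ x ∈ Metric.closedBall x₀ r, w x = v x := fun x hx => by simp [hwdef, h1 x hx]
  obtain ⟨J, hJ⟩ := exists_integration_clm (E := E)
  let I := Set.Icc (-1 : ℝ) 1
  let N : C(I, E) → C(I, E) := fun α => (⟨w, hw.continuous⟩ : C(E, E)).comp α
  have hN : ContDiff ℝ 1 N := contDiff_superposition hw hc
  let c : E →L[ℝ] C(I, E) := ContinuousLinearMap.const ℝ I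
  -- Here z = ((τ, x), α). The time τ enters as a factor, so all curves live on the same interval
  -- [-1, 1].
  let F : (ℝ × E) × C(I, E) → C(I, E) := fun z => z.2 - c z.1.2 - z.1.1 • J (N z.2)
  have hF : ContDiff ℝ 1 F := by
    have := hN.comp (contDiff_snd (𝕜 := ℝ) (E := ℝ × E) (F := C(I, E)) (n := 1))
    have h2 := J.contDiff.comp this
    exact (contDiff_snd.sub (c.contDiff.comp (contDiff_snd.comp contDiff_fst))).sub
      ((contDiff_fst.comp contDiff_fst).smul h2)
  let u : (ℝ × E) × C(I, E) := ((0, x₀), c x₀)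
  have hFu : F u = 0 := by simp [F, u]
  have hd : fderiv ℝ F u ∘L .inr ℝ (ℝ × E) C(I, E) = ContinuousLinearMap.id ℝ _ := by
    have h1 : HasFDerivAt (fun α => F ((0, x₀), α))
        (fderiv ℝ F u ∘L .inr ℝ (ℝ × E) C(I, E)) (c x₀) :=
      (hF.differentiable one_ne_zero u).hasFDerivAt.comp (c x₀) (hasFDerivAt_prodMk_right _ _)
    have h2 : HasFDerivAt (fun α => F ((0, x₀), α)) (ContinuousLinearMap.id ℝ _) (c x₀) := by
      simpa [F] using (hasFDerivAt_id (𝕜 := ℝ) (c x₀)).sub_const (c x₀)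
    exact h1.unique h2
  have hinv : (fderiv ℝ F u ∘L .inr ℝ (ℝ × E) C(I, E)).IsInvertible := by
    rw [hd]
    exact ContinuousLinearMap.isInvertible_equiv (f := ContinuousLinearEquiv.refl ℝ _)
  set ψ := hF.contDiffAt.implicitFunction one_ne_zero hinv with hψ
  have hψ0 : ψ (0, x₀) = c x₀ := hF.contDiffAt.implicitFunction_apply_self one_ne_zero hinv
  have hψc : ContDiffAt ℝ 1 ψ (0, x₀) :=
    hF.contDiffAt.contDiffAt_implicitFunction one_ne_zero hinv
  have hψe : ∀ᶠ p in 𝓝 ((0 : ℝ), x₀), F (p, ψ p) = 0 := by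
    simpa only [hFu] using hF.contDiffAt.eventually_apply_implicitFunction one_ne_zero hinv
  have hψb : ∀ᶠ p in 𝓝 ((0 : ℝ), x₀), dist (ψ p) (c x₀) < r := by
    have := hψc.continuousAt.eventually (Metric.ball_mem_nhds (ψ (0, x₀)) hr)
    simpa only [hψ0] using this
  have hpU : ∀ᶠ p in 𝓝 ((0 : ℝ), x₀), p.2 ∈ U :=
    continuousAt_snd.eventually (h.isOpen.mem_nhds hx₀)
  -- The curves are compared by uniqueness on the open interval (-1, 1), so they are evaluated at an
  -- interior point; the factor 1/2 is removed at the end by rescaling time.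
  have hhalf : (1 / 2 : ℝ) ∈ Set.Icc (-1 : ℝ) 1 := by norm_num
  have key : ∀ᶠ p in 𝓝 ((0 : ℝ), x₀), X (p.1 / 2) p.2 = ψ p ⟨1 / 2, hhalf⟩ := by
    filter_upwards [hψe, hψb, hpU] with p hp hb hp2
    let Y : ℝ → E := fun s =>
      p.2 + p.1 • ∫ r in (0 : ℝ)..s, w (ψ p (Set.projIcc (-1) 1 (by norm_num) r))
    have hYψ : ∀ s (hs : s ∈ Set.Icc (-1 : ℝ) 1), Y s = ψ p ⟨s, hs⟩ := by
      intro s hs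
      have := congrArg (fun α : C(I, E) => α ⟨s, hs⟩) hp
      simp only [F, ContinuousMap.sub_apply, ContinuousMap.smul_apply, hJ,
        ContinuousMap.zero_apply] at this
      have hcs : c p.2 ⟨s, hs⟩ = p.2 := rfl
      rw [hcs] at this
      rw [sub_sub, sub_eq_zero] at this
      exact this.symm
    have hcont : Continuous fun r => w (ψ p (Set.projIcc (-1) 1 (by norm_num) r)) :=
      hw.continuous.comp ((ψ p).continuous.comp continuous_projIcc)
    have hYb : ∀ s ∈ Set.Icc (-1 : ℝ) 1, Y s ∈ Metric.closedBall x₀ r := by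
      intro s hs
      rw [hYψ s hs]
      exact ((ContinuousMap.dist_apply_le_dist (f := ψ p) (g := c x₀) ⟨s, hs⟩).trans_lt hb).le
    have hY : ∀ s ∈ Set.Ioo (-1 : ℝ) 1, HasDerivAt Y (p.1 • v (Y s)) s := by
      intro s hs
      have hs' := Set.Ioo_subset_Icc_self hs
      have := ((intervalIntegral.integral_hasDerivAt_right (hcont.intervalIntegrable 0 s)
        (hcont.stronglyMeasurableAtFilter _ _) hcont.continuousAt).const_smul p.1).const_add p.2
      rw [Set.projIcc_of_mem _ hs', ← hYψ s hs', hwv _ (hYb s hs')] at this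
      exact this
    have := ODE_solution_unique_of_contDiffOn h.isOpen (v := fun x => p.1 • v x)
      (contDiffOn_const.smul h.field) (X := fun s => X (p.1 * s) p.2) (Y := Y)
      (a := -1) (b := 1) (t₀ := 0) (by norm_num)
      (fun s _ => ⟨by
        have h1 := (h.hasDerivAt (p.1 * s) p.2 hp2).scomp s
          (((hasDerivAt_id s).const_mul p.1))
        simpa [Function.comp_def] using h1, h.mem _ _ hp2⟩)
      (fun s hs => ⟨hY s hs, hrU (hYb s (Set.Ioo_subset_Icc_self hs))⟩)
      (by simp [Y, h.zero _ hp2]) (x := (1 / 2 : ℝ)) (by norm_num)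
    rw [← hYψ _ hhalf, ← this]
    simp [div_eq_mul_inv]
  have hL : ContDiffAt ℝ 1 (fun z : ℝ × E => X (z.1 / 2) z.2) (0, x₀) := by
    have hev : ContDiff ℝ 1 (fun α : C(I, E) => α ⟨1 / 2, hhalf⟩) :=
      (ContinuousMap.evalCLM ℝ (⟨1 / 2, hhalf⟩ : I) : C(I, E) →L[ℝ] E).contDiff
    exact (hev.contDiffAt.comp _ hψc).congr_of_eventuallyEq key
  have hscale : ContDiff ℝ 1 (fun z : ℝ × E => (2 * z.1, z.2)) := by fun_prop
  have := ContDiffAt.comp (𝕜 := ℝ) (n := 1) ((0 : ℝ), x₀) (f := fun z : ℝ × E => (2 * z.1, z.2))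
    (g := fun z : ℝ × E => X (z.1 / 2) z.2) (by simpa using hL) hscale.contDiffAt
  refine this.congr_of_eventuallyEq (Eventually.of_forall fun z => ?_)
  simp

/-- The set of times at which the flow is continuously differentiable near the given initial point
is nonempty, open and closed. It is closed because X(t) = X(t - s) ∘ X(s), where s is a good time
close to t and the first factor is covered by the case of times near 0. -/
theorem contDiffAt (h : IsCompleteFlow U v X) (t : ℝ) {x₀ : E} (hx₀ : x₀ ∈ U) :
    ContDiffAt ℝ 1 (fun z : ℝ × E => X z.1 z.2) (t, x₀) := by
  have hclopen : IsClopen {t | ContDiffAt ℝ 1 (fun z : ℝ × E => X z.1 z.2) (t, x₀)} := by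
    constructor
    · rw [isClosed_iff_clusterPt]
      intro t ht
      have hev := (h.contDiffAt_zero (h.mem t x₀ hx₀)).eventually (by simp)
      have hcont : ContinuousAt (fun s => (t - s, X s x₀)) t :=
        (continuousAt_const.sub continuousAt_id).prodMk (h.hasDerivAt t x₀ hx₀).continuousAt
      have hev' := hcont.eventually (by simpa using hev)
      rw [clusterPt_principal_iff_frequently] at ht
      obtain ⟨s, hs, hs'⟩ := (ht.and_eventually hev').exists
      have hin : ContDiffAt ℝ 1 (fun z : ℝ × E => (z.1 - s, X s z.2)) (t, x₀) := by
        refine (contDiffAt_fst.sub contDiffAt_const).prodMk ?_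
        exact ContDiffAt.comp (𝕜 := ℝ) (t, x₀) (f := fun z : ℝ × E => (s, z.2))
          (g := fun z : ℝ × E => X z.1 z.2) hs (contDiffAt_const.prodMk contDiffAt_snd)
      have := ContDiffAt.comp (𝕜 := ℝ) (t, x₀) (g := fun z : ℝ × E => X z.1 z.2) hs' hin
      refine this.congr_of_eventuallyEq ?_
      filter_upwards [continuousAt_snd.eventually (h.isOpen.mem_nhds hx₀)] with z hz
      simp only [Function.comp_apply]
      rw [← h.add _ _ hz, sub_add_cancel]
    · rw [isOpen_iff_mem_nhds]
      intro t ht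
      have hev := ContDiffAt.eventually (Set.mem_ofPred.1 ht) (by simp)
      have hcont : ContinuousAt (fun s : ℝ => (s, x₀)) t := by fun_prop
      exact hcont.eventually hev
  have := hclopen.eq_univ ⟨0, h.contDiffAt_zero hx₀⟩
  exact (Set.eq_univ_iff_forall.1 this) t

theorem contDiffOn_uncurry (h : IsCompleteFlow U v X) :
    ContDiffOn ℝ 1 (fun z : ℝ × E => X z.1 z.2) (Set.univ ×ˢ U) :=
  fun z hz => (h.contDiffAt z.1 hz.2).contDiffWithinAt

theorem continuousOn_uncurry (h : IsCompleteFlow U v X) :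
    ContinuousOn (fun z : ℝ × E => X z.1 z.2) (Set.univ ×ˢ U) :=
  h.contDiffOn_uncurry.continuousOn

theorem contDiffAt_apply (h : IsCompleteFlow U v X) (t : ℝ) {x : E} (hx : x ∈ U) :
    ContDiffAt ℝ 1 (X t) x :=
  ContDiffAt.comp (𝕜 := ℝ) x (f := fun x => (t, x)) (g := fun z : ℝ × E => X z.1 z.2)
    (h.contDiffAt t hx) (contDiffAt_const.prodMk contDiffAt_id)

/-- The derivative of `f ∘ X t` along the field. -/
theorem fderiv_comp_field (h : IsCompleteFlow U v X) (t : ℝ) {x : E} (hx : x ∈ U) {f : E → ℝ}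
    (hf : DifferentiableAt ℝ f (X t x)) :
    fderiv ℝ (fun y => f (X t y)) x (v x) = fderiv ℝ f (X t x) (v (X t x)) := by
  have hX : DifferentiableAt ℝ (X t) x := (h.contDiffAt_apply t hx).differentiableAt one_ne_zero
  -- The curve X(t, X(s, x)) = X(t + s, x) is differentiated at s = 0 in two ways: by the chain rule
  -- and as a trajectory. The comparison shows that the flow carries the field to itself.
  have h1 : HasDerivAt (fun s => X t (X s x)) (fderiv ℝ (X t) x (v x)) 0 := by
    have h0 := h.hasDerivAt 0 x hx
    have hX' := hX.hasFDerivAt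
    rw [← h.zero x hx] at hX'
    have := hX'.comp_hasDerivAt (0 : ℝ) h0
    rw [h.zero x hx] at this
    exact this
  have h2 : HasDerivAt (fun s => X t (X s x)) (v (X t x)) 0 := by
    have h0 : HasDerivAt (fun τ => X τ x) (v (X t x)) (t + 0) := by
      simpa using h.hasDerivAt t x hx
    have := h0.comp_const_add t 0
    refine this.congr_of_eventuallyEq (Eventually.of_forall fun s => ?_)
    exact (h.add t s hx).symm
  have h3 : fderiv ℝ (X t) x (v x) = v (X t x) := h1.unique h2
  have := (hf.hasFDerivAt.comp x hX.hasFDerivAt).fderiv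
  rw [show (fun y => f (X t y)) = f ∘ X t from rfl, this, ContinuousLinearMap.comp_apply, h3]

theorem hasDerivAt_comp (h : IsCompleteFlow U v X) (t : ℝ) {x : E} (hx : x ∈ U) {f : E → ℝ}
    (hf : DifferentiableAt ℝ f (X t x)) :
    HasDerivAt (fun τ => f (X τ x)) (fderiv ℝ f (X t x) (v (X t x))) t :=
  hf.hasFDerivAt.comp_hasDerivAt t (h.hasDerivAt t x hx)

/-- A compact set outside of which all `f ∘ X t`, `t ∈ [a, b]`, vanish. -/
theorem exists_isCompact (h : IsCompleteFlow U v X) (hoff : ∀ t, ∀ x ∉ U, X t x = x) {f : E → ℝ}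
    (hf : HasCompactSupport f) (hfU : tsupport f ⊆ U) (a b : ℝ) :
    ∃ K ⊆ U, IsCompact K ∧ ∀ t ∈ Set.Icc a b, ∀ x ∉ K, X t x ∉ tsupport f := by
  -- If X(t, x) lies in the support, then x = X(-t, X(t, x)) lies in the image of the support under
  -- the inverse flow. Points outside U do not move and thus never reach the support.
  refine ⟨(fun z : ℝ × E => X z.1 z.2) '' (Set.Icc (-b) (-a) ×ˢ tsupport f), ?_, ?_, ?_⟩
  · rintro _ ⟨z, hz, rfl⟩
    exact h.mem _ _ (hfU hz.2)
  · refine (isCompact_Icc.prod hf).image_of_continuousOn (h.continuousOn_uncurry.mono ?_)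
    exact Set.prod_mono (Set.subset_univ _) hfU
  · intro t ht x hx hXt
    have hxU : x ∈ U := by
      by_contra hxU
      rw [hoff t x hxU] at hXt
      exact hxU (hfU hXt)
    refine hx ⟨(-t, X t x), ⟨⟨?_, ?_⟩, hXt⟩, h.neg_apply t hxU⟩
    · exact neg_le_neg ht.2
    · exact neg_le_neg ht.1

/-- Test functions on U stay test functions under the flow, so a transported test function may be
inserted into weak equations. -/
theorem test_comp (h : IsCompleteFlow U v X) (hoff : ∀ t, ∀ x ∉ U, X t x = x) {f : E → ℝ}
    (hf1 : ContDiff ℝ 1 f) (hf : HasCompactSupport f) (hfU : tsupport f ⊆ U) (t : ℝ) :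
    ContDiff ℝ 1 (fun x => f (X t x)) ∧ HasCompactSupport (fun x => f (X t x)) ∧
      tsupport (fun x => f (X t x)) ⊆ U := by
  obtain ⟨K, hKU, hK, hK0⟩ := h.exists_isCompact hoff hf hfU t t
  have hsupp : tsupport (fun x => f (X t x)) ⊆ K := by
    refine closure_minimal (fun x hx => ?_) hK.isClosed
    by_contra hxK
    exact hx (image_eq_zero_of_notMem_tsupport (hK0 t ⟨le_rfl, le_rfl⟩ x hxK))
  refine ⟨?_, hK.of_isClosed_subset (isClosed_tsupport _) hsupp, hsupp.trans hKU⟩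
  refine contDiff_of_contDiffOn_of_tsupport h.isOpen (fun x hx => ?_) (hsupp.trans hKU)
  exact (hf1.contDiffAt.comp x (h.contDiffAt_apply t hx)).contDiffWithinAt

/-- The derivative of `f` along the field, transported by the flow, is jointly continuous. -/
theorem continuousOn_fderiv_comp (h : IsCompleteFlow U v X) {f : E → ℝ} (hf1 : ContDiff ℝ 1 f) :
    ContinuousOn (fun z : ℝ × E => fderiv ℝ f (X z.1 z.2) (v (X z.1 z.2))) (Set.univ ×ˢ U) := by
  have hv : ContinuousOn (fun z : ℝ × E => v (X z.1 z.2)) (Set.univ ×ˢ U) :=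
    h.field.continuousOn.comp h.continuousOn_uncurry fun z hz => h.mem _ _ hz.2
  exact (((hf1.continuous_fderiv one_ne_zero).comp_continuousOn h.continuousOn_uncurry)).clm_apply
    hv

end IsCompleteFlow

end ODE

/-! ### Invariance of volume and the weak transport equation -/

section Transport

variable {E : Type*} [NormedAddCommGroup E] [NormedSpace ℝ E] [MeasurableSpace E] [BorelSpace E]
  {μ : Measure E}

theorem integrable_of_continuousOn_of_eq_zero [IsFiniteMeasureOnCompacts μ] {K : Set E}
    (hK : IsCompact K) {G : E → ℝ} (hG : ContinuousOn G K) (h0 : ∀ x ∉ K, G x = 0) :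
    Integrable G μ := by
  rw [← integrableOn_iff_integrable_of_support_subset (s := K)]
  · exact hG.integrableOn_compact hK
  · intro x hx
    by_contra h
    exact hx (h0 x h)

/-- Differentiation under the integral sign for integrands that vanish outside a compact set. -/
theorem hasDerivAt_integral_of_isCompact [IsFiniteMeasureOnCompacts μ] {K : Set E}
    (hK : IsCompact K) {F F' : ℝ → E → ℝ} {a b t₀ : ℝ} (ht₀ : t₀ ∈ Set.Ioo a b)
    (hF : ∀ t ∈ Set.Ioo a b, ContinuousOn (F t) K)
    (hF' : ContinuousOn (fun z : ℝ × E => F' z.1 z.2) (Set.Icc a b ×ˢ K))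
    (hF0 : ∀ t ∈ Set.Ioo a b, ∀ x ∉ K, F t x = 0) (hF'0 : ∀ t ∈ Set.Ioo a b, ∀ x ∉ K, F' t x = 0)
    (hd : ∀ t ∈ Set.Ioo a b, ∀ x ∈ K, HasDerivAt (fun τ => F τ x) (F' t x) t) :
    HasDerivAt (fun t => ∫ x, F t x ∂μ) (∫ x, F' t₀ x ∂μ) t₀ := by
  obtain ⟨C, hC⟩ := (isCompact_Icc.prod hK).exists_bound_of_continuousOn hF'
  have hnhds : Set.Ioo a b ∈ 𝓝 t₀ := Ioo_mem_nhds ht₀.1 ht₀.2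
  have hint : ∀ t ∈ Set.Ioo a b, Integrable (F t) μ := fun t ht =>
    integrable_of_continuousOn_of_eq_zero hK (hF t ht) (hF0 t ht)
  have hF'c : ContinuousOn (F' t₀) K :=
    hF'.comp (continuousOn_const.prodMk continuousOn_id)
      fun x hx => ⟨Set.Ioo_subset_Icc_self ht₀, hx⟩
  refine (hasDerivAt_integral_of_dominated_loc_of_deriv_le (bound := K.indicator fun _ => C)
    hnhds ?_ (hint t₀ ht₀) ?_ ?_ ?_ ?_).2
  · filter_upwards [hnhds] with t ht using (hint t ht).aestronglyMeasurable
  · exact (integrable_of_continuousOn_of_eq_zero hK hF'c (hF'0 t₀ ht₀)).aestronglyMeasurable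
  · refine Eventually.of_forall fun x t ht => ?_
    by_cases hx : x ∈ K
    · rw [Set.indicator_of_mem hx]
      exact hC (t, x) ⟨Set.Ioo_subset_Icc_self ht, hx⟩
    · rw [Set.indicator_of_notMem hx, hF'0 t ht x hx, norm_zero]
  · rw [integrable_indicator_iff hK.measurableSet]
    exact continuousOn_const.integrableOn_compact hK
  · refine Eventually.of_forall fun x t ht => ?_
    by_cases hx : x ∈ K
    · exact hd t ht x hx
    · rw [hF'0 t ht x hx]
      refine (hasDerivAt_const t (0 : ℝ)).congr_of_eventuallyEq ?_
      filter_upwards [Ioo_mem_nhds ht.1 ht.2] with s hs using hF0 s hs x hx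

namespace IsCompleteFlow

variable [FiniteDimensional ℝ E] {U : Set E} {v : E → E} {X : ℝ → E → E}

/-- The time derivative of the integral of f ∘ X(t) is the integral of the derivative of f ∘ X(t)
along the field. As f ∘ X(t) is again a test function, this vanishes by the weak form of vanishing
divergence, which needs no derivative of the field. -/
theorem integral_comp_of_test [IsFiniteMeasureOnCompacts μ] (h : IsCompleteFlow U v X)
    (hoff : ∀ t, ∀ x ∉ U, X t x = x)
    (hdiv : ∀ g : E → ℝ, ContDiff ℝ 1 g → HasCompactSupport g → tsupport g ⊆ U →
      ∫ x, fderiv ℝ g x (v x) ∂μ = 0) {f : E → ℝ}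
    (hf1 : ContDiff ℝ 1 f) (hf : HasCompactSupport f) (hfU : tsupport f ⊆ U) (t : ℝ) :
    ∫ x, f (X t x) ∂μ = ∫ x, f x ∂μ := by
  have hd : ∀ t, HasDerivAt (fun t => ∫ x, f (X t x) ∂μ) 0 t := by
    intro t
    obtain ⟨K, hKU, hK, hK0⟩ := h.exists_isCompact hoff hf hfU (t - 1) (t + 1)
    have hz : ∀ s ∈ Set.Ioo (t - 1) (t + 1), ∀ x ∉ K, fderiv ℝ f (X s x) = 0 := fun s hs x hx =>
      fderiv_of_notMem_tsupport ℝ (hK0 s (Set.Ioo_subset_Icc_self hs) x hx)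
    have := hasDerivAt_integral_of_isCompact (μ := μ) hK (F := fun t x => f (X t x))
      (F' := fun t x => fderiv ℝ f (X t x) (v (X t x))) (a := t - 1) (b := t + 1) (t₀ := t)
      (by simp)
      (fun s _ => hf1.continuous.comp_continuousOn fun x hx =>
        (h.contDiffAt_apply s (hKU hx)).continuousAt.continuousWithinAt)
      ((h.continuousOn_fderiv_comp hf1).mono (Set.prod_mono (Set.subset_univ _) hKU))
      (fun s hs x hx =>
        image_eq_zero_of_notMem_tsupport (hK0 s (Set.Ioo_subset_Icc_self hs) x hx))
      (fun s hs x hx => by rw [hz s hs x hx]; rfl)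
      (fun s _ x hx => h.hasDerivAt_comp s (hKU hx) (hf1.differentiable one_ne_zero _))
    have hzero : ∫ x, fderiv ℝ f (X t x) (v (X t x)) ∂μ = 0 := by
      obtain ⟨h1, h2, h3⟩ := h.test_comp hoff hf1 hf hfU t
      rw [← hdiv _ h1 h2 h3]
      congr 1
      ext x
      by_cases hx : x ∈ U
      · exact (h.fderiv_comp_field t hx (hf1.differentiable one_ne_zero _)).symm
      · rw [fderiv_of_notMem_tsupport ℝ fun hx' => hx (h3 hx'), hoff t x hx,
          fderiv_of_notMem_tsupport ℝ fun hx' => hx (hfU hx')]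
    rwa [hzero] at this
  have hc := is_const_of_deriv_eq_zero (fun t => (hd t).differentiableAt)
    (fun t => (hd t).deriv) t 0
  rw [hc]
  congr 1
  ext x
  by_cases hx : x ∈ U
  · rw [h.zero x hx]
  · rw [hoff 0 x hx]

/-- Liouville's theorem: the flow of a divergence-free field preserves the volume. -/
theorem setIntegral_comp [μ.IsAddHaarMeasure] (h : IsCompleteFlow U v X)
    (hoff : ∀ t, ∀ x ∉ U, X t x = x)
    (hdiv : ∀ g : E → ℝ, ContDiff ℝ 1 g → HasCompactSupport g → tsupport g ⊆ U →
      ∫ x, fderiv ℝ g x (v x) ∂μ = 0) (t : ℝ) (G : E → ℝ) :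
    ∫ x in U, G (X t x) ∂μ = ∫ x in U, G x ∂μ := by
  have himg : X t '' U = U := by
    refine Set.Subset.antisymm ?_ fun x hx => ⟨X (-t) x, h.mem _ _ hx, h.apply_neg t hx⟩
    rintro _ ⟨x, hx, rfl⟩
    exact h.mem _ _ hx
  have hinj : Set.InjOn (X t) U := fun x hx y hy hxy => by
    rw [← h.neg_apply t hx, hxy, h.neg_apply t hy]
  have hder : ∀ x ∈ U, HasFDerivWithinAt (X t) (fderiv ℝ (X t) x) U x := fun x hx =>
    ((h.contDiffAt_apply t hx).differentiableAt one_ne_zero).hasFDerivAt.hasFDerivWithinAt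
  have hcv : ∀ G : E → ℝ,
      ∫ x in U, G x ∂μ = ∫ x in U, |(fderiv ℝ (X t) x).det| • G (X t x) ∂μ := by
    intro G
    have := integral_image_eq_integral_abs_det_fderiv_smul μ h.isOpen.measurableSet hder hinj G
    rwa [himg] at this
  have hJc0 : ContinuousOn (fun x => |(fderiv ℝ (X t) x).det|) U := by
    have h1 : ContinuousOn (fderiv ℝ (X t)) U := by
      have : ContDiffOn ℝ 1 (X t) U := fun x hx => (h.contDiffAt_apply t hx).contDiffWithinAt
      exact this.continuousOn_fderiv_of_isOpen h.isOpen le_rfl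
    exact (ContinuousLinearMap.continuous_det.comp_continuousOn h1).abs
  have hJc : ContinuousOn (fun x => |(fderiv ℝ (X t) x).det| - 1) U :=
    hJc0.sub continuousOn_const
  -- The change of variables applied to g ∘ X(-t), whose integral equals that of g by the previous
  -- result for test functions, shows that |det DX(t)| - 1 is orthogonal to all test functions g.
  have hJ : ∀ᵐ x ∂μ, x ∈ U → |(fderiv ℝ (X t) x).det| - 1 = 0 := by
    refine h.isOpen.ae_eq_zero_of_integral_contDiff_smul_eq_zero
      (hJc.locallyIntegrableOn h.isOpen.measurableSet) fun g hg hgc hgU => ?_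
    have hg1 : ContDiff ℝ 1 g := hg.of_le (by simp)
    have hgs : ∀ x ∉ U, g x = 0 := fun x hx =>
      image_eq_zero_of_notMem_tsupport fun hx' => hx (hgU hx')
    have e1 : ∫ x in U, |(fderiv ℝ (X t) x).det| • g x ∂μ = ∫ x in U, g x ∂μ := by
      have h1 := hcv fun y => g (X (-t) y)
      rw [setIntegral_eq_integral_of_forall_compl_eq_zero
        (fun x hx => by rw [hoff _ x hx, hgs x hx]),
        h.integral_comp_of_test hoff hdiv hg1 hgc hgU] at h1
      rw [setIntegral_eq_integral_of_forall_compl_eq_zero hgs, h1]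
      refine setIntegral_congr_fun h.isOpen.measurableSet fun x hx => ?_
      simp only [h.neg_apply t hx]
    rw [← setIntegral_eq_integral_of_forall_compl_eq_zero (s := U)
      (fun x hx => by rw [hgs x hx, zero_smul])]
    have i1 : Integrable (fun x => |(fderiv ℝ (X t) x).det| • g x) (μ.restrict U) := by
      refine (integrable_of_continuousOn_of_eq_zero hgc ?_ ?_).restrict
      · exact (hJc0.mono hgU).smul hg.continuous.continuousOn
      · intro x hx
        rw [image_eq_zero_of_notMem_tsupport hx, smul_zero]
    have i2 : Integrable g (μ.restrict U) :=
      (hg.continuous.integrable_of_hasCompactSupport hgc).restrict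
    have := integral_sub i1 i2
    rw [e1, sub_self] at this
    rw [← this]
    congr 1
    ext x
    simp only [smul_eq_mul]
    ring
  rw [hcv G]
  refine integral_congr_ae ?_
  filter_upwards [(ae_restrict_iff' h.isOpen.measurableSet).2 hJ] with x hx
  rw [sub_eq_zero.1 hx, one_smul]

/-- Weak form of the transport equation for `b ∘ X t`. -/
theorem hasDerivAt_integral_comp_mul [μ.IsAddHaarMeasure] (h : IsCompleteFlow U v X)
    (hoff : ∀ t, ∀ x ∉ U, X t x = x)
    (hdiv : ∀ g : E → ℝ, ContDiff ℝ 1 g → HasCompactSupport g → tsupport g ⊆ U →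
      ∫ x, fderiv ℝ g x (v x) ∂μ = 0) {b f : E → ℝ} (hb : ContinuousOn b U)
    (hf1 : ContDiff ℝ 1 f) (hf : HasCompactSupport f) (hfU : tsupport f ⊆ U) (t : ℝ) :
    HasDerivAt (fun τ => ∫ x, b (X τ x) * f x ∂μ)
      (∫ x, b (X t x) * -(fderiv ℝ f x (v x)) ∂μ) t := by
  have hf0 : ∀ x ∉ U, f x = 0 := fun x hx =>
    image_eq_zero_of_notMem_tsupport fun hx' => hx (hfU hx')
  have hdf0 : ∀ x ∉ U, fderiv ℝ f x = 0 := fun x hx =>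
    fderiv_of_notMem_tsupport ℝ fun hx' => hx (hfU hx')
  -- Since b is merely continuous, b ∘ X(s) cannot be differentiated in time pointwise. Invariance
  -- of volume moves the flow to the regular factor.
  have move : ∀ (s : ℝ) (g : E → ℝ), (∀ x ∉ U, g x = 0) →
      ∫ x, b (X s x) * g x ∂μ = ∫ x, b x * g (X (-s) x) ∂μ := by
    intro s g hg
    rw [← setIntegral_eq_integral_of_forall_compl_eq_zero (s := U)
        (fun x hx => by rw [hg x hx, mul_zero]),
      ← setIntegral_eq_integral_of_forall_compl_eq_zero (s := U) (f := fun x => b x * g (X (-s) x))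
        (fun x hx => by rw [hoff _ x hx, hg x hx, mul_zero]),
      ← h.setIntegral_comp hoff hdiv s fun x => b x * g (X (-s) x)]
    refine setIntegral_congr_fun h.isOpen.measurableSet fun x hx => ?_
    simp only [h.neg_apply s hx]
  rw [move t (fun x => -(fderiv ℝ f x (v x))) (fun x hx => by rw [hdf0 x hx]; simp)]
  simp only [fun s => move s f hf0]
  obtain ⟨K, hKU, hK, hK0⟩ := h.exists_isCompact hoff hf hfU (-t - 1) (-t + 1)
  have hmem : ∀ s ∈ Set.Ioo (t - 1) (t + 1), -s ∈ Set.Icc (-t - 1) (-t + 1) := fun s hs =>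
    ⟨by linarith [hs.2], by linarith [hs.1]⟩
  refine hasDerivAt_integral_of_isCompact (μ := μ) hK (F := fun t x => b x * f (X (-t) x))
      (F' := fun t x => b x * -(fderiv ℝ f (X (-t) x) (v (X (-t) x))))
      (a := t - 1) (b := t + 1) (t₀ := t) (by simp) ?_ ?_ ?_ ?_ ?_
  · exact fun s _ => (hb.mono hKU).mul <| hf1.continuous.comp_continuousOn fun x hx =>
        (h.contDiffAt_apply _ (hKU hx)).continuousAt.continuousWithinAt
  · refine ContinuousOn.mul ?_ (ContinuousOn.neg ?_)
    · exact hb.comp continuousOn_snd fun z hz => hKU hz.2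
    · refine (h.continuousOn_fderiv_comp hf1).comp (f := fun z : ℝ × E => (-z.1, z.2))
        (by fun_prop) fun z hz => ⟨trivial, hKU hz.2⟩
  · intro s hs x hx
    simp only [image_eq_zero_of_notMem_tsupport (hK0 _ (hmem s hs) x hx), mul_zero]
  · intro s hs x hx
    simp [fderiv_of_notMem_tsupport ℝ (hK0 _ (hmem s hs) x hx)]
  · intro s hs x hx
    have h1 := h.hasDerivAt_comp (-s) (hKU hx) (hf1.differentiable one_ne_zero (X (-s) x))
    have := (HasDerivAt.comp s h1 (hasDerivAt_neg s)).const_mul (b x)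
    rwa [mul_neg_one] at this

/-- Uniqueness for the weak form of the transport equation. -/
theorem eq_zero_of_hasDerivAt_integral [μ.IsAddHaarMeasure] (h : IsCompleteFlow U v X)
    (hoff : ∀ t, ∀ x ∉ U, X t x = x) {D : ℝ → E → ℝ}
    (hD : ContinuousOn (fun z : ℝ × E => D z.1 z.2) (Set.univ ×ˢ U)) (hD0 : ∀ x ∈ U, D 0 x = 0)
    (hw : ∀ f : E → ℝ, ContDiff ℝ 1 f → HasCompactSupport f → tsupport f ⊆ U → ∀ t,
      HasDerivAt (fun τ => ∫ x, D τ x * f x ∂μ) (∫ x, D t x * -(fderiv ℝ f x (v x)) ∂μ) t)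
    (T : ℝ) {x : E} (hx : x ∈ U) : D T x = 0 := by
  have hDx : ∀ x ∈ U, Continuous fun t => D t x := fun x hx => by
    rw [← continuousOn_univ]
    exact hD.comp (continuousOn_id.prodMk continuousOn_const) fun t ht => ⟨trivial, hx⟩
  have hDt : ∀ t, ContinuousOn (D t) U := fun t =>
    hD.comp (continuousOn_const.prodMk continuousOn_id) fun x hx => ⟨trivial, hx⟩
  have key : ∀ f : E → ℝ, ContDiff ℝ 1 f → HasCompactSupport f → tsupport f ⊆ U →
      ∫ x, D T x * f x ∂μ = 0 := by
    intro f hf1 hf hfU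
    have hdf0 : ∀ x ∉ U, fderiv ℝ f x = 0 := fun x hx =>
      fderiv_of_notMem_tsupport ℝ fun hx' => hx (hfU hx')
    -- The pairing of D(t) with the test function f ∘ X(t - T) does not change in time: it is the
    -- required pairing with f at t = T and vanishes at t = 0. This is the duality argument for
    -- uniqueness.
    have hd : ∀ t, HasDerivAt (fun t => ∫ x, D t x * f (X (t - T) x) ∂μ) 0 t := by
      intro t
      obtain ⟨K, hKU, hK, hK0⟩ := h.exists_isCompact hoff hf hfU (t - 1 - T) (t + 1 - T)
      have hmem : ∀ s ∈ Set.Icc (t - 1) (t + 1), s - T ∈ Set.Icc (t - 1 - T) (t + 1 - T) :=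
        fun s hs => ⟨by linarith [hs.1], by linarith [hs.2]⟩
      have htmem : t ∈ Set.Icc (t - 1) (t + 1) := by simp
      have hf0 : ∀ s ∈ Set.Icc (t - 1) (t + 1), ∀ x ∉ K, f (X (s - T) x) = 0 := fun s hs x hx =>
        image_eq_zero_of_notMem_tsupport (hK0 _ (hmem s hs) x hx)
      obtain ⟨h1, h2, h3⟩ := h.test_comp hoff hf1 hf hfU (t - T)
      have hA := hw _ h1 h2 h3 t
      have hKp : Set.Icc (t - 1) (t + 1) ×ˢ K ⊆ Set.univ ×ˢ U :=
        Set.prod_mono (Set.subset_univ _) hKU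
      obtain ⟨C, hC⟩ := (isCompact_Icc.prod hK).exists_bound_of_continuousOn (hD.mono hKp)
      have hcd : ContinuousOn
          (fun z : ℝ × E => fderiv ℝ f (X (z.1 - T) z.2) (v (X (z.1 - T) z.2)))
          (Set.Icc (t - 1) (t + 1) ×ˢ K) :=
        (h.continuousOn_fderiv_comp hf1).comp (f := fun z : ℝ × E => (z.1 - T, z.2))
          (by fun_prop) fun z hz => ⟨trivial, hKU hz.2⟩
      obtain ⟨C', hC'⟩ := (isCompact_Icc.prod hK).exists_bound_of_continuousOn hcd
      have hfd : ∀ x ∈ U, ∀ s, HasDerivAt (fun s => f (X (s - T) x))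
          (fderiv ℝ f (X (s - T) x) (v (X (s - T) x))) s := fun x hx s =>
        (h.hasDerivAt_comp (s - T) hx
          (hf1.differentiable one_ne_zero (X (s - T) x))).comp_sub_const s T
      have hcf : ∀ s, ContinuousOn (fun x => f (X (s - T) x)) U := fun s =>
        hf1.continuous.comp_continuousOn fun x hx =>
          (h.contDiffAt_apply _ hx).continuousAt.continuousWithinAt
      -- Product rule with D only continuous in time: the weak equation gives the derivative with
      -- the test function frozen at time t, and this is the derivative of what is left. The frozen
      -- difference vanishes at s = t, so only D(t) enters the limit.
      have hB : HasDerivAt (fun s => ∫ x, D s x * (f (X (s - T) x) - f (X (t - T) x)) ∂μ)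
          (∫ x, D t x * fderiv ℝ f (X (t - T) x) (v (X (t - T) x)) ∂μ) t := by
        rw [hasDerivAt_iff_tendsto_slope]
        have hev : ∀ᶠ s in 𝓝[≠] t, s ∈ Set.Icc (t - 1) (t + 1) ∧ s ≠ t := by
          refine (Filter.Eventually.and ?_ self_mem_nhdsWithin)
          exact nhdsWithin_le_nhds (Icc_mem_nhds (by linarith) (by linarith))
        have hslope : (slope (fun s => ∫ x, D s x * (f (X (s - T) x) - f (X (t - T) x)) ∂μ) t) =
            fun s => ∫ x, D s x * slope (fun s => f (X (s - T) x)) t s ∂μ := by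
          ext s
          simp only [slope_def_field, sub_self, mul_zero, integral_zero, sub_zero]
          rw [← integral_div]
          simp only [mul_div_assoc]
        rw [hslope]
        refine tendsto_integral_filter_of_dominated_convergence (K.indicator fun _ => C * C')
          ?_ ?_ ?_ ?_
        · filter_upwards [hev] with s hs
          refine (integrable_of_continuousOn_of_eq_zero hK ?_ ?_).aestronglyMeasurable
          · simp only [slope_def_field]
            exact ((hDt s).mono hKU).mul ((((hcf s).sub (hcf t)).mono hKU).div_const _)
          · intro x hx
            simp [slope_def_field, hf0 s hs.1 x hx, hf0 t htmem x hx]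
        · filter_upwards [hev] with s hs
          refine Eventually.of_forall fun x => ?_
          by_cases hx : x ∈ K
          · rw [Set.indicator_of_mem hx, norm_mul]
            refine mul_le_mul (hC (s, x) ⟨hs.1, hx⟩) ?_ (norm_nonneg _)
              ((norm_nonneg _).trans (hC (s, x) ⟨hs.1, hx⟩))
            have := (convex_Icc (t - 1) (t + 1)).norm_image_sub_le_of_norm_hasDerivWithin_le
              (f := fun s => f (X (s - T) x)) (C := C')
              (fun s _ => (hfd x (hKU hx) s).hasDerivWithinAt)
              (fun s hs => hC' (s, x) ⟨hs, hx⟩) htmem hs.1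
            rw [slope_def_field, norm_div]
            exact div_le_of_le_mul₀ (norm_nonneg _)
              ((norm_nonneg _).trans (hC' (s, x) ⟨hs.1, hx⟩)) this
          · simp [hx, slope_def_field, hf0 s hs.1 x hx, hf0 t htmem x hx]
        · rw [integrable_indicator_iff hK.measurableSet]
          exact continuousOn_const.integrableOn_compact hK
        · refine Eventually.of_forall fun x => ?_
          by_cases hx : x ∈ U
          · exact (((hDx x hx).tendsto t).mono_left nhdsWithin_le_nhds).mul
              ((hasDerivAt_iff_tendsto_slope.1 (hfd x hx t)))
          · simp [slope_def_field, hoff _ x hx, hdf0 x hx]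
      have hAB := hA.add hB
      have hz : (∫ x, D t x * -(fderiv ℝ (fun y => f (X (t - T) y)) x (v x)) ∂μ) +
          ∫ x, D t x * fderiv ℝ f (X (t - T) x) (v (X (t - T) x)) ∂μ = 0 := by
        have : ∀ x, fderiv ℝ (fun y => f (X (t - T) y)) x (v x) =
            fderiv ℝ f (X (t - T) x) (v (X (t - T) x)) := by
          intro x
          by_cases hx : x ∈ U
          · exact h.fderiv_comp_field _ hx (hf1.differentiable one_ne_zero _)
          · rw [fderiv_of_notMem_tsupport ℝ fun hx' => hx (h3 hx'), hoff _ x hx, hdf0 x hx]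
        simp only [this, mul_neg, integral_neg, neg_add_cancel]
      rw [hz] at hAB
      refine hAB.congr_of_eventuallyEq ?_
      filter_upwards [Icc_mem_nhds (show t - 1 < t by linarith) (show t < t + 1 by linarith)]
        with s hs
      simp only [Pi.add_apply]
      rw [← integral_add]
      · congr 1
        ext x
        ring
      · refine integrable_of_continuousOn_of_eq_zero hK (((hDt s).mul (hcf t)).mono hKU) ?_
        intro x hx
        rw [hf0 t htmem x hx, mul_zero]
      · refine integrable_of_continuousOn_of_eq_zero hK
          (((hDt s).mul ((hcf s).sub (hcf t))).mono hKU) ?_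
        intro x hx
        rw [hf0 t htmem x hx, hf0 s hs x hx, sub_self, mul_zero]
    have hc := is_const_of_deriv_eq_zero (fun t => (hd t).differentiableAt)
      (fun t => (hd t).deriv) T 0
    simp only [sub_self] at hc
    have e1 : ∫ x, D T x * f (X 0 x) ∂μ = ∫ x, D T x * f x ∂μ := by
      congr 1
      ext x
      by_cases hx : x ∈ U
      · rw [h.zero x hx]
      · rw [hoff 0 x hx]
    rw [← e1, hc]
    refine integral_eq_zero_of_ae (Eventually.of_forall fun x => ?_)
    by_cases hx : x ∈ U
    · simp [hD0 x hx]
    · simp [hoff _ x hx, image_eq_zero_of_notMem_tsupport fun hx' => hx (hfU hx')]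
  have hae : ∀ᵐ x ∂μ, x ∈ U → D T x = 0 := by
    refine h.isOpen.ae_eq_zero_of_integral_contDiff_smul_eq_zero
      ((hDt T).locallyIntegrableOn h.isOpen.measurableSet) fun g hg hgc hgU => ?_
    rw [← key g (hg.of_le (by simp)) hgc hgU]
    simp [mul_comm]
  have hae' : D T =ᵐ[μ.restrict U] fun _ => 0 :=
    (ae_restrict_iff' h.isOpen.measurableSet).2 hae
  exact Measure.eqOn_open_of_ae_eq hae' h.isOpen (hDt T) continuousOn_const hx

end IsCompleteFlow

end Transport

namespace TopInt

/-! ### Groups of consecutive particles -/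

section Window

/-- `window` as a continuous linear map. -/
noncomputable def windowL (N o k : ℕ) : Phase N →L[ℝ] Phase k :=
  LinearMap.toContinuousLinearMap
    { toFun := window o k
      map_add' := fun x y => by
        ext j <;> simp only [window, Prod.fst_add, Prod.snd_add, Pi.add_apply] <;> split_ifs <;>
          simp
      map_smul' := fun c x => by
        ext j <;> simp only [window, Prod.smul_fst, Prod.smul_snd, Pi.smul_apply] <;>
          split_ifs <;> simp }

theorem contDiff_window {N : ℕ} (o k : ℕ) {n : WithTop ℕ∞} :
    ContDiff ℝ n (window o k : Phase N → Phase k) :=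
  (windowL N o k).contDiff

theorem continuous_window {N : ℕ} (o k : ℕ) : Continuous (window o k : Phase N → Phase k) :=
  (windowL N o k).continuous

theorem window_fst {N : ℕ} {o k : ℕ} (x : Phase N) (j : Fin k) (h : o + j < N) :
    (window o k x).1 j = x.1 ⟨o + j, h⟩ := by
  simp [window, h]

theorem window_snd {N : ℕ} {o k : ℕ} (x : Phase N) (j : Fin k) (h : o + j < N) :
    (window o k x).2 j = x.2 ⟨o + j, h⟩ := by
  simp [window, h]

theorem window_window {N : ℕ} {o k o' k' : ℕ} (h : o' + k' ≤ k) (x : Phase N) :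
    window o' k' (window o k x) = window (o + o') k' x := by
  ext j
  · have : o' + (j : ℕ) < k := by have := j.2; omega
    simp [window, this, add_assoc]
  · have : o' + (j : ℕ) < k := by have := j.2; omega
    simp [window, this, add_assoc]

theorem window_zero_self {N : ℕ} (x : Phase N) : window 0 N x = x := by
  ext j
  · rw [window_fst x j (by simp)]
    simp
  · rw [window_snd x j (by simp)]
    simp

theorem window_mem_allowed {σ : ℝ} {N o k : ℕ} (h : o + k ≤ N) {x : Phase N}
    (hx : x ∈ Allowed σ N) : window o k x ∈ Allowed σ k := by
  intro j hj
  rw [window_fst x ⟨j, by omega⟩ (by simp only; omega),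
    window_fst x ⟨j + 1, hj⟩ (by simp only; omega)]
  exact hx (o + j) (by omega)

theorem isOpen_allowed (σ : ℝ) (N : ℕ) : IsOpen (Allowed σ N) := by
  have : Allowed σ N = ⋂ j : Fin (N - 1), {x : Phase N |
      x.1 ⟨j, by omega⟩ + σ < x.1 ⟨j + 1, by omega⟩} := by
    ext x
    simp only [Set.mem_iInter, Allowed]
    exact ⟨fun h j => h j (by omega), fun h j hj => h ⟨j, by omega⟩⟩
  rw [this]
  refine isOpen_iInter_of_finite fun j => isOpen_lt ?_ ?_ <;> fun_prop

/-- The particle in position `j` of a window that starts in position `o`. -/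
def shift {o m N : ℕ} (h : o + m ≤ N) (j : Fin m) : Fin N := ⟨o + j, by omega⟩

/-- Configurations of the window as configurations of all particles, zero outside the window. -/
noncomputable def embed {o m N : ℕ} (h : o + m ≤ N) : Phase m →L[ℝ] Phase N :=
  ∑ j : Fin m,
    (((ContinuousLinearMap.proj j).comp (ContinuousLinearMap.fst ℝ (Fin m → ℝ) (Fin m → ℝ))).smulRight
        ((Pi.single (shift h j) 1, 0) : Phase N) +
      ((ContinuousLinearMap.proj j).comp (ContinuousLinearMap.snd ℝ (Fin m → ℝ) (Fin m → ℝ))).smulRight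
        ((0, Pi.single (shift h j) 1) : Phase N))

theorem embed_apply {o m N : ℕ} (h : o + m ≤ N) (y : Phase m) :
    embed h y = ∑ j : Fin m, (y.1 j • ((Pi.single (shift h j) 1, 0) : Phase N) +
      y.2 j • ((0, Pi.single (shift h j) 1) : Phase N)) := by
  simp [embed]

theorem fderiv_embed {o m N : ℕ} (h : o + m ≤ N) (y : Phase m) (f : Phase N → ℝ) (x : Phase N) :
    fderiv ℝ f x (embed h y) =
      ∑ j : Fin m, (y.1 j * dq (shift h j) f x + y.2 j * dp (shift h j) f x) := by
  rw [embed_apply, map_sum]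
  simp only [map_add, map_smul, smul_eq_mul, dq, dp]

theorem window_embed {o m N : ℕ} (h : o + m ≤ N) (y : Phase m) :
    window o m (embed h y) = y := by
  ext i
  · rw [window_fst _ i (by omega), embed_apply]
    simp [Prod.fst_sum, Finset.sum_apply, Pi.single_apply, shift, Fin.ext_iff]
    simp [← Fin.ext_iff]
  · rw [window_snd _ i (by omega), embed_apply]
    simp [Prod.snd_sum, Finset.sum_apply, Pi.single_apply, shift, Fin.ext_iff]
    simp [← Fin.ext_iff]

end Window

/-! ### The Hamiltonian flow of particles with a hard core -/

section Potential

variable {Φ : ℝ → ℝ} {σ R : ℝ}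

theorem isOpen_core (σ : ℝ) : IsOpen {r : ℝ | σ < |r|} :=
  isOpen_lt continuous_const continuous_abs

theorem IsPotential.hasDerivAt (hΦ : IsPotential Φ σ R) {r : ℝ} (hr : σ < |r|) :
    HasDerivAt Φ (deriv Φ r) r :=
  ((hΦ.smooth.contDiffAt ((isOpen_core σ).mem_nhds hr)).differentiableAt two_ne_zero).hasDerivAt

theorem IsPotential.contDiffOn_deriv (hΦ : IsPotential Φ σ R) :
    ContDiffOn ℝ 1 (deriv Φ) {r | σ < |r|} :=
  hΦ.smooth.deriv_of_isOpen (isOpen_core σ) (by norm_num)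

theorem Allowed.lt_abs_sub {N : ℕ} {x : Phase N} (hx : x ∈ Allowed σ N) {j : ℕ} (h : j + 1 < N) :
    σ < |x.1 ⟨j, by omega⟩ - x.1 ⟨j + 1, h⟩| := by
  rw [abs_sub_comm]
  exact lt_of_lt_of_le (by linarith [hx j h]) (le_abs_self _)

theorem contDiffOn_dPhi (hΦ : IsPotential Φ σ R) (N j : ℕ) :
    ContDiffOn ℝ 1 (fun x : Phase N => dPhi Φ j x.1) (Allowed σ N) := by
  by_cases h : j + 1 < N
  · simp only [dPhi, h, dif_pos]
    refine hΦ.contDiffOn_deriv.comp (f := fun x : Phase N => x.1 ⟨j, by omega⟩ - x.1 ⟨j + 1, h⟩)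
      ?_ fun x hx => Allowed.lt_abs_sub hx h
    exact ContDiff.contDiffOn (by fun_prop)
  · simp only [dPhi, h, dif_neg, not_false_eq_true]
    exact contDiffOn_const

theorem contDiffOn_hamiltonField (hΦ : IsPotential Φ σ R) (N : ℕ) :
    ContDiffOn ℝ 1 (hamiltonField Φ : Phase N → Phase N) (Allowed σ N) := by
  refine contDiffOn_snd.prodMk (contDiffOn_pi.2 fun j => ContDiffOn.sub ?_ (contDiffOn_dPhi hΦ N j))
  split_ifs
  · exact contDiffOn_const
  · exact contDiffOn_dPhi hΦ N _

/-- Three regions: close to the core the potential is nonnegative, because it tends to +∞; up to the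
range R it is continuous on a compact interval; beyond R it vanishes. -/
theorem IsPotential.exists_lower_bound (hΦ : IsPotential Φ σ R) :
    ∃ m : ℝ, 0 ≤ m ∧ ∀ r, σ < r → -m ≤ Φ r := by
  obtain ⟨δ, hδ, hδ0⟩ := mem_nhdsGT_iff_exists_Ioo_subset.1
    (hΦ.core.eventually (eventually_ge_atTop 0))
  have hδ' : σ < δ := hδ
  have hcont : ContinuousOn Φ (Set.Icc δ R) := hΦ.smooth.continuousOn.mono fun r hr =>
    lt_of_lt_of_le (hδ'.trans_le hr.1) (le_abs_self r)
  obtain ⟨C, hC⟩ := isCompact_Icc.exists_bound_of_continuousOn hcont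
  refine ⟨max C 0, le_max_right _ _, fun r hr => ?_⟩
  rcases lt_or_ge r δ with h | h
  · have : 0 ≤ Φ r := hδ0 ⟨hr, h⟩
    linarith [le_max_right C 0]
  · rcases le_or_gt r R with h' | h'
    · have := (abs_le.1 (hC r ⟨h, h'⟩)).1
      linarith [le_max_left C 0]
    · rw [hΦ.short_range r (h'.trans_le (le_abs_self r))]
      linarith [le_max_right C 0]

/-- Summation by parts for forces between neighbours. -/
theorem sum_force_mul (N : ℕ) (F c : ℕ → ℝ) (hF : ∀ j, N ≤ j + 1 → F j = 0) :
    ∑ j ∈ range N, ((if j = 0 then 0 else F (j - 1)) - F j) * c j =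
      -∑ j ∈ range (N - 1), F j * (c j - c (j + 1)) := by
  rcases N with _ | M
  · simp
  · simp only [sub_mul, sum_sub_distrib, add_tsub_cancel_right, mul_sub]
    rw [sum_range_succ', sum_range_succ (fun j => F j * c j), hF M le_rfl]
    simp

/-- The potential energy of the neighbours in positions `j` and `j + 1`. -/
noncomputable def pairEnergy (Φ : ℝ → ℝ) {N : ℕ} (j : ℕ) (x : Phase N) : ℝ :=
  if h : j + 1 < N then Φ (x.1 ⟨j, by omega⟩ - x.1 ⟨j + 1, h⟩) else 0

/-- The Hamiltonian. -/
noncomputable def energy (Φ : ℝ → ℝ) {N : ℕ} (x : Phase N) : ℝ :=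
  ∑ j : Fin N, x.2 j ^ 2 / 2 + ∑ j ∈ range (N - 1), pairEnergy Φ j x

/-- The energy is conserved also when the field is multiplied by a scalar c, which only changes the
speed. This covers the cut-off fields in `ODE_exists_global`. -/
theorem hasDerivAt_energy (hΦ : IsPotential Φ σ R) {N : ℕ} {X : ℝ → Phase N} {c t : ℝ}
    (hX : HasDerivAt X (c • hamiltonField Φ (X t)) t) (ht : X t ∈ Allowed σ N) :
    HasDerivAt (fun s => energy Φ (X s)) 0 t := by
  have h1 : ∀ j, HasDerivAt (fun s => (X s).1 j) (c * (X t).2 j) t := fun j =>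
    (hasDerivAt_pi.1 hX.fst) j
  have h2 : ∀ j, HasDerivAt (fun s => (X s).2 j) (c * (hamiltonField Φ (X t)).2 j) t := fun j =>
    (hasDerivAt_pi.1 hX.snd) j
  let P : ℕ → ℝ := fun j => if h : j < N then (X t).2 ⟨j, h⟩ else 0
  have hpair : ∀ j ∈ range (N - 1), HasDerivAt (fun s => pairEnergy Φ j (X s))
      (c * (dPhi Φ j (X t).1 * (P j - P (j + 1)))) t := by
    intro j hj
    have hj' : j + 1 < N := by have := mem_range.1 hj; omega
    have hj'' : j < N := by omega
    simp only [pairEnergy, hj', dif_pos, dPhi, P, hj'']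
    have := (hΦ.hasDerivAt (Allowed.lt_abs_sub ht hj')).comp t ((h1 ⟨j, hj''⟩).sub (h1 ⟨j + 1, hj'⟩))
    refine this.congr_deriv ?_
    ring
  have hkin : HasDerivAt (fun s => ∑ j : Fin N, (X s).2 j ^ 2 / 2)
      (∑ j : Fin N, c * ((hamiltonField Φ (X t)).2 j * (X t).2 j)) t := by
    refine HasDerivAt.fun_sum fun j _ => ?_
    refine (((h2 j).pow 2).div_const 2).congr_deriv ?_
    norm_num
    ring
  refine (hkin.add (HasDerivAt.fun_sum hpair)).congr_deriv ?_
  rw [← mul_sum, ← mul_sum, ← mul_add]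
  have := sum_force_mul N (fun j => dPhi Φ j (X t).1) P fun j hj => by
    simp [dPhi, not_lt.2 hj]
  rw [Finset.sum_range] at this
  have e : ∑ j : Fin N, (hamiltonField Φ (X t)).2 j * (X t).2 j =
      ∑ i : Fin N, ((if (i : ℕ) = 0 then 0 else dPhi Φ ((i : ℕ) - 1) (X t).1) -
        dPhi Φ (i : ℕ) (X t).1) * P i := by
    refine Finset.sum_congr rfl fun j _ => ?_
    simp [hamiltonField, P]
  rw [e, this, neg_add_cancel, mul_zero]

/-- Energy conservation bounds the momenta and, as the potential blows up at the core, keeps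
neighbours at a distance of at least some δ > σ. Bounded momenta bound the positions on bounded time
intervals, which yields the compact set required by `ODE_exists_global`. -/
theorem exists_trajectory (hΦ : IsPotential Φ σ R) {N : ℕ} {x : Phase N} (hx : x ∈ Allowed σ N) :
    ∃ X : ℝ → Phase N, IsTrajectory Φ σ X ∧ X 0 = x := by
  obtain ⟨m, hm0, hm⟩ := hΦ.exists_lower_bound
  -- Every pair has energy at least -m and there are fewer than N + 1 pairs, so A bounds the kinetic
  -- energy and the energy of any single pair on the energy surface of x.
  set A := energy Φ x + N * m with hA
  obtain ⟨δ, hδ, hδA⟩ := mem_nhdsGT_iff_exists_Ioo_subset.1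
    (hΦ.core.eventually (eventually_gt_atTop A))
  have hδ' : σ < δ := hδ
  have hpair : ∀ y ∈ Allowed σ N, ∀ j ∈ range (N - 1), -m ≤ pairEnergy Φ j y := by
    intro y hy j hj
    have hj' : j + 1 < N := by have := mem_range.1 hj; omega
    simp only [pairEnergy, hj', dif_pos]
    rw [← hΦ.even]
    exact hm _ (by linarith [hy j hj'])
  have hcard : ((N - 1 : ℕ) : ℝ) ≤ N := by exact_mod_cast Nat.sub_le N 1
  have hpot : ∀ y ∈ Allowed σ N, -(N * m) ≤ ∑ j ∈ range (N - 1), pairEnergy Φ j y := by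
    intro y hy
    have := Finset.card_nsmul_le_sum _ _ _ (hpair y hy)
    rw [card_range, nsmul_eq_mul] at this
    nlinarith
  -- From p² ≤ 2A a bound without square roots follows by 2|p| ≤ p² + 1.
  have hmom : ∀ y ∈ Allowed σ N, energy Φ y = energy Φ x → ∀ j, |y.2 j| ≤ 2 * A + 1 := by
    intro y hy he j
    have h1 : y.2 j ^ 2 / 2 ≤ ∑ j : Fin N, y.2 j ^ 2 / 2 :=
      Finset.single_le_sum (f := fun j : Fin N => y.2 j ^ 2 / 2) (fun i _ => by positivity)
        (mem_univ j)
    have h2 := hpot y hy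
    have h3 : y.2 j ^ 2 ≤ 2 * A := by
      simp only [energy] at he hA ⊢
      linarith
    have : |y.2 j| ^ 2 ≤ 2 * A := by rwa [sq_abs]
    nlinarith [sq_nonneg (|y.2 j| - 1), abs_nonneg (y.2 j)]
  have hgap : ∀ y ∈ Allowed σ N, energy Φ y = energy Φ x → ∀ (j : ℕ) (h : j + 1 < N),
      y.1 ⟨j, by omega⟩ + δ ≤ y.1 ⟨j + 1, h⟩ := by
    intro y hy he j h
    by_contra hlt
    have hlt' : y.1 ⟨j + 1, h⟩ - y.1 ⟨j, by omega⟩ < δ := by linarith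
    have h1 : A < Φ (y.1 ⟨j + 1, h⟩ - y.1 ⟨j, by omega⟩) := hδA ⟨by linarith [hy j h], hlt'⟩
    have hj : j ∈ range (N - 1) := mem_range.2 (by omega)
    have h2 : pairEnergy Φ j y = Φ (y.1 ⟨j + 1, h⟩ - y.1 ⟨j, by omega⟩) := by
      simp only [pairEnergy, h, dif_pos]
      rw [← hΦ.even, neg_sub]
    have h3 := Finset.add_sum_erase _ (fun j => pairEnergy Φ j y) hj
    have h4 := Finset.card_nsmul_le_sum ((range (N - 1)).erase j) (fun j => pairEnergy Φ j y) (-m)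
      fun i hi => hpair y hy i (mem_of_mem_erase hi)
    have h5 : (((range (N - 1)).erase j).card : ℝ) ≤ N := by
      refine le_trans ?_ hcard
      exact_mod_cast (card_erase_le.trans (card_range _).le)
    rw [nsmul_eq_mul] at h4
    have h6 : 0 ≤ ∑ j : Fin N, y.2 j ^ 2 / 2 := Finset.sum_nonneg fun i _ => by positivity
    have h7 : energy Φ y = ∑ j : Fin N, y.2 j ^ 2 / 2 + ∑ j ∈ range (N - 1), pairEnergy Φ j y :=
      rfl
    nlinarith
  refine Exists.imp (fun X hX => ⟨⟨hX.2.1, hX.2.2⟩, hX.1⟩) (ODE_exists_global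
    (isOpen_allowed σ N) (contDiffOn_hamiltonField hΦ N) hx fun T hT => ?_)
  let B := ‖x‖ + (2 * A + 1) * T
  let K : Set (Phase N) := {y | (∀ (j : ℕ) (h : j + 1 < N),
      y.1 ⟨j, by omega⟩ + δ ≤ y.1 ⟨j + 1, h⟩) ∧ (∀ j, |y.1 j| ≤ B) ∧ ∀ j, |y.2 j| ≤ 2 * A + 1}
  refine ⟨K, fun y hy j h => by linarith [hy.1 j h], ?_, ?_⟩
  · refine Metric.isCompact_of_isClosed_isBounded ?_ ?_
    · simp only [K, Set.ofPred_and, Set.ofPred_forall]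
      refine IsClosed.inter ?_ (IsClosed.inter ?_ ?_)
      · refine isClosed_iInter fun j => isClosed_iInter fun h => isClosed_le ?_ ?_ <;> fun_prop
      · refine isClosed_iInter fun j => isClosed_le ?_ ?_ <;> fun_prop
      · refine isClosed_iInter fun j => isClosed_le ?_ ?_ <;> fun_prop
    · refine isBounded_iff_forall_norm_le.2 ⟨max |B| |2 * A + 1|, fun y hy => ?_⟩
      refine max_le ((pi_norm_le_iff_of_nonneg (by positivity)).2 fun j => ?_)
        ((pi_norm_le_iff_of_nonneg (by positivity)).2 fun j => ?_)
      · exact (hy.2.1 j).trans ((le_abs_self _).trans (le_max_left _ _))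
      · exact (hy.2.2 j).trans ((le_abs_self _).trans (le_max_right _ _))
  · intro χ hχ X hX0 hX
    have h0 : (0 : ℝ) ∈ Set.Ioo (-T) T := ⟨by linarith, hT⟩
    have hE : ∀ t ∈ Set.Ioo (-T) T, energy Φ (X t) = energy Φ x := by
      intro t ht
      have := (convex_Ioo (-T) T).is_const_of_fderivWithin_eq_zero (𝕜 := ℝ)
        (f := fun s => energy Φ (X s))
        (fun s hs => (hasDerivAt_energy hΦ (hX s hs).2
          (hX s hs).1).differentiableAt.differentiableWithinAt)
        (fun s hs => by
          have := (hasDerivAt_energy hΦ (hX s hs).2 (hX s hs).1).hasFDerivAt.hasFDerivWithinAt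
            (s := Set.Ioo (-T) T)
          rw [this.fderivWithin (isOpen_Ioo.uniqueDiffOn s hs)]
          ext
          simp) ht h0
      simpa only [hX0] using this
    intro t ht
    refine ⟨hgap _ (hX t ht).1 (hE t ht), fun j => ?_, hmom _ (hX t ht).1 (hE t ht)⟩
    have hA0 : 0 ≤ 2 * A + 1 := (abs_nonneg _).trans (hmom x hx rfl j)
    have := (convex_Ioo (-T) T).norm_image_sub_le_of_norm_hasDerivWithin_le
      (f := fun s => (X s).1 j) (f' := fun s => χ (X s) * (X s).2 j) (C := 2 * A + 1)
      (fun s hs => ((hasDerivAt_pi.1 (hX s hs).2.fst) j).hasDerivWithinAt)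
      (fun s hs => by
        rw [norm_mul, Real.norm_eq_abs, Real.norm_eq_abs, abs_of_nonneg (hχ _).1]
        exact (mul_le_of_le_one_left (abs_nonneg _) (hχ _).2).trans
          (hmom _ (hX s hs).1 (hE s hs) j)) h0 ht
    rw [Real.norm_eq_abs, Real.norm_eq_abs, sub_zero, hX0] at this
    have htT : |t| ≤ T := abs_le.2 ⟨ht.1.le, ht.2.le⟩
    have hxj : |x.1 j| ≤ ‖x‖ := (norm_le_pi_norm x.1 j).trans (le_max_left _ _)
    calc |(X t).1 j| = |x.1 j + ((X t).1 j - x.1 j)| := by ring_nf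
      _ ≤ |x.1 j| + |(X t).1 j - x.1 j| := abs_add_le _ _
      _ ≤ ‖x‖ + (2 * A + 1) * T :=
        add_le_add hxj (this.trans (mul_le_mul_of_nonneg_left htT hA0))

theorem flow_spec (hΦ : IsPotential Φ σ R) {N : ℕ} {x : Phase N} (hx : x ∈ Allowed σ N) :
    IsTrajectory Φ σ (flow Φ σ x) ∧ flow Φ σ x 0 = x := by
  have h := exists_trajectory hΦ hx
  rw [flow, dif_pos h]
  exact h.choose_spec

/-- A trajectory never visits forbidden configurations, so the default value of `flow` applies. That
forbidden points are fixed allows the transport results to integrate over the whole phase space. -/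
theorem flow_of_notMem {N : ℕ} {x : Phase N} (hx : x ∉ Allowed σ N) (t : ℝ) :
    flow Φ σ x t = x := by
  rw [flow, dif_neg]
  rintro ⟨X, hX, rfl⟩
  exact hx (hX.1 0)

theorem isCompleteFlow_flow (hΦ : IsPotential Φ σ R) (N : ℕ) :
    IsCompleteFlow (Allowed σ N) (hamiltonField Φ) fun t x => flow Φ σ x t where
  isOpen := isOpen_allowed σ N
  field := contDiffOn_hamiltonField hΦ N
  mem := fun t _ hx => (flow_spec hΦ hx).1.1 t
  zero := fun _ hx => (flow_spec hΦ hx).2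
  hasDerivAt := fun t _ hx => (flow_spec hΦ hx).1.2 t

end Potential

end TopInt

namespace TopInt

/-! ### Liouville operators of windows -/

section Operators

variable {Φ : ℝ → ℝ} {σ R : ℝ}

/-- The free part `-p_j ∂/∂q_j` of the Liouville operator (zero if there is no particle in
position `j`). -/
noncomputable def freeTerm {N : ℕ} (j : ℕ) (f : Phase N → ℝ) (x : Phase N) : ℝ :=
  if h : j < N then -(x.2 ⟨j, h⟩ * dq ⟨j, h⟩ f x) else 0

theorem LStar_eq_sum {N : ℕ} (f : Phase N → ℝ) (x : Phase N) :
    LStar Φ f x = ∑ j ∈ range N, freeTerm j f x + ∑ j ∈ range (N - 1), LStarInt Φ j f x := by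
  rw [LStar, Finset.sum_range fun j => freeTerm j f x]
  simp [freeTerm]

/-- The Hamiltonian field of the particles in a window; the other particles do not move. -/
noncomputable def liftField (Φ : ℝ → ℝ) {o m N : ℕ} (h : o + m ≤ N) (x : Phase N) : Phase N :=
  embed h (hamiltonField Φ (window o m x))

/-- The flow of the particles in a window; the other particles do not move. -/
noncomputable def liftFlow (Φ : ℝ → ℝ) (σ : ℝ) {o m N : ℕ} (h : o + m ≤ N) (t : ℝ) (x : Phase N) :
    Phase N :=
  x + embed h (flow Φ σ (window o m x) t - window o m x)

theorem window_liftFlow {o m N : ℕ} (h : o + m ≤ N) (t : ℝ) (x : Phase N) :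
    window o m (liftFlow Φ σ h t x) = flow Φ σ (window o m x) t := by
  have : window o m (liftFlow Φ σ h t x) =
      window o m x + window o m (embed h (flow Φ σ (window o m x) t - window o m x)) :=
    (windowL N o m).map_add _ _
  rw [this, window_embed, add_sub_cancel]

/-- Observables of part of the particles are treated as functions of all particles under a flow that
freezes the others; the general transport results then apply on the larger phase space. -/
theorem isCompleteFlow_liftFlow (hΦ : IsPotential Φ σ R) {o m N : ℕ} (h : o + m ≤ N) :
    IsCompleteFlow (window o m ⁻¹' Allowed σ m) (liftField Φ h) (liftFlow Φ σ h) where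
  isOpen := (isOpen_allowed σ m).preimage (continuous_window o m)
  field := (embed h).contDiff.comp_contDiffOn ((contDiffOn_hamiltonField hΦ m).comp
    (contDiff_window o m).contDiffOn fun _ hx => hx)
  mem := fun t x hx => by
    rw [Set.mem_preimage, window_liftFlow]
    exact (isCompleteFlow_flow hΦ m).mem t _ hx
  zero := fun x hx => by
    have : flow Φ σ (window o m x) 0 = window o m x := (isCompleteFlow_flow hΦ m).zero _ hx
    rw [liftFlow, this, sub_self, map_zero, add_zero]
  hasDerivAt := fun t x hx => by
    have h1 := ((isCompleteFlow_flow hΦ m).hasDerivAt t _ hx).sub_const (window o m x)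
    have h2 := ((embed h).hasFDerivAt.comp_hasDerivAt t h1).const_add x
    rw [liftField, window_liftFlow]
    exact h2

theorem liftFlow_of_notMem {o m N : ℕ} (h : o + m ≤ N) (t : ℝ) (x : Phase N)
    (hx : x ∉ window o m ⁻¹' Allowed σ m) : liftFlow Φ σ h t x = x := by
  rw [liftFlow, flow_of_notMem hx, sub_self, map_zero, add_zero]

theorem dPhi_window {o m N : ℕ} (h : o + m ≤ N) {j : ℕ} (hj : j + 1 < m) (x : Phase N) :
    dPhi Φ j (window o m x).1 = dPhi Φ (o + j) x.1 := by
  have hj' : o + j + 1 < N := by omega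
  simp only [dPhi, hj, hj', dif_pos]
  rw [window_fst x ⟨j, by omega⟩ (by simp only; omega),
    window_fst x ⟨j + 1, hj⟩ (by simp only; omega)]
  rfl

/-- The field lists the total force on each particle, the Liouville operator the interactions of
pairs. Summation by parts (`sum_force_mul`) converts one into the other. -/
theorem neg_fderiv_liftField {o m N : ℕ} (h : o + m ≤ N) (f : Phase N → ℝ) (x : Phase N) :
    -(fderiv ℝ f x (liftField Φ h x)) = ∑ j ∈ range m, freeTerm (o + j) f x +
      ∑ j ∈ range (m - 1), LStarInt Φ (o + j) f x := by
  let c : ℕ → ℝ := fun j => if hj : j < m then dp (shift h ⟨j, hj⟩) f x else 0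
  have key := sum_force_mul m (fun j => dPhi Φ j (window o m x).1) c fun j hj => by
    simp [dPhi, not_lt.2 hj]
  have e1 : ∑ j : Fin m, (hamiltonField Φ (window o m x)).2 j * dp (shift h j) f x =
      -∑ j ∈ range (m - 1), LStarInt Φ (o + j) f x := by
    have : ∑ j ∈ range (m - 1), LStarInt Φ (o + j) f x =
        ∑ j ∈ range (m - 1), dPhi Φ j (window o m x).1 * (c j - c (j + 1)) := by
      refine Finset.sum_congr rfl fun j hj => ?_
      have hj1 : j + 1 < m := by have := mem_range.1 hj; omega
      have hj2 : o + j + 1 < N := by omega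
      have hj3 : j < m := by omega
      simp only [LStarInt, hj2, dif_pos, dPhi_window h hj1, c, hj1, hj3]
      rfl
    rw [this, ← key, Finset.sum_range]
    refine Finset.sum_congr rfl fun j _ => ?_
    simp [hamiltonField, c]
  have e2 : ∑ j : Fin m, (hamiltonField Φ (window o m x)).1 j * dq (shift h j) f x =
      -∑ j ∈ range m, freeTerm (o + j) f x := by
    rw [Finset.sum_range, ← Finset.sum_neg_distrib]
    refine Finset.sum_congr rfl fun j _ => ?_
    have hj : o + (j : ℕ) < N := by omega
    simp only [freeTerm, hj, dif_pos, neg_neg, hamiltonField]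
    rw [window_snd x j hj]
    rfl
  rw [liftField, fderiv_embed, Finset.sum_add_distrib, e1, e2]
  ring

theorem window_add_smul_fst {o m N : ℕ} (j : Fin N) (hj : (j : ℕ) < o ∨ o + m ≤ j)
    (t : ℝ) (x : Phase N) :
    window o m (x + t • ((Pi.single j 1, 0) : Phase N)) = window o m x := by
  ext i
  · simp only [window]
    split_ifs with h
    · have : (⟨o + i, h⟩ : Fin N) ≠ j := fun e => by
        have : o + (i : ℕ) = j := congrArg Fin.val e
        omega
      simp [this]
    · rfl
  · simp [window]

theorem window_add_smul_snd {o m N : ℕ} (j : Fin N) (hj : (j : ℕ) < o ∨ o + m ≤ j)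
    (t : ℝ) (x : Phase N) :
    window o m (x + t • ((0, Pi.single j 1) : Phase N)) = window o m x := by
  ext i
  · simp [window]
  · simp only [window]
    split_ifs with h
    · have : (⟨o + i, h⟩ : Fin N) ≠ j := fun e => by
        have : o + (i : ℕ) = j := congrArg Fin.val e
        omega
      simp [this]
    · rfl

/-- Bookkeeping common to the pointwise and the integrated equation: F stands for the free terms of
the particles and I for the interactions of neighbours. Enlarging the window by at most one particle
on each side adds free terms that vanish and the interactions of the outermost pairs. -/
theorem sum_window {o m N : ℕ} (ho : o ≤ 1) (h : o + m ≤ N) (hN : N ≤ o + m + 1) (F I : ℕ → ℝ)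
    (hF : ∀ j < N, (j < o ∨ o + m ≤ j) → F j = 0)
    (hI : ∀ j, (j < o ∨ o + m ≤ j) → (j + 1 < o ∨ o + m ≤ j + 1) → I j = 0)
    (hIN : ∀ j, N ≤ j + 1 → I j = 0) :
    ∑ j ∈ range m, F (o + j) + ∑ j ∈ range (m - 1), I (o + j) =
      ∑ j ∈ range N, F j + ∑ j ∈ range (N - 1), I j - (if o = 0 then 0 else I 0) -
        (if o + m = N then 0 else I (N - 2)) := by
  have ho' : o = 0 ∨ o = 1 := by omega
  have hN' : N = o + m ∨ N = o + m + 1 := by omega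
  rcases ho' with rfl | rfl <;> rcases hN' with rfl | rfl
  · simp
  · rw [sum_range_succ, hF (0 + m) (by omega) (by omega)]
    rcases m with _ | m
    · simp [hIN 0]
    · simp [sum_range_succ]
      ring
  · rw [add_comm 1 m, sum_range_succ', hF 0 (by omega) (by omega)]
    rcases m with _ | m
    · simp [hIN 0]
    · simp [sum_range_succ', add_comm 1]
      ring
  · rw [sum_range_succ, hF (1 + m) (by omega) (by omega), add_comm 1 m, sum_range_succ',
      hF 0 (by omega) (by omega)]
    rcases m with _ | m
    -- The window is empty and N = 2: the two outermost pairs coincide and are subtracted twice, so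
    -- their term has to vanish. It does, since both particles lie outside the window.
    · simp [hI 0]
    · simp only [add_tsub_cancel_right, add_comm 1]
      rw [sum_range_succ' I, sum_range_succ fun j => I (j + 1)]
      simp
      ring

/-- No regularity of b is needed: where the function is differentiable its derivative in the
direction of a foreign particle is zero, and elsewhere `fderiv` is zero by convention. -/
theorem freeTerm_eq_zero_of_window {o m N j : ℕ} (hj : j < o ∨ o + m ≤ j) (b : Phase m → ℝ)
    (x : Phase N) : freeTerm j (fun y => b (window o m y)) x = 0 := by
  rw [freeTerm]
  split_ifs with h
  · have : dq ⟨j, h⟩ (fun y : Phase N => b (window o m y)) x = 0 := by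
      rw [dq]
      by_cases hd : DifferentiableAt ℝ (fun y : Phase N => b (window o m y)) x
      · rw [← hd.lineDeriv_eq_fderiv]
        simp only [lineDeriv, window_add_smul_fst (⟨j, h⟩ : Fin N) hj, deriv_const]
      · rw [fderiv_zero_of_not_differentiableAt hd]
        rfl
    rw [this, mul_zero, neg_zero]
  · rfl

theorem dp_eq_zero_of_window {o m N : ℕ} (j : Fin N) (hj : (j : ℕ) < o ∨ o + m ≤ j)
    (b : Phase m → ℝ) (x : Phase N) : dp j (fun y => b (window o m y)) x = 0 := by
  rw [dp]
  by_cases hd : DifferentiableAt ℝ (fun y : Phase N => b (window o m y)) x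
  · rw [← hd.lineDeriv_eq_fderiv]
    simp only [lineDeriv, window_add_smul_snd j hj, deriv_const]
  · rw [fderiv_zero_of_not_differentiableAt hd]
    rfl

theorem LStarInt_eq_zero_of_window {o m N j : ℕ} (hj : j < o ∨ o + m ≤ j)
    (hj' : j + 1 < o ∨ o + m ≤ j + 1) (b : Phase m → ℝ) (x : Phase N) :
    LStarInt Φ j (fun y => b (window o m y)) x = 0 := by
  rw [LStarInt]
  split_ifs with h
  · rw [dp_eq_zero_of_window _ hj, dp_eq_zero_of_window _ hj', sub_zero, mul_zero]
  · rfl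

theorem LStarInt_of_le {N j : ℕ} (h : N ≤ j + 1) (f : Phase N → ℝ) (x : Phase N) :
    LStarInt Φ j f x = 0 := by
  rw [LStarInt, dif_neg (not_lt.2 h)]

/-- For functions of the particles in a window that contains all particles except possibly the two
outermost ones, the Liouville operator of the window differs from the one of all particles by the
interactions with the outermost particles. -/
theorem neg_fderiv_liftField_window {o m N : ℕ} (ho : o ≤ 1) (h : o + m ≤ N) (hN : N ≤ o + m + 1)
    (b : Phase m → ℝ) (x : Phase N) :
    -(fderiv ℝ (fun y => b (window o m y)) x (liftField Φ h x)) =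
      LStar Φ (fun y => b (window o m y)) x -
        (if o = 0 then 0 else LStarInt Φ 0 (fun y => b (window o m y)) x) -
        (if o + m = N then 0 else LStarInt Φ (N - 2) (fun y => b (window o m y)) x) := by
  rw [neg_fderiv_liftField, LStar_eq_sum]
  exact sum_window ho h hN (fun j => freeTerm j (fun y => b (window o m y)) x)
    (fun j => LStarInt Φ j (fun y => b (window o m y)) x)
    (fun j _ hj => freeTerm_eq_zero_of_window hj b x)
    (fun j hj hj' => LStarInt_eq_zero_of_window hj hj' b x)
    (fun j hj => LStarInt_of_le hj _ x)

end Operators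

/-! ### Integration by parts and the weak evolution equation of a window -/

section Integrals

variable {Φ : ℝ → ℝ} {σ R : ℝ}

instance (N : ℕ) : (volume : Measure (Phase N)).IsAddHaarMeasure :=
  Measure.prod.instIsAddHaarMeasure (volume : Measure (Fin N → ℝ)) (volume : Measure (Fin N → ℝ))

/-- Integration by parts along e, where the other factor is constant. It applies to all parts of the
Liouville operator, since the coefficient p_j of ∂/∂q_j does not depend on q_j, and the force in
front of ∂/∂p_j does not depend on p_j. -/
theorem integral_mul_fderiv_eq_zero {N : ℕ} {G g : Phase N → ℝ} {e : Phase N}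
    (hg1 : ContDiff ℝ 1 g) (hg : HasCompactSupport g) (hG : ContinuousOn G (tsupport g))
    (hinv : ∀ x (t : ℝ), G (x + t • e) = G x) : ∫ x, G x * fderiv ℝ g x e = 0 := by
  have hdg : Continuous fun x => fderiv ℝ g x e :=
    (hg1.continuous_fderiv one_ne_zero).clm_apply continuous_const
  have := integral_bilinear_hasLineDerivAt_right_eq_neg_left_of_integrable
    (μ := (volume : Measure (Phase N))) (f := G) (f' := fun _ => 0) (g := g)
    (g' := fun x => fderiv ℝ g x e) (v := e) (B := ContinuousLinearMap.mul ℝ ℝ)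
    (by simp)
    (integrable_of_continuousOn_of_eq_zero hg (hG.mul hdg.continuousOn) fun x hx => by
      simp [fderiv_of_notMem_tsupport ℝ hx])
    (integrable_of_continuousOn_of_eq_zero hg (hG.mul hg1.continuous.continuousOn) fun x hx => by
      simp [image_eq_zero_of_notMem_tsupport hx])
    (fun x _ => by
      simp only [HasLineDerivAt, hinv]
      exact hasDerivAt_const _ _)
    (fun x _ => (hg1.differentiable one_ne_zero x).hasFDerivAt.hasLineDerivAt e)
  simpa using this

theorem continuous_freeTerm {N : ℕ} {f : Phase N → ℝ} (hf : ContDiff ℝ 1 f) (j : ℕ) :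
    Continuous (freeTerm j f) := by
  by_cases h : j < N
  · have h1 : Continuous fun x => fderiv ℝ f x ((Pi.single ⟨j, h⟩ 1, 0) : Phase N) :=
      (hf.continuous_fderiv one_ne_zero).clm_apply continuous_const
    have : freeTerm j f = fun x => -(x.2 ⟨j, h⟩ * dq ⟨j, h⟩ f x) := by
      ext x
      simp [freeTerm, h]
    rw [this]
    exact ((by fun_prop : Continuous fun x : Phase N => x.2 ⟨j, h⟩).mul h1).neg
  · have : freeTerm j f = fun x : Phase N => (0 : ℝ) := by
      ext x
      simp [freeTerm, h]
    rw [this]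
    exact continuous_const

theorem freeTerm_of_notMem_tsupport {N : ℕ} {f : Phase N → ℝ} {x : Phase N} (hx : x ∉ tsupport f)
    (j : ℕ) : freeTerm j f x = 0 := by
  simp [freeTerm, dq, fderiv_of_notMem_tsupport ℝ hx]

theorem LStarInt_of_notMem_tsupport {N : ℕ} {f : Phase N → ℝ} {x : Phase N}
    (hx : x ∉ tsupport f) (j : ℕ) : LStarInt Φ j f x = 0 := by
  simp [LStarInt, dp, fderiv_of_notMem_tsupport ℝ hx]

theorem continuousOn_LStarInt {N : ℕ} {f : Phase N → ℝ} (hf : ContDiff ℝ 1 f) {j : ℕ}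
    {s : Set (Phase N)} (hs : ContinuousOn (fun x : Phase N => dPhi Φ j x.1) s) :
    ContinuousOn (LStarInt Φ j f) s := by
  by_cases h : j + 1 < N
  · have h1 : ∀ i, Continuous fun x => fderiv ℝ f x ((0, Pi.single i 1) : Phase N) := fun i =>
      (hf.continuous_fderiv one_ne_zero).clm_apply continuous_const
    have : LStarInt Φ j f =
        fun x => dPhi Φ j x.1 * (dp ⟨j, by omega⟩ f x - dp ⟨j + 1, h⟩ f x) := by
      ext x
      simp [LStarInt, h]
    rw [this]
    exact hs.mul ((h1 _).sub (h1 _)).continuousOn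
  · have : LStarInt Φ j f = fun x : Phase N => (0 : ℝ) := by
      ext x
      simp [LStarInt, h]
    rw [this]
    exact continuousOn_const

theorem integrable_mul_freeTerm {N : ℕ} {G f : Phase N → ℝ} (hf1 : ContDiff ℝ 1 f)
    (hf : HasCompactSupport f) (hG : ContinuousOn G (tsupport f)) (j : ℕ) :
    Integrable fun x => G x * freeTerm j f x :=
  integrable_of_continuousOn_of_eq_zero hf (hG.mul (continuous_freeTerm hf1 j).continuousOn)
    fun x hx => by rw [freeTerm_of_notMem_tsupport hx, mul_zero]

theorem integrable_mul_LStarInt {N : ℕ} {G f : Phase N → ℝ} (hf1 : ContDiff ℝ 1 f)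
    (hf : HasCompactSupport f) (hG : ContinuousOn G (tsupport f)) {j : ℕ}
    (hs : ContinuousOn (fun x : Phase N => dPhi Φ j x.1) (tsupport f)) :
    Integrable fun x => G x * LStarInt Φ j f x :=
  integrable_of_continuousOn_of_eq_zero hf (hG.mul (continuousOn_LStarInt hf1 hs))
    fun x hx => by rw [LStarInt_of_notMem_tsupport hx, mul_zero]

theorem integral_mul_freeTerm {N : ℕ} {G f : Phase N → ℝ} (hf1 : ContDiff ℝ 1 f)
    (hf : HasCompactSupport f) (hG : ContinuousOn G (tsupport f)) {j : ℕ} (hj : j < N)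
    (hinv : ∀ x (t : ℝ), G (x + t • ((Pi.single ⟨j, hj⟩ 1, 0) : Phase N)) = G x) :
    ∫ x, G x * freeTerm j f x = 0 := by
  have := integral_mul_fderiv_eq_zero (G := fun x => -(G x * x.2 ⟨j, hj⟩)) hf1 hf
    (hG.mul (by fun_prop)).neg (e := ((Pi.single ⟨j, hj⟩ 1, 0) : Phase N))
    (fun x t => by
      rw [hinv x t]
      simp)
  rw [← this]
  congr 1
  ext x
  simp only [freeTerm, hj, dif_pos, dq]
  ring

theorem integral_mul_LStarInt {N : ℕ} {G f : Phase N → ℝ} (hf1 : ContDiff ℝ 1 f)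
    (hf : HasCompactSupport f) (hG : ContinuousOn G (tsupport f)) {j : ℕ}
    (hs : ContinuousOn (fun x : Phase N => dPhi Φ j x.1) (tsupport f))
    (hinv : ∀ (i : Fin N), ((i : ℕ) = j ∨ (i : ℕ) = j + 1) →
      ∀ x (t : ℝ), G (x + t • ((0, Pi.single i 1) : Phase N)) = G x) :
    ∫ x, G x * LStarInt Φ j f x = 0 := by
  by_cases h : j + 1 < N
  · have key : ∀ i : Fin N, ((i : ℕ) = j ∨ (i : ℕ) = j + 1) →
        ∫ x, G x * dPhi Φ j x.1 * dp i f x = 0 := fun i hi =>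
      integral_mul_fderiv_eq_zero (G := fun x => G x * dPhi Φ j x.1) hf1 hf (hG.mul hs)
        (fun x t => by
          rw [hinv i hi x t]
          simp)
    have hint : ∀ i : Fin N, Integrable fun x => G x * dPhi Φ j x.1 * dp i f x := fun i =>
      integrable_of_continuousOn_of_eq_zero hf ((hG.mul hs).mul
        ((hf1.continuous_fderiv one_ne_zero).clm_apply continuous_const).continuousOn)
        fun x hx => by simp [dp, fderiv_of_notMem_tsupport ℝ hx]
    have := integral_sub (hint ⟨j, by omega⟩) (hint ⟨j + 1, h⟩)
    rw [key _ (Or.inl rfl), key _ (Or.inr rfl), sub_zero] at this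
    rw [← this]
    congr 1
    ext x
    simp only [LStarInt, h, dif_pos]
    ring
  · simp [LStarInt, h]

theorem continuousOn_dPhi_preimage (hΦ : IsPotential Φ σ R) {o m N : ℕ} (h : o + m ≤ N) {j : ℕ}
    (hj : j + 1 < m) : ContinuousOn (fun x : Phase N => dPhi Φ (o + j) x.1)
      (window o m ⁻¹' Allowed σ m) := by
  simp only [← dPhi_window h hj]
  exact (contDiffOn_dPhi hΦ m j).continuousOn.comp (continuous_window o m).continuousOn
    fun _ hx => hx

/-- The Hamiltonian field is divergence-free in the weak sense: each single term of the Liouville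
operator integrates to zero. -/
theorem integral_fderiv_liftField (hΦ : IsPotential Φ σ R) {o m N : ℕ} (h : o + m ≤ N)
    {g : Phase N → ℝ} (hg1 : ContDiff ℝ 1 g) (hg : HasCompactSupport g)
    (hgU : tsupport g ⊆ window o m ⁻¹' Allowed σ m) :
    ∫ x, fderiv ℝ g x (liftField Φ h x) = 0 := by
  have hpair : ∀ j ∈ range (m - 1),
      ContinuousOn (fun x : Phase N => dPhi Φ (o + j) x.1) (tsupport g) := fun j hj =>
    (continuousOn_dPhi_preimage hΦ h (by have := mem_range.1 hj; omega)).mono hgU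
  have hone : ContinuousOn (fun _ : Phase N => (1 : ℝ)) (tsupport g) := continuousOn_const
  have : ∫ x, -(fderiv ℝ g x (liftField Φ h x)) = 0 := by
    simp only [neg_fderiv_liftField]
    rw [integral_add, integral_finsetSum, integral_finsetSum]
    · rw [Finset.sum_eq_zero, Finset.sum_eq_zero, add_zero]
      · intro j hj
        simpa using integral_mul_LStarInt hg1 hg hone (hpair j hj) (by simp)
      · intro j hj
        have hj' : o + j < N := by have := mem_range.1 hj; omega
        simpa using integral_mul_freeTerm hg1 hg hone hj' (by simp)
    · intro j hj
      simpa using integrable_mul_LStarInt hg1 hg hone (hpair j hj)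
    · intro j _
      simpa using integrable_mul_freeTerm hg1 hg hone (o + j)
    · refine integrable_finsetSum _ fun j _ => ?_
      simpa using integrable_mul_freeTerm hg1 hg hone (o + j)
    · refine integrable_finsetSum _ fun j hj => ?_
      simpa using integrable_mul_LStarInt hg1 hg hone (hpair j hj)
  rwa [integral_neg, neg_eq_zero] at this

theorem integral_mul_LStarInt_of_window (hΦ : IsPotential Φ σ R) {o m N : ℕ} {b : Phase m → ℝ}
    {f : Phase N → ℝ} (hf1 : ContDiff ℝ 1 f) (hf : HasCompactSupport f)
    (hfU : tsupport f ⊆ Allowed σ N) (h : o + m ≤ N) (hb : ContinuousOn b (Allowed σ m)) {j : ℕ}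
    (hj : j < o ∨ o + m ≤ j) (hj' : j + 1 < o ∨ o + m ≤ j + 1) :
    ∫ x, b (window o m x) * LStarInt Φ j f x = 0 := by
  refine integral_mul_LStarInt (G := fun x => b (window o m x)) hf1 hf
    (hb.comp (continuous_window o m).continuousOn fun x hx => window_mem_allowed h (hfU hx))
    ((contDiffOn_dPhi hΦ N j).continuousOn.mono hfU) fun i hi x t => ?_
  rw [window_add_smul_snd i (by rcases hi with hi | hi <;> omega)]

theorem integral_mul_freeTerm_of_window {o m N : ℕ} {b : Phase m → ℝ}
    {f : Phase N → ℝ} (hf1 : ContDiff ℝ 1 f) (hf : HasCompactSupport f)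
    (hfU : tsupport f ⊆ Allowed σ N) (h : o + m ≤ N) (hb : ContinuousOn b (Allowed σ m)) {j : ℕ}
    (hjN : j < N) (hj : j < o ∨ o + m ≤ j) :
    ∫ x, b (window o m x) * freeTerm j f x = 0 := by
  refine integral_mul_freeTerm (G := fun x => b (window o m x)) hf1 hf
    (hb.comp (continuous_window o m).continuousOn fun x hx => window_mem_allowed h (hfU hx))
    hjN fun x t => ?_
  rw [window_add_smul_fst (⟨j, hjN⟩ : Fin N) hj]

theorem integral_mul_sum_add_sum (hΦ : IsPotential Φ σ R) {N : ℕ} {G f : Phase N → ℝ}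
    (hf1 : ContDiff ℝ 1 f) (hf : HasCompactSupport f) (hfU : tsupport f ⊆ Allowed σ N)
    (hG : ContinuousOn G (Allowed σ N)) (o m n : ℕ) :
    ∫ x, G x * (∑ j ∈ range m, freeTerm (o + j) f x + ∑ j ∈ range n, LStarInt Φ (o + j) f x) =
      (∑ j ∈ range m, ∫ x, G x * freeTerm (o + j) f x) +
        ∑ j ∈ range n, ∫ x, G x * LStarInt Φ (o + j) f x := by
  have i1 := integrable_mul_freeTerm hf1 hf (hG.mono hfU)
  have i2 := fun j => integrable_mul_LStarInt (Φ := Φ) hf1 hf (hG.mono hfU) (j := j)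
    ((contDiffOn_dPhi hΦ N j).continuousOn.mono hfU)
  simp only [mul_add, mul_sum]
  rw [integral_add, integral_finsetSum, integral_finsetSum]
  · exact fun j _ => i2 _
  · exact fun j _ => i1 _
  · exact integrable_finsetSum _ fun j _ => i1 _
  · exact integrable_finsetSum _ fun j _ => i2 _

/-- Weak form of the evolution equation for observables of the particles in a window that contains
all particles except possibly the two outermost ones. -/
theorem hasDerivAt_integral_window (hΦ : IsPotential Φ σ R) {o m N : ℕ} (ho : o ≤ 1)
    (h : o + m ≤ N) (hN : N ≤ o + m + 1) {b : Phase m → ℝ} (hb : ContinuousOn b (Allowed σ m))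
    {f : Phase N → ℝ} (hf1 : ContDiff ℝ 1 f) (hf : HasCompactSupport f)
    (hfU : tsupport f ⊆ Allowed σ N) (t : ℝ) :
    HasDerivAt (fun τ => ∫ x, b (flow Φ σ (window o m x) τ) * f x)
      ((∫ x, b (flow Φ σ (window o m x) t) * LStar Φ f x) -
        (if o = 0 then 0 else ∫ x, b (flow Φ σ (window o m x) t) * LStarInt Φ 0 f x) -
        (if o + m = N then 0
          else ∫ x, b (flow Φ σ (window o m x) t) * LStarInt Φ (N - 2) f x)) t := by
  have hAU : Allowed σ N ⊆ window o m ⁻¹' Allowed σ m := fun x hx => window_mem_allowed h hx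
  have key := (isCompleteFlow_liftFlow hΦ h).hasDerivAt_integral_comp_mul (μ := volume)
    (liftFlow_of_notMem h) (fun g h1 h2 h3 => integral_fderiv_liftField hΦ h h1 h2 h3)
    (b := fun x => b (window o m x))
    (hb.comp (continuous_window o m).continuousOn fun _ hx => hx) hf1 hf (hfU.trans hAU) t
  simp only [window_liftFlow, neg_fderiv_liftField] at key
  refine key.congr_deriv ?_
  have hbt : ContinuousOn (fun y => b (flow Φ σ y t)) (Allowed σ m) :=
    hb.comp (fun y hy => ((isCompleteFlow_flow hΦ m).contDiffAt_apply t
      hy).continuousAt.continuousWithinAt) fun y hy => (isCompleteFlow_flow hΦ m).mem t y hy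
  have hG : ContinuousOn (fun x : Phase N => b (flow Φ σ (window o m x) t)) (Allowed σ N) :=
    hbt.comp (continuous_window o m).continuousOn hAU
  have e := integral_mul_sum_add_sum hΦ hf1 hf hfU hG 0 N (N - 1)
  simp only [zero_add] at e
  simp only [LStar_eq_sum]
  rw [integral_mul_sum_add_sum hΦ hf1 hf hfU hG, e]
  -- The test function depends on all particles, so the terms outside the window are not zero
  -- pointwise. Their integrals against a function of the window vanish by parts, and the
  -- bookkeeping is done with the integrals.
  exact sum_window ho h hN
    (fun j => ∫ x, b (flow Φ σ (window o m x) t) * freeTerm j f x)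
    (fun j => ∫ x, b (flow Φ σ (window o m x) t) * LStarInt Φ j f x)
    (fun j hjN hj => integral_mul_freeTerm_of_window hf1 hf hfU h hbt hjN hj)
    (fun j hj hj' => integral_mul_LStarInt_of_window hΦ hf1 hf hfU h hbt hj hj')
    (fun j hj => by simp [LStarInt_of_le hj])

end Integrals

end TopInt

/-! ### Double sequences of functions and the operators a₋, a₊ -/

namespace TopInt

/-- Double sequences of functions on the phase spaces. -/
abbrev Fam : Type := (s : ℕ × ℕ) → Phase (s.1 + s.2) → ℝ

/-- The operator `a⁺₋` on double sequences of functions. -/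
noncomputable def am (D : Fam) : Fam := fun s x =>
  if s.1 = 0 then 0 else D (s.1 - 1, s.2) (window 1 (s.1 - 1 + s.2) x)

/-- The operator `a⁺₊` on double sequences of functions. -/
noncomputable def ap (D : Fam) : Fam := fun s x =>
  if s.2 = 0 then 0 else D (s.1, s.2 - 1) (window 0 (s.1 + (s.2 - 1)) x)

/-- The operator `(1 - a⁺₋)(1 - a⁺₊)`. -/
noncomputable def diff (D : Fam) : Fam := fun s x =>
  D s x - am D s x - ap D s x + am (ap D) s x

/-- The evolution of all members of a double sequence. -/
noncomputable def evolve (Φ : ℝ → ℝ) (σ : ℝ) (D : Fam) (t : ℝ) : Fam := fun s x =>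
  D s (flow Φ σ x t)

section Fam

variable {Φ : ℝ → ℝ} {σ R : ℝ}

theorem ap_am (D : Fam) : ap (am D) = am (ap D) := by
  funext s x
  by_cases h1 : s.1 = 0
  · simp [ap, am, h1]
  by_cases h2 : s.2 = 0
  · simp [ap, am, h2]
  simp only [ap, am, h1, h2, if_false]
  rw [window_window (by omega), window_window (by omega)]

theorem am_diff (D : Fam) (s : ℕ × ℕ) (x : Phase (s.1 + s.2)) :
    am (diff D) s x = am D s x - am (am D) s x - am (ap D) s x + am (am (ap D)) s x := by
  by_cases h : s.1 = 0
  · simp [am, h]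
  · simp only [am, h, if_false, diff]

theorem ap_diff (D : Fam) (s : ℕ × ℕ) (x : Phase (s.1 + s.2)) :
    ap (diff D) s x = ap D s x - am (ap D) s x - ap (ap D) s x + ap (ap (am D)) s x := by
  rw [← ap_am]
  by_cases h : s.2 = 0
  · simp [ap, h]
  · have e : ∀ G : Fam, ap G s x = G (s.1, s.2 - 1) (window 0 (s.1 + (s.2 - 1)) x) := fun G =>
      if_neg h
    rw [e, e, e, e (ap D), e (ap (am D)), diff, ap_am]

theorem am_window_mem {s : ℕ × ℕ} (h : s.1 ≠ 0) {x : Phase (s.1 + s.2)}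
    (hx : x ∈ Allowed σ (s.1 + s.2)) :
    window 1 (s.1 - 1 + s.2) x ∈ Allowed σ (s.1 - 1 + s.2) :=
  window_mem_allowed (by omega) hx

theorem ap_window_mem {s : ℕ × ℕ} {x : Phase (s.1 + s.2)}
    (hx : x ∈ Allowed σ (s.1 + s.2)) :
    window 0 (s.1 + (s.2 - 1)) x ∈ Allowed σ (s.1 + (s.2 - 1)) :=
  window_mem_allowed (by omega) hx

theorem contDiffOn_am {n : WithTop ℕ∞} {D : Fam}
    (hD : ∀ s, ContDiffOn ℝ n (D s) (Allowed σ (s.1 + s.2))) (s : ℕ × ℕ) :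
    ContDiffOn ℝ n (am D s) (Allowed σ (s.1 + s.2)) := by
  by_cases h : s.1 = 0
  · have : am D s = fun _ => 0 := by
      funext x
      simp [am, h]
    rw [this]
    exact contDiffOn_const
  · have : am D s = fun x => D (s.1 - 1, s.2) (window 1 (s.1 - 1 + s.2) x) := by
      funext x
      simp [am, h]
    rw [this]
    exact (hD (s.1 - 1, s.2)).comp (contDiff_window _ _).contDiffOn fun x hx => am_window_mem h hx

theorem contDiffOn_ap {n : WithTop ℕ∞} {D : Fam}
    (hD : ∀ s, ContDiffOn ℝ n (D s) (Allowed σ (s.1 + s.2))) (s : ℕ × ℕ) :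
    ContDiffOn ℝ n (ap D s) (Allowed σ (s.1 + s.2)) := by
  by_cases h : s.2 = 0
  · have : ap D s = fun _ => 0 := by
      funext x
      simp [ap, h]
    rw [this]
    exact contDiffOn_const
  · have : ap D s = fun x => D (s.1, s.2 - 1) (window 0 (s.1 + (s.2 - 1)) x) := by
      funext x
      simp [ap, h]
    rw [this]
    exact (hD (s.1, s.2 - 1)).comp (contDiff_window _ _).contDiffOn fun x hx => ap_window_mem hx

theorem continuousOn_am {D : Fam} (hD : ∀ s, ContinuousOn (D s) (Allowed σ (s.1 + s.2)))
    (s : ℕ × ℕ) : ContinuousOn (am D s) (Allowed σ (s.1 + s.2)) :=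
  contDiffOn_zero.1 (contDiffOn_am (fun s => contDiffOn_zero.2 (hD s)) s)

theorem continuousOn_ap {D : Fam} (hD : ∀ s, ContinuousOn (D s) (Allowed σ (s.1 + s.2)))
    (s : ℕ × ℕ) : ContinuousOn (ap D s) (Allowed σ (s.1 + s.2)) :=
  contDiffOn_zero.1 (contDiffOn_ap (fun s => contDiffOn_zero.2 (hD s)) s)

theorem contDiffOn_evolve (hΦ : IsPotential Φ σ R) {D : Fam}
    (hD : ∀ s, ContDiffOn ℝ 1 (D s) (Allowed σ (s.1 + s.2))) (s : ℕ × ℕ) :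
    ContDiffOn ℝ 1 (fun z : ℝ × Phase (s.1 + s.2) => evolve Φ σ D z.1 s z.2)
      (Set.univ ×ˢ Allowed σ (s.1 + s.2)) :=
  (hD s).comp (isCompleteFlow_flow hΦ _).contDiffOn_uncurry fun z hz =>
    (isCompleteFlow_flow hΦ _).mem z.1 _ hz.2

theorem continuousOn_evolve_uncurry (hΦ : IsPotential Φ σ R) {D : Fam}
    (hD : ∀ s, ContinuousOn (D s) (Allowed σ (s.1 + s.2))) (s : ℕ × ℕ) :
    ContinuousOn (fun z : ℝ × Phase (s.1 + s.2) => evolve Φ σ D z.1 s z.2)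
      (Set.univ ×ˢ Allowed σ (s.1 + s.2)) :=
  (hD s).comp (isCompleteFlow_flow hΦ _).continuousOn_uncurry fun z hz =>
    (isCompleteFlow_flow hΦ _).mem z.1 _ hz.2

theorem contDiffOn_evolve_apply (hΦ : IsPotential Φ σ R) {D : Fam}
    (hD : ∀ s, ContDiffOn ℝ 1 (D s) (Allowed σ (s.1 + s.2))) (t : ℝ) (s : ℕ × ℕ) :
    ContDiffOn ℝ 1 (evolve Φ σ D t s) (Allowed σ (s.1 + s.2)) :=
  (contDiffOn_evolve hΦ hD s).comp (contDiffOn_const.prodMk contDiffOn_id) fun _ hx => ⟨trivial, hx⟩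

theorem continuousOn_evolve (hΦ : IsPotential Φ σ R) {D : Fam}
    (hD : ∀ s, ContinuousOn (D s) (Allowed σ (s.1 + s.2))) (t : ℝ) (s : ℕ × ℕ) :
    ContinuousOn (evolve Φ σ D t s) (Allowed σ (s.1 + s.2)) :=
  (continuousOn_evolve_uncurry hΦ hD s).comp (continuousOn_const.prodMk continuousOn_id)
    fun _ hx => ⟨trivial, hx⟩

/-- Joint regularity of a double sequence that depends on time passes to `a⁺₋`. -/
theorem contDiffOn_am_uncurry {n : WithTop ℕ∞} {D : ℝ → Fam}
    (hD : ∀ s : ℕ × ℕ, ContDiffOn ℝ n (fun z : ℝ × Phase (s.1 + s.2) => D z.1 s z.2)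
      (Set.univ ×ˢ Allowed σ (s.1 + s.2))) (s : ℕ × ℕ) :
    ContDiffOn ℝ n (fun z : ℝ × Phase (s.1 + s.2) => am (D z.1) s z.2)
      (Set.univ ×ˢ Allowed σ (s.1 + s.2)) := by
  by_cases h : s.1 = 0
  · simp only [am, h, if_true]
    exact contDiffOn_const
  · simp only [am, h, if_false]
    exact (hD (s.1 - 1, s.2)).comp
      (contDiff_fst.prodMk ((contDiff_window _ _).comp contDiff_snd)).contDiffOn
      fun z hz => ⟨trivial, am_window_mem h hz.2⟩

theorem contDiffOn_ap_uncurry {n : WithTop ℕ∞} {D : ℝ → Fam}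
    (hD : ∀ s : ℕ × ℕ, ContDiffOn ℝ n (fun z : ℝ × Phase (s.1 + s.2) => D z.1 s z.2)
      (Set.univ ×ˢ Allowed σ (s.1 + s.2))) (s : ℕ × ℕ) :
    ContDiffOn ℝ n (fun z : ℝ × Phase (s.1 + s.2) => ap (D z.1) s z.2)
      (Set.univ ×ˢ Allowed σ (s.1 + s.2)) := by
  by_cases h : s.2 = 0
  · simp only [ap, h, if_true]
    exact contDiffOn_const
  · simp only [ap, h, if_false]
    exact (hD (s.1, s.2 - 1)).comp
      (contDiff_fst.prodMk ((contDiff_window _ _).comp contDiff_snd)).contDiffOn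
      fun z hz => ⟨trivial, ap_window_mem hz.2⟩

theorem contDiffOn_diff_uncurry {n : WithTop ℕ∞} {D : ℝ → Fam}
    (hD : ∀ s : ℕ × ℕ, ContDiffOn ℝ n (fun z : ℝ × Phase (s.1 + s.2) => D z.1 s z.2)
      (Set.univ ×ˢ Allowed σ (s.1 + s.2))) (s : ℕ × ℕ) :
    ContDiffOn ℝ n (fun z : ℝ × Phase (s.1 + s.2) => diff (D z.1) s z.2)
      (Set.univ ×ˢ Allowed σ (s.1 + s.2)) :=
  (((hD s).sub (contDiffOn_am_uncurry hD s)).sub (contDiffOn_ap_uncurry hD s)).add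
    (contDiffOn_am_uncurry (D := fun t => ap (D t)) (fun s => contDiffOn_ap_uncurry hD s) s)

/-- The form in which a₋a₋D is seen to be independent of the particles in positions 0 and 1, so that
the interaction of this pair annihilates it. -/
theorem am_am_window (D : Fam) (s : ℕ × ℕ) :
    am (am D) s = (fun _ => 0) ∨ ∃ b : Phase (s.1 - 1 - 1 + s.2) → ℝ,
      2 ≤ s.1 ∧ b = D (s.1 - 1 - 1, s.2) ∧
        am (am D) s = fun x => b (window 2 (s.1 - 1 - 1 + s.2) x) := by
  by_cases h : s.1 - 1 = 0
  · left
    funext x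
    simp [am, h]
  · right
    refine ⟨D (s.1 - 1 - 1, s.2), by omega, rfl, ?_⟩
    funext x
    have h' : s.1 ≠ 0 := by omega
    simp only [am, h, h', if_false]
    rw [window_window (by omega)]

theorem ap_ap_window (D : Fam) (s : ℕ × ℕ) :
    ap (ap D) s = (fun _ => 0) ∨ ∃ b : Phase (s.1 + (s.2 - 1 - 1)) → ℝ,
      2 ≤ s.2 ∧ b = D (s.1, s.2 - 1 - 1) ∧
        ap (ap D) s = fun x => b (window 0 (s.1 + (s.2 - 1 - 1)) x) := by
  by_cases h : s.2 - 1 = 0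
  · left
    funext x
    simp [ap, h]
  · right
    refine ⟨D (s.1, s.2 - 1 - 1), by omega, rfl, ?_⟩
    funext x
    have h' : s.2 ≠ 0 := by omega
    simp only [ap, h, h', if_false]
    rw [window_window (by omega)]

end Fam

/-! ### The hierarchy in weak form: existence -/

section Weak

variable {Φ : ℝ → ℝ} {σ R : ℝ}

/-- Right-hand side of the hierarchy, paired with a test function. -/
noncomputable def weakGenerator (Φ : ℝ → ℝ) (B : Fam) (s : ℕ × ℕ) (f : Phase (s.1 + s.2) → ℝ) : ℝ :=
  (∫ x, B s x * LStar Φ f x) + (∫ x, am B s x * LStarInt Φ 0 f x) +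
    ∫ x, ap B s x * LStarInt Φ (s.1 + s.2 - 2) f x

theorem continuousOn_LStar (hΦ : IsPotential Φ σ R) {N : ℕ} {f : Phase N → ℝ}
    (hf : ContDiff ℝ 1 f) : ContinuousOn (LStar Φ f) (Allowed σ N) := by
  have : LStar Φ f = fun x => ∑ j ∈ range N, freeTerm j f x +
      ∑ j ∈ range (N - 1), LStarInt Φ j f x := funext fun x => LStar_eq_sum f x
  rw [this]
  exact (continuousOn_finsetSum _ fun j _ => (continuous_freeTerm hf j).continuousOn).add
    (continuousOn_finsetSum _ fun j _ => continuousOn_LStarInt hf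
      (contDiffOn_dPhi hΦ N j).continuousOn)

theorem LStar_of_notMem_tsupport {N : ℕ} {f : Phase N → ℝ} {x : Phase N} (hx : x ∉ tsupport f) :
    LStar Φ f x = 0 := by
  simp [LStar_eq_sum, freeTerm_of_notMem_tsupport hx, LStarInt_of_notMem_tsupport hx]

theorem integral_sub_sub_add_mul {N : ℕ} {G₁ G₂ G₃ G₄ g : Phase N → ℝ} {K : Set (Phase N)}
    (hK : IsCompact K) (h₁ : ContinuousOn G₁ K) (h₂ : ContinuousOn G₂ K) (h₃ : ContinuousOn G₃ K)
    (h₄ : ContinuousOn G₄ K) (hg : ContinuousOn g K) (h0 : ∀ x ∉ K, g x = 0) :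
    ∫ x, (G₁ x - G₂ x - G₃ x + G₄ x) * g x =
      (∫ x, G₁ x * g x) - (∫ x, G₂ x * g x) - (∫ x, G₃ x * g x) + ∫ x, G₄ x * g x := by
  have hi : ∀ G : Phase N → ℝ, ContinuousOn G K → Integrable fun x => G x * g x := fun G hG =>
    integrable_of_continuousOn_of_eq_zero hK (hG.mul hg) fun x hx => by rw [h0 x hx, mul_zero]
  have e : (fun x => (G₁ x - G₂ x - G₃ x + G₄ x) * g x) =
      fun x => G₁ x * g x - G₂ x * g x - G₃ x * g x + G₄ x * g x := by
    ext x
    ring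
  have i₁ : Integrable fun x => G₁ x * g x - G₂ x * g x := (hi _ h₁).sub (hi _ h₂)
  have i₂ : Integrable fun x => G₁ x * g x - G₂ x * g x - G₃ x * g x := i₁.sub (hi _ h₃)
  rw [e, integral_add i₂ (hi _ h₄), integral_sub i₁ (hi _ h₃), integral_sub (hi _ h₁) (hi _ h₂)]

theorem hasDerivAt_integral_evolve (hΦ : IsPotential Φ σ R) {D : Fam}
    (hD : ∀ s, ContinuousOn (D s) (Allowed σ (s.1 + s.2))) {s : ℕ × ℕ}
    {f : Phase (s.1 + s.2) → ℝ} (hf1 : ContDiff ℝ 1 f) (hf : HasCompactSupport f)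
    (hfU : tsupport f ⊆ Allowed σ (s.1 + s.2)) (t : ℝ) :
    HasDerivAt (fun τ => ∫ x, evolve Φ σ D τ s x * f x)
      (∫ x, evolve Φ σ D t s x * LStar Φ f x) t := by
  have := hasDerivAt_integral_window hΦ (o := 0) (m := s.1 + s.2) zero_le_one (by omega)
    (by omega) (hD s) hf1 hf hfU t
  simpa only [window_zero_self, if_true, zero_add, sub_zero, evolve] using this

/-- The function a₋D moves with a Hamiltonian that lacks the pair of the two leftmost particles.
Compared with the full Liouville operator, the interaction of this pair is missing; it is the source
of an inhomogeneous term of the hierarchy. -/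
theorem hasDerivAt_integral_am_evolve (hΦ : IsPotential Φ σ R) {D : Fam}
    (hD : ∀ s, ContinuousOn (D s) (Allowed σ (s.1 + s.2))) {s : ℕ × ℕ}
    {f : Phase (s.1 + s.2) → ℝ} (hf1 : ContDiff ℝ 1 f) (hf : HasCompactSupport f)
    (hfU : tsupport f ⊆ Allowed σ (s.1 + s.2)) (t : ℝ) :
    HasDerivAt (fun τ => ∫ x, am (evolve Φ σ D τ) s x * f x)
      ((∫ x, am (evolve Φ σ D t) s x * LStar Φ f x) -
        ∫ x, am (evolve Φ σ D t) s x * LStarInt Φ 0 f x) t := by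
  by_cases h : s.1 = 0
  · simpa [am, h] using hasDerivAt_const t (0 : ℝ)
  · have := hasDerivAt_integral_window hΦ (o := 1) (m := s.1 - 1 + s.2) le_rfl (by omega)
      (by omega) (hD (s.1 - 1, s.2)) hf1 hf hfU t
    have hN : 1 + (s.1 - 1 + s.2) = s.1 + s.2 := by omega
    simpa only [am, h, if_false, hN, if_true, one_ne_zero, sub_zero, evolve] using this

theorem hasDerivAt_integral_ap_evolve (hΦ : IsPotential Φ σ R) {D : Fam}
    (hD : ∀ s, ContinuousOn (D s) (Allowed σ (s.1 + s.2))) {s : ℕ × ℕ}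
    {f : Phase (s.1 + s.2) → ℝ} (hf1 : ContDiff ℝ 1 f) (hf : HasCompactSupport f)
    (hfU : tsupport f ⊆ Allowed σ (s.1 + s.2)) (t : ℝ) :
    HasDerivAt (fun τ => ∫ x, ap (evolve Φ σ D τ) s x * f x)
      ((∫ x, ap (evolve Φ σ D t) s x * LStar Φ f x) -
        ∫ x, ap (evolve Φ σ D t) s x * LStarInt Φ (s.1 + s.2 - 2) f x) t := by
  by_cases h : s.2 = 0
  · simpa [ap, h] using hasDerivAt_const t (0 : ℝ)
  · have := hasDerivAt_integral_window hΦ (o := 0) (m := s.1 + (s.2 - 1)) zero_le_one (by omega)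
      (by omega) (hD (s.1, s.2 - 1)) hf1 hf hfU t
    have hN : 0 + (s.1 + (s.2 - 1)) ≠ s.1 + s.2 := by omega
    simpa only [ap, h, if_false, hN, if_true, sub_zero, evolve] using this

theorem am_ap_eq (D : Fam) {s : ℕ × ℕ} (h1 : s.1 ≠ 0) (h2 : s.2 ≠ 0) (x : Phase (s.1 + s.2)) :
    am (ap D) s x = D (s.1 - 1, s.2 - 1) (window 1 (s.1 - 1 + (s.2 - 1)) x) := by
  simp only [am, ap, h1, h2, if_false]
  rw [window_window (by omega)]

theorem am_ap_eq_zero (D : Fam) {s : ℕ × ℕ} (h : s.1 = 0 ∨ s.2 = 0) (x : Phase (s.1 + s.2)) :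
    am (ap D) s x = 0 := by
  rcases h with h | h <;> simp [am, ap, h]

theorem hasDerivAt_integral_am_ap_evolve (hΦ : IsPotential Φ σ R) {D : Fam}
    (hD : ∀ s, ContinuousOn (D s) (Allowed σ (s.1 + s.2))) {s : ℕ × ℕ}
    {f : Phase (s.1 + s.2) → ℝ} (hf1 : ContDiff ℝ 1 f) (hf : HasCompactSupport f)
    (hfU : tsupport f ⊆ Allowed σ (s.1 + s.2)) (t : ℝ) :
    HasDerivAt (fun τ => ∫ x, am (ap (evolve Φ σ D τ)) s x * f x)
      ((∫ x, am (ap (evolve Φ σ D t)) s x * LStar Φ f x) -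
        (∫ x, am (ap (evolve Φ σ D t)) s x * LStarInt Φ 0 f x) -
        ∫ x, am (ap (evolve Φ σ D t)) s x * LStarInt Φ (s.1 + s.2 - 2) f x) t := by
  by_cases h : s.1 = 0 ∨ s.2 = 0
  · simpa [am_ap_eq_zero _ h] using hasDerivAt_const t (0 : ℝ)
  · push Not at h
    have := hasDerivAt_integral_window hΦ (o := 1) (m := s.1 - 1 + (s.2 - 1)) le_rfl (by omega)
      (by omega) (hD (s.1 - 1, s.2 - 1)) hf1 hf hfU t
    have hN : 1 + (s.1 - 1 + (s.2 - 1)) ≠ s.1 + s.2 := by omega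
    simpa only [am_ap_eq _ h.1 h.2, if_false, hN, one_ne_zero, evolve] using this

theorem integral_am_am_mul_LStarInt (hΦ : IsPotential Φ σ R) {D : Fam}
    (hD : ∀ s, ContinuousOn (D s) (Allowed σ (s.1 + s.2))) {s : ℕ × ℕ}
    {f : Phase (s.1 + s.2) → ℝ} (hf1 : ContDiff ℝ 1 f) (hf : HasCompactSupport f)
    (hfU : tsupport f ⊆ Allowed σ (s.1 + s.2)) :
    ∫ x, am (am D) s x * LStarInt Φ 0 f x = 0 := by
  rcases am_am_window D s with h | ⟨b, h2, hb, h⟩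
  · simp [h]
  · rw [h]
    refine integral_mul_LStarInt_of_window hΦ hf1 hf hfU (by omega) ?_ (Or.inl (by omega))
      (Or.inl (by omega))
    rw [hb]
    exact hD (s.1 - 1 - 1, s.2)

theorem integral_ap_ap_mul_LStarInt (hΦ : IsPotential Φ σ R) {D : Fam}
    (hD : ∀ s, ContinuousOn (D s) (Allowed σ (s.1 + s.2))) {s : ℕ × ℕ}
    {f : Phase (s.1 + s.2) → ℝ} (hf1 : ContDiff ℝ 1 f) (hf : HasCompactSupport f)
    (hfU : tsupport f ⊆ Allowed σ (s.1 + s.2)) :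
    ∫ x, ap (ap D) s x * LStarInt Φ (s.1 + s.2 - 2) f x = 0 := by
  rcases ap_ap_window D s with h | ⟨b, h2, hb, h⟩
  · simp [h]
  · rw [h]
    refine integral_mul_LStarInt_of_window hΦ hf1 hf hfU (by omega) ?_ (Or.inr (by omega))
      (Or.inr (by omega))
    rw [hb]
    exact hD (s.1, s.2 - 1 - 1)

/-- Existence of generalized solutions. -/
theorem hasDerivAt_integral_diff_evolve (hΦ : IsPotential Φ σ R) {D : Fam}
    (hD : ∀ s, ContinuousOn (D s) (Allowed σ (s.1 + s.2))) {s : ℕ × ℕ}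
    {f : Phase (s.1 + s.2) → ℝ} (hf1 : ContDiff ℝ 1 f) (hf : HasCompactSupport f)
    (hfU : tsupport f ⊆ Allowed σ (s.1 + s.2)) (t : ℝ) :
    HasDerivAt (fun τ => ∫ x, diff (evolve Φ σ D τ) s x * f x)
      (weakGenerator Φ (diff (evolve Φ σ D t)) s f) t := by
  have c := fun τ => continuousOn_evolve hΦ hD τ
  have cm := fun τ => continuousOn_am (c τ)
  have cp := fun τ => continuousOn_ap (c τ)
  have cmp := fun τ => continuousOn_am (cp τ)
  have hL := (continuousOn_LStar hΦ hf1).mono hfU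
  have hI := fun j => (continuousOn_LStarInt hf1 (contDiffOn_dPhi hΦ _ j).continuousOn).mono hfU
  have e1 : ∀ τ, ∫ x, diff (evolve Φ σ D τ) s x * f x =
      (∫ x, evolve Φ σ D τ s x * f x) - (∫ x, am (evolve Φ σ D τ) s x * f x) -
        (∫ x, ap (evolve Φ σ D τ) s x * f x) + ∫ x, am (ap (evolve Φ σ D τ)) s x * f x := fun τ =>
    integral_sub_sub_add_mul hf ((c τ s).mono hfU) ((cm τ s).mono hfU) ((cp τ s).mono hfU)
      ((cmp τ s).mono hfU) hf1.continuous.continuousOn fun x hx =>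
        image_eq_zero_of_notMem_tsupport hx
  simp only [e1]
  refine ((((hasDerivAt_integral_evolve hΦ hD hf1 hf hfU t).sub
    (hasDerivAt_integral_am_evolve hΦ hD hf1 hf hfU t)).sub
    (hasDerivAt_integral_ap_evolve hΦ hD hf1 hf hfU t)).add
    (hasDerivAt_integral_am_ap_evolve hΦ hD hf1 hf hfU t)).congr_deriv ?_
  rw [weakGenerator]
  have e2 := integral_sub_sub_add_mul hf ((c t s).mono hfU) ((cm t s).mono hfU)
    ((cp t s).mono hfU) ((cmp t s).mono hfU) hL fun x hx => LStar_of_notMem_tsupport hx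
  have e3 := integral_sub_sub_add_mul hf ((cm t s).mono hfU) ((continuousOn_am (cm t) s).mono hfU)
    ((cmp t s).mono hfU) ((continuousOn_am (cmp t) s).mono hfU) (hI 0)
    fun x hx => LStarInt_of_notMem_tsupport hx 0
  have e4 := integral_sub_sub_add_mul hf ((cp t s).mono hfU) ((cmp t s).mono hfU)
    ((continuousOn_ap (cp t) s).mono hfU)
    ((continuousOn_ap (continuousOn_ap (cm t)) s).mono hfU) (hI (s.1 + s.2 - 2))
    fun x hx => LStarInt_of_notMem_tsupport hx _
  -- The missing interactions act on a₋E - a₋a₊E and a₊E - a₋a₊E, where E is the evolved sequence.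
  -- The hierarchy has a₋ and a₊ of (1 - a₋)(1 - a₊)E instead, and the surplus terms with a₋a₋ and
  -- a₊a₊ contribute nothing.
  rw [integral_am_am_mul_LStarInt hΦ (c t) hf1 hf hfU,
    integral_am_am_mul_LStarInt hΦ (cp t) hf1 hf hfU] at e3
  rw [integral_ap_ap_mul_LStarInt hΦ (c t) hf1 hf hfU,
    integral_ap_ap_mul_LStarInt hΦ (cm t) hf1 hf hfU] at e4
  simp only [am_diff, ap_diff]
  rw [e3, e4]
  simp only [diff]
  rw [e2]
  ring

end Weak

/-! ### The hierarchy in classical form: existence -/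

section Classical

variable {Φ : ℝ → ℝ} {σ R : ℝ}

/-- Right-hand side of the hierarchy. -/
noncomputable def classicalGenerator (Φ : ℝ → ℝ) (B : Fam) (s : ℕ × ℕ) (x : Phase (s.1 + s.2)) :
    ℝ :=
  -LStar Φ (B s) x - LStarInt Φ 0 (am B s) x - LStarInt Φ (s.1 + s.2 - 2) (ap B s) x

theorem LStar_eq_fderiv {N : ℕ} (f : Phase N → ℝ) (x : Phase N) :
    LStar Φ f x = -(fderiv ℝ f x (hamiltonField Φ x)) := by
  have h := neg_fderiv_liftField (Φ := Φ) (o := 0) (m := N) (zero_add N).le f x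
  simp only [zero_add] at h
  rw [LStar_eq_sum, ← h, liftField, window_zero_self]
  have := window_embed (o := 0) (m := N) (zero_add N).le (hamiltonField Φ x)
  rw [window_zero_self] at this
  rw [this]

/-- At a fixed point the operator is a directional derivative, in a direction that does not depend
on f. Its linearity and locality thus reduce to those of `fderiv`. -/
theorem exists_LStarInt_eq_fderiv {N : ℕ} (j : ℕ) (x : Phase N) :
    ∃ w : Phase N, ∀ f : Phase N → ℝ, LStarInt Φ j f x = fderiv ℝ f x w := by
  by_cases h : j + 1 < N
  · refine ⟨dPhi Φ j x.1 • ((0, Pi.single ⟨j, by omega⟩ 1) - (0, Pi.single ⟨j + 1, h⟩ 1)),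
      fun f => ?_⟩
    rw [map_smul, map_sub, smul_eq_mul, LStarInt, dif_pos h]
    rfl
  · exact ⟨0, fun f => by rw [LStarInt, dif_neg h, map_zero]⟩

theorem fderiv_sub_sub_add {N : ℕ} {G₁ G₂ G₃ G₄ : Phase N → ℝ} {x : Phase N}
    (h₁ : DifferentiableAt ℝ G₁ x) (h₂ : DifferentiableAt ℝ G₂ x) (h₃ : DifferentiableAt ℝ G₃ x)
    (h₄ : DifferentiableAt ℝ G₄ x) :
    fderiv ℝ (fun y => G₁ y - G₂ y - G₃ y + G₄ y) x =
      fderiv ℝ G₁ x - fderiv ℝ G₂ x - fderiv ℝ G₃ x + fderiv ℝ G₄ x :=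
  (((h₁.hasFDerivAt.sub h₂.hasFDerivAt).sub h₃.hasFDerivAt).add h₄.hasFDerivAt).fderiv

theorem LStar_sub_sub_add {N : ℕ} {G₁ G₂ G₃ G₄ : Phase N → ℝ} {x : Phase N}
    (h₁ : DifferentiableAt ℝ G₁ x) (h₂ : DifferentiableAt ℝ G₂ x) (h₃ : DifferentiableAt ℝ G₃ x)
    (h₄ : DifferentiableAt ℝ G₄ x) :
    LStar Φ (fun y => G₁ y - G₂ y - G₃ y + G₄ y) x =
      LStar Φ G₁ x - LStar Φ G₂ x - LStar Φ G₃ x + LStar Φ G₄ x := by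
  simp only [LStar_eq_fderiv]
  rw [fderiv_sub_sub_add h₁ h₂ h₃ h₄]
  simp only [add_apply, sub_apply]
  ring

theorem LStarInt_sub_sub_add {N j : ℕ} {G₁ G₂ G₃ G₄ : Phase N → ℝ} {x : Phase N}
    (h₁ : DifferentiableAt ℝ G₁ x) (h₂ : DifferentiableAt ℝ G₂ x) (h₃ : DifferentiableAt ℝ G₃ x)
    (h₄ : DifferentiableAt ℝ G₄ x) :
    LStarInt Φ j (fun y => G₁ y - G₂ y - G₃ y + G₄ y) x =
      LStarInt Φ j G₁ x - LStarInt Φ j G₂ x - LStarInt Φ j G₃ x + LStarInt Φ j G₄ x := by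
  obtain ⟨w, hw⟩ := exists_LStarInt_eq_fderiv (Φ := Φ) j x
  simp only [hw]
  rw [fderiv_sub_sub_add h₁ h₂ h₃ h₄]
  rfl

/-- The evolution equation for observables of the particles in a window that contains all particles
except possibly the two outermost ones. -/
theorem hasDerivAt_window (hΦ : IsPotential Φ σ R) {o m N : ℕ} (ho : o ≤ 1)
    (h : o + m ≤ N) (hN : N ≤ o + m + 1) {b : Phase m → ℝ} (hb : ContDiffOn ℝ 1 b (Allowed σ m))
    {x : Phase N} (hx : x ∈ Allowed σ N) (t : ℝ) :
    HasDerivAt (fun τ => b (flow Φ σ (window o m x) τ))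
      (-(LStar Φ (fun y => b (flow Φ σ (window o m y) t)) x -
        (if o = 0 then 0 else LStarInt Φ 0 (fun y => b (flow Φ σ (window o m y) t)) x) -
        (if o + m = N then 0
          else LStarInt Φ (N - 2) (fun y => b (flow Φ σ (window o m y) t)) x))) t := by
  have hfl := isCompleteFlow_liftFlow hΦ h
  have hxU : x ∈ window o m ⁻¹' Allowed σ m := window_mem_allowed h hx
  have hd : DifferentiableAt ℝ (fun y => b (window o m y)) (liftFlow Φ σ h t x) := by
    have hmem := hfl.mem t x hxU
    exact DifferentiableAt.comp _
      ((hb.contDiffAt ((isOpen_allowed σ m).mem_nhds hmem)).differentiableAt one_ne_zero)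
      (windowL N o m).differentiableAt
  have key := hfl.hasDerivAt_comp t hxU hd
  -- The chain rule gives the derivative of b at the transported point, the Liouville operator the
  -- derivative of the transported b at x. They agree because the flow preserves its field.
  rw [← hfl.fderiv_comp_field t hxU hd] at key
  simp only [window_liftFlow] at key
  rw [← neg_fderiv_liftField_window ho h hN (fun y => b (flow Φ σ y t)) x, neg_neg]
  exact key

theorem LStarInt_am_am {D : Fam} (s : ℕ × ℕ) (x : Phase (s.1 + s.2)) :
    LStarInt Φ 0 (am (am D) s) x = 0 := by
  rcases am_am_window D s with h | ⟨b, h2, hb, h⟩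
  · obtain ⟨w, hw⟩ := exists_LStarInt_eq_fderiv (Φ := Φ) 0 x
    rw [hw, h]
    simp
  · rw [h]
    exact LStarInt_eq_zero_of_window (Or.inl (by omega)) (Or.inl (by omega)) b x

theorem LStarInt_ap_ap {D : Fam} (s : ℕ × ℕ) (x : Phase (s.1 + s.2)) :
    LStarInt Φ (s.1 + s.2 - 2) (ap (ap D) s) x = 0 := by
  rcases ap_ap_window D s with h | ⟨b, h2, hb, h⟩
  · obtain ⟨w, hw⟩ := exists_LStarInt_eq_fderiv (Φ := Φ) (s.1 + s.2 - 2) x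
    rw [hw, h]
    simp
  · rw [h]
    exact LStarInt_eq_zero_of_window (Or.inr (by omega)) (Or.inr (by omega)) b x

theorem LStar_zero_fun {N : ℕ} (x : Phase N) : LStar Φ (fun _ => 0) x = 0 := by
  simp [LStar_eq_fderiv]

theorem LStarInt_zero_fun {N j : ℕ} (x : Phase N) : LStarInt Φ j (fun _ => 0) x = 0 := by
  obtain ⟨w, hw⟩ := exists_LStarInt_eq_fderiv (Φ := Φ) j x
  simp [hw]

/-- Existence of classical solutions. -/
theorem hasDerivAt_diff_evolve (hΦ : IsPotential Φ σ R) {D : Fam}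
    (hD : ∀ s, ContDiffOn ℝ 1 (D s) (Allowed σ (s.1 + s.2))) {s : ℕ × ℕ}
    {x : Phase (s.1 + s.2)} (hx : x ∈ Allowed σ (s.1 + s.2)) (t : ℝ) :
    HasDerivAt (fun τ => diff (evolve Φ σ D τ) s x)
      (classicalGenerator Φ (diff (evolve Φ σ D t)) s x) t := by
  set E := evolve Φ σ D t with hE
  have hd : ∀ {G : Fam}, (∀ s, ContDiffOn ℝ 1 (G s) (Allowed σ (s.1 + s.2))) →
      DifferentiableAt ℝ (G s) x := fun hG =>
    ((hG s).contDiffAt ((isOpen_allowed σ _).mem_nhds hx)).differentiableAt one_ne_zero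
  have c : ∀ s, ContDiffOn ℝ 1 (E s) (Allowed σ (s.1 + s.2)) := contDiffOn_evolve_apply hΦ hD t
  have cm := contDiffOn_am c
  have cp := contDiffOn_ap c
  have cmp := contDiffOn_am cp
  have h1 : HasDerivAt (fun τ => evolve Φ σ D τ s x) (-LStar Φ (E s) x) t := by
    have := hasDerivAt_window hΦ (o := 0) (m := s.1 + s.2) zero_le_one (by omega) (by omega)
      (hD s) hx t
    simp only [window_zero_self, if_true, zero_add, sub_zero] at this
    exact this
  have h2 : HasDerivAt (fun τ => am (evolve Φ σ D τ) s x)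
      (-(LStar Φ (am E s) x - LStarInt Φ 0 (am E s) x)) t := by
    by_cases h : s.1 = 0
    · have : ∀ D : Fam, am D s = fun _ => 0 := fun D => by
        funext y
        simp [am, h]
      simpa [this, LStar_zero_fun, LStarInt_zero_fun] using hasDerivAt_const t (0 : ℝ)
    · have := hasDerivAt_window hΦ (o := 1) (m := s.1 - 1 + s.2) le_rfl (by omega)
        (by omega) (hD (s.1 - 1, s.2)) hx t
      have hN : 1 + (s.1 - 1 + s.2) = s.1 + s.2 := by omega
      have e : ∀ D : Fam, am D s = fun y => D (s.1 - 1, s.2) (window 1 (s.1 - 1 + s.2) y) :=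
        fun D => by
          funext y
          simp [am, h]
      simpa only [e, hN, if_true, one_ne_zero, if_false, sub_zero, evolve, hE] using this
  have h3 : HasDerivAt (fun τ => ap (evolve Φ σ D τ) s x)
      (-(LStar Φ (ap E s) x - LStarInt Φ (s.1 + s.2 - 2) (ap E s) x)) t := by
    by_cases h : s.2 = 0
    · have : ∀ D : Fam, ap D s = fun _ => 0 := fun D => by
        funext y
        simp [ap, h]
      simpa [this, LStar_zero_fun, LStarInt_zero_fun] using hasDerivAt_const t (0 : ℝ)
    · have := hasDerivAt_window hΦ (o := 0) (m := s.1 + (s.2 - 1)) zero_le_one (by omega)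
        (by omega) (hD (s.1, s.2 - 1)) hx t
      have hN : 0 + (s.1 + (s.2 - 1)) ≠ s.1 + s.2 := by omega
      have e : ∀ D : Fam, ap D s = fun y => D (s.1, s.2 - 1) (window 0 (s.1 + (s.2 - 1)) y) :=
        fun D => by
          funext y
          simp [ap, h]
      simpa only [e, hN, if_true, if_false, sub_zero, evolve, hE] using this
  have h4 : HasDerivAt (fun τ => am (ap (evolve Φ σ D τ)) s x)
      (-(LStar Φ (am (ap E) s) x - LStarInt Φ 0 (am (ap E) s) x -
        LStarInt Φ (s.1 + s.2 - 2) (am (ap E) s) x)) t := by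
    by_cases h : s.1 = 0 ∨ s.2 = 0
    · have : ∀ D : Fam, am (ap D) s = fun _ => 0 := fun D => funext fun y => am_ap_eq_zero D h y
      simpa [this, LStar_zero_fun, LStarInt_zero_fun] using hasDerivAt_const t (0 : ℝ)
    · push Not at h
      have := hasDerivAt_window hΦ (o := 1) (m := s.1 - 1 + (s.2 - 1)) le_rfl (by omega)
        (by omega) (hD (s.1 - 1, s.2 - 1)) hx t
      have hN : 1 + (s.1 - 1 + (s.2 - 1)) ≠ s.1 + s.2 := by omega
      have e : ∀ D : Fam, am (ap D) s =
          fun y => D (s.1 - 1, s.2 - 1) (window 1 (s.1 - 1 + (s.2 - 1)) y) := fun D =>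
        funext fun y => am_ap_eq D h.1 h.2 y
      simpa only [e, hN, one_ne_zero, if_false, evolve, hE] using this
  refine (((h1.sub h2).sub h3).add h4).congr_deriv ?_
  have em : am (diff E) s = fun y =>
      am E s y - am (am E) s y - am (ap E) s y + am (am (ap E)) s y := funext (am_diff E s)
  have ep : ap (diff E) s = fun y =>
      ap E s y - am (ap E) s y - ap (ap E) s y + ap (ap (am E)) s y := funext (ap_diff E s)
  have e0 : diff E s = fun y => E s y - am E s y - ap E s y + am (ap E) s y := rfl
  rw [classicalGenerator, em, ep, e0, LStar_sub_sub_add (hd c) (hd cm) (hd cp) (hd cmp),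
    LStarInt_sub_sub_add (hd cm) (hd (contDiffOn_am cm)) (hd cmp) (hd (contDiffOn_am cmp)),
    LStarInt_sub_sub_add (hd cp) (hd cmp) (hd (contDiffOn_ap cp))
      (hd (contDiffOn_ap (contDiffOn_ap cm))), LStarInt_am_am, LStarInt_am_am, LStarInt_ap_ap,
    LStarInt_ap_ap]
  ring

end Classical

end TopInt

namespace TopInt

/-! ### Uniqueness of generalized and classical solutions -/

section Uniqueness

variable {Φ : ℝ → ℝ} {σ R : ℝ}

theorem am_congr {B B' : Fam} {s : ℕ × ℕ} (h : s.1 ≠ 0 → ∀ x ∈ Allowed σ (s.1 - 1 + s.2),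
      B (s.1 - 1, s.2) x = B' (s.1 - 1, s.2) x) {x : Phase (s.1 + s.2)}
    (hx : x ∈ Allowed σ (s.1 + s.2)) : am B s x = am B' s x := by
  by_cases h1 : s.1 = 0
  · simp [am, h1]
  · simp only [am, h1, if_false]
    exact h h1 _ (am_window_mem h1 hx)

theorem ap_congr {B B' : Fam} {s : ℕ × ℕ} (h : s.2 ≠ 0 → ∀ x ∈ Allowed σ (s.1 + (s.2 - 1)),
      B (s.1, s.2 - 1) x = B' (s.1, s.2 - 1) x) {x : Phase (s.1 + s.2)}
    (hx : x ∈ Allowed σ (s.1 + s.2)) : ap B s x = ap B' s x := by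
  by_cases h2 : s.2 = 0
  · simp [ap, h2]
  · simp only [ap, h2, if_false]
    exact h h2 _ (ap_window_mem hx)

theorem integral_mul_congr {N : ℕ} {G G' g : Phase N → ℝ} {U : Set (Phase N)}
    (h : ∀ x ∈ U, G x = G' x) (h0 : ∀ x ∉ U, g x = 0) :
    ∫ x, G x * g x = ∫ x, G' x * g x := by
  congr 1
  ext x
  by_cases hx : x ∈ U
  · rw [h x hx]
  · rw [h0 x hx, mul_zero, mul_zero]

theorem diff_congr {B B' : Fam} (h : ∀ s : ℕ × ℕ, ∀ x ∈ Allowed σ (s.1 + s.2), B s x = B' s x) (s : ℕ × ℕ)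
    {x : Phase (s.1 + s.2)} (hx : x ∈ Allowed σ (s.1 + s.2)) : diff B s x = diff B' s x := by
  have ha : ∀ s : ℕ × ℕ, ∀ x ∈ Allowed σ (s.1 + s.2), ap B s x = ap B' s x := fun s x hx =>
    ap_congr (fun _ => h (s.1, s.2 - 1)) hx
  rw [diff, diff, h s x hx, am_congr (fun _ => h (s.1 - 1, s.2)) hx, ha s x hx, am_congr (fun _ => ha (s.1 - 1, s.2)) hx]

theorem weakGenerator_congr {B B' : Fam} (h : ∀ s : ℕ × ℕ, ∀ x ∈ Allowed σ (s.1 + s.2), B s x = B' s x)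
    {s : ℕ × ℕ} {f : Phase (s.1 + s.2) → ℝ} (hfU : tsupport f ⊆ Allowed σ (s.1 + s.2)) :
    weakGenerator Φ B s f = weakGenerator Φ B' s f := by
  rw [weakGenerator, weakGenerator]
  congr 1
  · congr 1
    · exact integral_mul_congr (h s) fun x hx => LStar_of_notMem_tsupport fun hx' => hx (hfU hx')
    · exact integral_mul_congr (fun x hx => am_congr (fun _ => h (s.1 - 1, s.2)) hx) fun x hx =>
        LStarInt_of_notMem_tsupport (fun hx' => hx (hfU hx')) _
  · exact integral_mul_congr (fun x hx => ap_congr (fun _ => h (s.1, s.2 - 1)) hx) fun x hx =>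
      LStarInt_of_notMem_tsupport (fun hx' => hx (hfU hx')) _

theorem LStarInt_congr {N j : ℕ} {G G' : Phase N → ℝ} (h : ∀ x ∈ Allowed σ N, G x = G' x)
    {x : Phase N} (hx : x ∈ Allowed σ N) : LStarInt Φ j G x = LStarInt Φ j G' x := by
  have e : G =ᶠ[𝓝 x] G' := by
    filter_upwards [(isOpen_allowed σ N).mem_nhds hx] with y hy using h y hy
  obtain ⟨w, hw⟩ := exists_LStarInt_eq_fderiv (Φ := Φ) j x
  rw [hw, hw, e.fderiv_eq]

theorem LStar_congr {N : ℕ} {G G' : Phase N → ℝ} (h : ∀ x ∈ Allowed σ N, G x = G' x)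
    {x : Phase N} (hx : x ∈ Allowed σ N) : LStar Φ G x = LStar Φ G' x := by
  have e : G =ᶠ[𝓝 x] G' := by
    filter_upwards [(isOpen_allowed σ N).mem_nhds hx] with y hy using h y hy
  rw [LStar_eq_fderiv, LStar_eq_fderiv, e.fderiv_eq]

theorem classicalGenerator_congr {B B' : Fam}
    (h : ∀ s : ℕ × ℕ, ∀ x ∈ Allowed σ (s.1 + s.2), B s x = B' s x) {s : ℕ × ℕ}
    {x : Phase (s.1 + s.2)} (hx : x ∈ Allowed σ (s.1 + s.2)) :
    classicalGenerator Φ B s x = classicalGenerator Φ B' s x := by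
  rw [classicalGenerator, classicalGenerator, LStar_congr (h s) hx,
    LStarInt_congr (fun x hx => am_congr (B' := B') (fun _ => h (s.1 - 1, s.2)) hx) hx,
    LStarInt_congr (fun x hx => ap_congr (B' := B') (fun _ => h (s.1, s.2 - 1)) hx) hx]

/-- Uniqueness of generalized solutions. -/
theorem eq_of_hasDerivAt_integral (hΦ : IsPotential Φ σ R) {B B' : ℝ → Fam}
    (hc : ∀ s : ℕ × ℕ, ContinuousOn (fun z : ℝ × Phase (s.1 + s.2) => B z.1 s z.2)
      (Set.univ ×ˢ Allowed σ (s.1 + s.2)))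
    (hc' : ∀ s : ℕ × ℕ, ContinuousOn (fun z : ℝ × Phase (s.1 + s.2) => B' z.1 s z.2)
      (Set.univ ×ˢ Allowed σ (s.1 + s.2)))
    (h0 : ∀ s : ℕ × ℕ, ∀ x ∈ Allowed σ (s.1 + s.2), B 0 s x = B' 0 s x)
    (hw : ∀ (s : ℕ × ℕ) (f : Phase (s.1 + s.2) → ℝ), ContDiff ℝ 1 f → HasCompactSupport f →
      tsupport f ⊆ Allowed σ (s.1 + s.2) → ∀ t,
      HasDerivAt (fun τ => ∫ x, B τ s x * f x) (weakGenerator Φ (B t) s f) t)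
    (hw' : ∀ (s : ℕ × ℕ) (f : Phase (s.1 + s.2) → ℝ), ContDiff ℝ 1 f → HasCompactSupport f →
      tsupport f ⊆ Allowed σ (s.1 + s.2) → ∀ t,
      HasDerivAt (fun τ => ∫ x, B' τ s x * f x) (weakGenerator Φ (B' t) s f) t)
    (s : ℕ × ℕ) (t : ℝ) {x : Phase (s.1 + s.2)} (hx : x ∈ Allowed σ (s.1 + s.2)) :
    B t s x = B' t s x := by
  induction hn : s.1 + s.2 using Nat.strong_induction_on generalizing s t with
  | _ n ih =>
    have hct : ∀ {G : ℝ → Fam}, (∀ s : ℕ × ℕ, ContinuousOn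
        (fun z : ℝ × Phase (s.1 + s.2) => G z.1 s z.2) (Set.univ ×ˢ Allowed σ (s.1 + s.2))) →
        ∀ t, ContinuousOn (G t s) (Allowed σ (s.1 + s.2)) := fun hG t =>
      (hG s).comp (continuousOn_const.prodMk continuousOn_id) fun _ hx => ⟨trivial, hx⟩
    rw [← sub_eq_zero]
    refine (isCompleteFlow_flow hΦ (s.1 + s.2)).eq_zero_of_hasDerivAt_integral (μ := volume)
      (D := fun t x => B t s x - B' t s x) (fun t x hx => flow_of_notMem hx t)
      ((hc s).sub (hc' s)) (fun x hx => by rw [h0 s x hx, sub_self]) ?_ t hx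
    intro f hf1 hf hfU t
    have hi : ∀ {G g : Phase (s.1 + s.2) → ℝ}, ContinuousOn G (Allowed σ (s.1 + s.2)) →
        ContinuousOn g (tsupport f) → (∀ x ∉ tsupport f, g x = 0) →
        Integrable fun x => G x * g x := fun hG hg h0 =>
      integrable_of_continuousOn_of_eq_zero hf ((hG.mono hfU).mul hg)
        fun x hx => by rw [h0 x hx, mul_zero]
    have e : ∀ {g : Phase (s.1 + s.2) → ℝ} (τ : ℝ), ContinuousOn g (tsupport f) →
        (∀ x ∉ tsupport f, g x = 0) → ∫ x, (B τ s x - B' τ s x) * g x =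
          (∫ x, B τ s x * g x) - ∫ x, B' τ s x * g x := fun τ hg h0 => by
      rw [← integral_sub (hi (hct hc τ) hg h0) (hi (hct hc' τ) hg h0)]
      simp only [sub_mul]
    have e1 := fun τ => e τ hf1.continuous.continuousOn
      fun x hx => image_eq_zero_of_notMem_tsupport hx
    simp only [e1]
    -- The inhomogeneous terms involve one particle less. By induction they coincide for both
    -- solutions and drop out of the equation for the difference.
    have ea : ∫ x, am (B t) s x * LStarInt Φ 0 f x = ∫ x, am (B' t) s x * LStarInt Φ 0 f x :=
      integral_mul_congr (fun x hx => am_congr (fun h x hx => ih _ (by simp only; omega)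
        (s.1 - 1, s.2) t hx rfl) hx)
        fun x hx => LStarInt_of_notMem_tsupport (fun hx' => hx (hfU hx')) _
    have ep : ∫ x, ap (B t) s x * LStarInt Φ (s.1 + s.2 - 2) f x =
        ∫ x, ap (B' t) s x * LStarInt Φ (s.1 + s.2 - 2) f x :=
      integral_mul_congr (fun x hx => ap_congr (fun h x hx => ih _ (by simp only; omega)
        (s.1, s.2 - 1) t hx rfl) hx)
        fun x hx => LStarInt_of_notMem_tsupport (fun hx' => hx (hfU hx')) _
    refine ((hw s f hf1 hf hfU t).sub (hw' s f hf1 hf hfU t)).congr_deriv ?_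
    have e2 := e t ((continuousOn_LStar hΦ hf1).mono hfU) fun x hx => LStar_of_notMem_tsupport hx
    simp only [LStar_eq_fderiv] at e2
    rw [e2, weakGenerator, weakGenerator, ea, ep]
    simp only [LStar_eq_fderiv]
    ring

/-- Uniqueness of classical solutions of the Liouville equation. -/
theorem eq_zero_of_hasDerivAt_liouville (hΦ : IsPotential Φ σ R) {N : ℕ} {D : ℝ → Phase N → ℝ}
    (hD : ContDiffOn ℝ 1 (fun z : ℝ × Phase N => D z.1 z.2) (Set.univ ×ˢ Allowed σ N))
    (h0 : ∀ x ∈ Allowed σ N, D 0 x = 0)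
    (hL : ∀ t, ∀ x ∈ Allowed σ N, HasDerivAt (fun τ => D τ x) (-LStar Φ (D t) x) t) (T : ℝ)
    {x : Phase N} (hx : x ∈ Allowed σ N) : D T x = 0 := by
  have hfl := isCompleteFlow_flow hΦ N
  -- Method of characteristics: D is constant along the backward trajectory that passes through x at
  -- time T, and it vanishes at time 0. Joint differentiability in t and x is what the chain rule
  -- needs here.
  have hd : ∀ t, HasDerivAt (fun t => D t (flow Φ σ x (T - t))) 0 t := by
    intro t
    set y := flow Φ σ x (T - t) with hy
    have hyU : y ∈ Allowed σ N := hfl.mem (T - t) x hx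
    have hF : HasFDerivAt (fun z : ℝ × Phase N => D z.1 z.2)
        (fderiv ℝ (fun z : ℝ × Phase N => D z.1 z.2) (t, y)) (t, y) :=
      ((hD.contDiffAt ((isOpen_univ.prod (isOpen_allowed σ N)).mem_nhds
        ⟨trivial, hyU⟩)).differentiableAt one_ne_zero).hasFDerivAt
    set F := fderiv ℝ (fun z : ℝ × Phase N => D z.1 z.2) (t, y)
    have h1 : F (1, 0) = -LStar Φ (D t) y :=
      (hF.comp_hasDerivAt (f := fun τ => (τ, y)) t
        ((hasDerivAt_id t).prodMk (hasDerivAt_const t y))).unique (hL t y hyU)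
    have h2 : ∀ w, F (0, w) = fderiv ℝ (D t) y w := fun w => by
      have := hF.comp y ((hasFDerivAt_const t y).prodMk (hasFDerivAt_id y))
      have e : fderiv ℝ (D t) y = _ := this.fderiv
      rw [e]
      rfl
    have hX : HasDerivAt (fun t => flow Φ σ x (T - t)) (-hamiltonField Φ y) t := by
      have := (hfl.hasDerivAt (T - t) x hx).scomp t ((hasDerivAt_id t).const_sub T)
      simp only [neg_smul, one_smul] at this
      exact this
    refine (hF.comp_hasDerivAt t ((hasDerivAt_id t).prodMk hX)).congr_deriv ?_
    have : ((1 : ℝ), -hamiltonField Φ y) = (1, 0) - (0, hamiltonField Φ y) := by simp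
    rw [this, map_sub, h1, h2, LStar_eq_fderiv, neg_neg, sub_self]
  have hconst := is_const_of_deriv_eq_zero (fun t => (hd t).differentiableAt)
    (fun t => (hd t).deriv) T 0
  have hz : flow Φ σ x 0 = x := hfl.zero x hx
  simp only [sub_self, sub_zero, hz] at hconst
  rw [hconst]
  exact h0 _ (hfl.mem T x hx)

/-- Uniqueness of classical solutions. -/
theorem eq_of_hasDerivAt_classical (hΦ : IsPotential Φ σ R) {B B' : ℝ → Fam}
    (hc : ∀ s : ℕ × ℕ, ContDiffOn ℝ 1 (fun z : ℝ × Phase (s.1 + s.2) => B z.1 s z.2)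
      (Set.univ ×ˢ Allowed σ (s.1 + s.2)))
    (hc' : ∀ s : ℕ × ℕ, ContDiffOn ℝ 1 (fun z : ℝ × Phase (s.1 + s.2) => B' z.1 s z.2)
      (Set.univ ×ˢ Allowed σ (s.1 + s.2)))
    (h0 : ∀ s : ℕ × ℕ, ∀ x ∈ Allowed σ (s.1 + s.2), B 0 s x = B' 0 s x)
    (hw : ∀ (s : ℕ × ℕ) (t : ℝ), ∀ x ∈ Allowed σ (s.1 + s.2),
      HasDerivAt (fun τ => B τ s x) (classicalGenerator Φ (B t) s x) t)
    (hw' : ∀ (s : ℕ × ℕ) (t : ℝ), ∀ x ∈ Allowed σ (s.1 + s.2),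
      HasDerivAt (fun τ => B' τ s x) (classicalGenerator Φ (B' t) s x) t)
    (s : ℕ × ℕ) (t : ℝ) {x : Phase (s.1 + s.2)} (hx : x ∈ Allowed σ (s.1 + s.2)) :
    B t s x = B' t s x := by
  induction hn : s.1 + s.2 using Nat.strong_induction_on generalizing s t with
  | _ n ih =>
    have hct : ∀ {G : ℝ → Fam}, (∀ s : ℕ × ℕ, ContDiffOn ℝ 1
        (fun z : ℝ × Phase (s.1 + s.2) => G z.1 s z.2) (Set.univ ×ˢ Allowed σ (s.1 + s.2))) →
        ∀ t, ∀ x ∈ Allowed σ (s.1 + s.2), DifferentiableAt ℝ (G t s) x := fun {G} hG t x hx => by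
      have : ContDiffOn ℝ 1 (G t s) (Allowed σ (s.1 + s.2)) :=
        (hG s).comp (contDiffOn_const.prodMk contDiffOn_id) fun _ hx => ⟨trivial, hx⟩
      exact (this.contDiffAt ((isOpen_allowed σ _).mem_nhds hx)).differentiableAt one_ne_zero
    rw [← sub_eq_zero]
    refine eq_zero_of_hasDerivAt_liouville hΦ (D := fun t x => B t s x - B' t s x)
      ((hc s).sub (hc' s)) (fun x hx => by rw [h0 s x hx, sub_self]) ?_ t hx
    intro t x hx
    refine ((hw s t x hx).sub (hw' s t x hx)).congr_deriv ?_
    have ea : LStarInt Φ 0 (am (B t) s) x = LStarInt Φ 0 (am (B' t) s) x :=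
      LStarInt_congr (fun x hx => am_congr (fun h x hx => ih _ (by simp only; omega)
        (s.1 - 1, s.2) t hx rfl) hx) hx
    have ep : LStarInt Φ (s.1 + s.2 - 2) (ap (B t) s) x =
        LStarInt Φ (s.1 + s.2 - 2) (ap (B' t) s) x :=
      LStarInt_congr (fun x hx => ap_congr (fun h x hx => ih _ (by simp only; omega)
        (s.1, s.2 - 1) t hx rfl) hx) hx
    have e : fderiv ℝ (fun x => B t s x - B' t s x) x =
        fderiv ℝ (B t s) x - fderiv ℝ (B' t s) x :=
      ((hct hc t x hx).hasFDerivAt.sub (hct hc' t x hx).hasFDerivAt).fderiv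
    rw [classicalGenerator, classicalGenerator, ea, ep]
    simp only [LStar_eq_fderiv, e, sub_apply]
    ring

end Uniqueness

end TopInt

namespace TopInt

/-! ### Sums over partitions into consecutive blocks -/

section Compositions

/-- The product over the blocks `(o, m)` of a list of block sizes, where `m` is the size of the block
and `o` is the sum of the preceding sizes, starting from the given value of `o`. -/
def weightProd (g : ℕ → ℕ → ℝ) : ℕ → List ℕ → ℝ
  | _, [] => 1
  | o, m :: l => g o m * weightProd g (o + m) l

theorem prod_take_eq_weightProd (g : ℕ → ℕ → ℝ) (o : ℕ) (l : List ℕ) :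
    ∏ i : Fin l.length, g (o + (l.take i).sum) (l.get i) = weightProd g o l := by
  induction l generalizing o with
  | nil => simp [weightProd]
  | cons m l ih =>
    rw [weightProd, ← ih]
    simp [Fin.prod_univ_succ, add_assoc]

theorem prod_blocks_eq_weightProd (g : ℕ → ℕ → ℝ) {N : ℕ} (c : Composition N) :
    ∏ i : Fin c.length, g (c.sizeUpTo i) (c.blocksFun i) = weightProd g 0 c.blocks := by
  rw [← prod_take_eq_weightProd]
  simp only [zero_add]
  rfl

/-- Compositions are sorted by their first block, of size m + 1, which leaves a composition of the
rest. This is the recursion behind all sums over partitions. -/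
theorem sum_composition_succ (F : List ℕ → ℝ) (r : ℕ) :
    ∑ c : Composition (r + 1), F c.blocks =
      ∑ m ∈ range (r + 1), ∑ c : Composition (r - m), F ((m + 1) :: c.blocks) := by
  rw [Finset.sum_sigma']
  symm
  refine Finset.sum_bij (fun p hp => ⟨(p.1 + 1) :: p.2.blocks, ?_, ?_⟩) ?_ ?_ ?_ ?_
  · intro i hi
    rcases List.mem_cons.1 hi with rfl | hi
    · omega
    · exact p.2.blocks_pos hi
  · have := mem_range.1 (Finset.mem_sigma.1 hp).1
    rw [List.sum_cons, p.2.blocks_sum]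
    omega
  · intros
    exact mem_univ _
  · rintro ⟨m, c⟩ _ ⟨m', c'⟩ _ h
    simp only [Composition.mk.injEq, List.cons.injEq, add_left_inj] at h
    obtain ⟨hm, hc⟩ := h
    subst hm
    rw [Composition.ext hc]
  · rintro ⟨l, hl, hs⟩ -
    cases l with
    | nil => simp at hs
    | cons m l =>
      have hm : 0 < m := hl (by simp)
      rw [List.sum_cons] at hs
      refine ⟨⟨m - 1, ⟨l, fun hi => hl (List.mem_cons_of_mem _ hi), by omega⟩⟩, ?_, ?_⟩
      · simp only [mem_sigma, mem_range, mem_univ, and_true]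
        omega
      · simp only [Composition.mk.injEq, List.cons.injEq, and_true]
        omega
  · intros
    rfl

theorem sum_weightProd_succ (g : ℕ → ℕ → ℝ) (o r : ℕ) :
    ∑ c : Composition (r + 1), weightProd g o c.blocks =
      ∑ m ∈ range (r + 1), g o (m + 1) *
        ∑ c : Composition (r - m), weightProd g (o + (m + 1)) c.blocks := by
  rw [sum_composition_succ]
  simp only [weightProd, mul_sum]

/-- Only the composition into singletons has a nonzero weight. -/
theorem sum_weightProd_eq_one {g : ℕ → ℕ → ℝ} {o r : ℕ}
    (h : ∀ o' m, o ≤ o' → 1 ≤ m → o' + m ≤ o + r → g o' m = if m = 1 then 1 else 0) :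
    ∑ c : Composition r, weightProd g o c.blocks = 1 := by
  induction r generalizing o with
  | zero =>
    have : ∀ c : Composition 0, c.blocks = [] := fun c => by
      have := c.blocks_sum
      rcases hc : c.blocks with _ | ⟨m, l⟩
      · rfl
      · have hm : 0 < m := c.blocks_pos (by simp [hc])
        rw [hc, List.sum_cons] at this
        omega
    simp [this, weightProd, composition_card]
  | succ r ih =>
    rw [sum_weightProd_succ, sum_eq_single_of_mem 0 (by simp)]
    · rw [h _ _ le_rfl (by omega) (by omega), if_pos rfl, one_mul]
      exact ih fun o' m h1 h2 h3 => h o' m (by omega) h2 (by omega)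
    · intro m hm hm0
      have := mem_range.1 hm
      rw [h _ _ le_rfl (by omega) (by omega), if_neg (by omega), zero_mul]

/-- If all blocks to the left and to the right of the position `k₁` have weight zero, unless they
are singletons of weight one, then only the block that contains this position matters. -/
theorem sum_weightProd {g : ℕ → ℕ → ℝ} {k₁ k₂ : ℕ}
    (hl : ∀ o m, 1 ≤ m → o + m ≤ k₁ → g o m = if m = 1 then 1 else 0)
    (hr : ∀ o m, k₁ < o → 1 ≤ m → o + m ≤ k₁ + 1 + k₂ → g o m = if m = 1 then 1 else 0) :
    ∑ c : Composition (k₁ + 1 + k₂), weightProd g 0 c.blocks =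
      ∑ a ∈ range (k₁ + 1), ∑ c ∈ range (k₂ + 1), g (k₁ - a) (a + 1 + c) := by
  have hR : ∀ o r, k₁ < o → o + r = k₁ + 1 + k₂ →
      ∑ c : Composition r, weightProd g o c.blocks = 1 := fun o r ho h =>
    sum_weightProd_eq_one fun o' m h1 h2 h3 => hr o' m (by omega) h2 (by omega)
  -- Here j counts the elements left of the distinguished position that are not yet in a block. A
  -- first block that ends before the position must be a singleton, which leads to j - 1. Otherwise
  -- it contains the position, and what follows it sums to 1.
  have key : ∀ j ≤ k₁, ∑ c : Composition (j + k₂ + 1), weightProd g (k₁ - j) c.blocks =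
      ∑ a ∈ range (j + 1), ∑ c ∈ range (k₂ + 1), g (k₁ - a) (a + 1 + c) := by
    intro j
    induction j with
    | zero =>
      intro _
      rw [sum_weightProd_succ, sum_range_one, zero_add]
      refine sum_congr rfl fun m hm => ?_
      have := mem_range.1 hm
      rw [hR _ _ (by omega) (by omega), mul_one, zero_add, add_comm]
    | succ j ih =>
      intro hj
      rw [sum_weightProd_succ, sum_range_succ (n := j + 1), ← ih (by omega),
        show j + 1 + k₂ + 1 = j + 1 + (k₂ + 1) by omega, sum_range_add]
      congr 1
      · rw [sum_eq_single_of_mem 0 (by simp)]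
        · rw [hl _ _ (by omega) (by omega), if_pos (by omega), one_mul,
            show k₁ - (j + 1) + (0 + 1) = k₁ - j by omega,
            show j + 1 + k₂ - 0 = j + k₂ + 1 by omega]
        · intro m hm hm0
          have := mem_range.1 hm
          rw [hl _ _ (by omega) (by omega), if_neg (by omega), zero_mul]
      · refine sum_congr rfl fun m hm => ?_
        have := mem_range.1 hm
        rw [hR _ _ (by omega) (by omega), mul_one, show j + 1 + m + 1 = j + 1 + 1 + m by omega]
  have := key k₁ le_rfl
  rwa [Nat.sub_self, show k₁ + k₂ + 1 = k₁ + 1 + k₂ by omega] at this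

end Compositions

end TopInt

namespace TopInt

/-! ### The inverse of (1 - a₋)(1 - a₊) -/

section Cumulation

variable {Φ : ℝ → ℝ} {σ R : ℝ}

/-- The operator inverse to `(1 - a⁺₋)(1 - a⁺₊)`. -/
noncomputable def cum (B : Fam) : Fam := fun s x =>
  ∑ c ∈ range (s.2 + 1), ∑ m ∈ range (s.1 + 1), B (m, c) (window (s.1 - m) (m + c) x)

/-- A function of the particles `-n₁, …, n₂` as a function of the particles `-s₁, …, s₂` for all
`s₁ ≥ n₁`, `s₂ ≥ n₂`. -/
noncomputable def extend (n : ℕ × ℕ) (b : Phase (n.1 + n.2) → ℝ) : Fam := fun s x =>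
  if n.1 ≤ s.1 ∧ n.2 ≤ s.2 then b (window (s.1 - n.1) (n.1 + n.2) x) else 0

/-- A finite geometric series in a₋ telescopes; the powers of a₋ beyond the number of particles on
the left vanish. -/
theorem sum_range_sub_am (B : Fam) (s : ℕ × ℕ) (x : Phase (s.1 + s.2)) :
    (∑ m ∈ range (s.1 + 1), B (m, s.2) (window (s.1 - m) (m + s.2) x)) -
      am (fun s x => ∑ m ∈ range (s.1 + 1), B (m, s.2) (window (s.1 - m) (m + s.2) x)) s x =
      B s x := by
  obtain ⟨s₁, s₂⟩ := s
  rw [sum_range_succ]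
  simp only [Nat.sub_self, window_zero_self]
  rw [sub_eq_iff_eq_add, add_comm]
  congr 1
  cases s₁ with
  | zero => simp [am]
  | succ s₁ =>
    simp only [am, Nat.add_one_ne_zero, if_false, Nat.add_sub_cancel]
    refine sum_congr rfl fun m hm => ?_
    have := mem_range.1 hm
    rw [window_window (by omega), show 1 + (s₁ - m) = s₁ + 1 - m by omega]

theorem sum_range_sub_ap (B : Fam) (s : ℕ × ℕ) (x : Phase (s.1 + s.2)) :
    (∑ c ∈ range (s.2 + 1), B (s.1, c) (window 0 (s.1 + c) x)) -
      ap (fun s x => ∑ c ∈ range (s.2 + 1), B (s.1, c) (window 0 (s.1 + c) x)) s x = B s x := by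
  obtain ⟨s₁, s₂⟩ := s
  rw [sum_range_succ]
  simp only [window_zero_self]
  rw [sub_eq_iff_eq_add, add_comm]
  congr 1
  cases s₂ with
  | zero => simp [ap]
  | succ s₂ =>
    simp only [ap, Nat.add_one_ne_zero, if_false, Nat.add_sub_cancel]
    refine sum_congr rfl fun c hc => ?_
    have := mem_range.1 hc
    rw [window_window (by omega)]

theorem diff_eq_sub_am (D : Fam) (s : ℕ × ℕ) (x : Phase (s.1 + s.2)) :
    diff D s x = (D s x - ap D s x) - am (fun s x => D s x - ap D s x) s x := by
  by_cases h : s.1 = 0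
  · simp [diff, am, h]
  · simp only [diff, am, h, if_false]
    ring

theorem diff_cum (B : Fam) : diff (cum B) = B := by
  have e : cum B = fun s x => ∑ c ∈ range (s.2 + 1),
      (fun (s : ℕ × ℕ) x => ∑ m ∈ range (s.1 + 1), B (m, s.2) (window (s.1 - m) (m + s.2) x))
        (s.1, c) (window 0 (s.1 + c) x) := by
    funext s x
    refine sum_congr rfl fun c _ => sum_congr rfl fun m hm => ?_
    have := mem_range.1 hm
    simp only
    rw [window_window (by omega), zero_add]
  funext s x
  rw [diff_eq_sub_am, e]
  simp only [sum_range_sub_ap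
    (fun s x => ∑ m ∈ range (s.1 + 1), B (m, s.2) (window (s.1 - m) (m + s.2) x))]
  exact sum_range_sub_am B s x

/-- On each member `diff` is the identity plus terms with fewer particles, so it is injective by
induction. Only allowed configurations matter, as forgetting outer particles keeps a configuration
allowed. -/
theorem eq_of_diff_eq {D D' : Fam}
    (h : ∀ s : ℕ × ℕ, ∀ x ∈ Allowed σ (s.1 + s.2), diff D s x = diff D' s x) (s : ℕ × ℕ)
    {x : Phase (s.1 + s.2)} (hx : x ∈ Allowed σ (s.1 + s.2)) : D s x = D' s x := by
  induction hn : s.1 + s.2 using Nat.strong_induction_on generalizing s with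
  | _ n ih =>
    have hm : am D s x = am D' s x := am_congr (fun h x hx => ih _ (by simp only; omega)
      (s.1 - 1, s.2) hx rfl) hx
    have hp : ∀ s : ℕ × ℕ, s.1 + s.2 ≤ n → ∀ x ∈ Allowed σ (s.1 + s.2), ap D s x = ap D' s x :=
      fun s hs x hx => ap_congr (fun h x hx => ih _ (by simp only; omega) (s.1, s.2 - 1) hx rfl) hx
    have hmp : am (ap D) s x = am (ap D') s x :=
      am_congr (fun h x hx => hp (s.1 - 1, s.2) (by simp only; omega) x hx) hx
    have := h s x hx
    rw [diff, diff, hm, hp s hn.le x hx, hmp] at this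
    linarith

/-- Equal labels that are written differently give different types of phase space; the statement
confines this transport to a substitution. -/
theorem apply_window_congr (B : Fam) {s s' : ℕ × ℕ} (h : s = s') {o o' N : ℕ} (ho : o = o')
    (x : Phase N) : B s (window o (s.1 + s.2) x) = B s' (window o' (s'.1 + s'.2) x) := by
  subst h ho
  rfl

theorem sum_range_eq_sum_range_add {M : Type*} [AddCommMonoid M] (f : ℕ → M) {n k : ℕ}
    (h : ∀ i < n, f i = 0) : ∑ i ∈ range (n + k + 1), f i = ∑ i ∈ range (k + 1), f (n + i) := by
  rw [add_assoc, sum_range_add, sum_eq_zero fun i hi => h i (mem_range.1 hi), zero_add]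

end Cumulation

/-! ### Solution of the cluster expansions -/

section Cluster

variable {Φ : ℝ → ℝ} {σ R : ℝ}

/-- The operators of the family that act on `b`, applied to `b`. -/
noncomputable def opFam (A : GenOps σ) (t : ℝ) (n : ℕ × ℕ) (b : Obs σ (n.1 + n.2)) : Fam :=
  fun s x => if n.1 ≤ s.1 ∧ n.2 ≤ s.2 then (A t s n b : Phase (s.1 + s.2) → ℝ) x else 0

theorem opFam_of_le (A : GenOps σ) (t : ℝ) {n s : ℕ × ℕ} (b : Obs σ (n.1 + n.2))
    (h1 : n.1 ≤ s.1) (h2 : n.2 ≤ s.2) (x : Phase (s.1 + s.2)) :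
    opFam A t n b s x = (A t s n b : Phase (s.1 + s.2) → ℝ) x := if_pos ⟨h1, h2⟩

theorem cum_opFam (A : GenOps σ) (t : ℝ) (n k : ℕ × ℕ) (b : Obs σ (n.1 + n.2))
    (x : Phase (n.1 + k.1 + (n.2 + k.2))) :
    cum (opFam A t n b) (n.1 + k.1, n.2 + k.2) x =
      ∑ a ∈ range (k.1 + 1), ∑ c ∈ range (k.2 + 1),
        (A t (n.1 + a, n.2 + c) n b : Phase (n.1 + a + (n.2 + c)) → ℝ)
          (window (k.1 - a) (n.1 + a + (n.2 + c)) x) := by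
  rw [cum, sum_range_eq_sum_range_add, sum_comm]
  · rw [sum_range_eq_sum_range_add]
    · refine sum_congr rfl fun a _ => sum_congr rfl fun c _ => ?_
      rw [opFam_of_le A t b (by simp) (by simp)]
      simp only
      rw [Nat.add_sub_add_left]
    · intro i hi
      exact sum_eq_zero fun c _ => if_neg (by simp only; omega)
  · intro i hi
    exact sum_eq_zero fun c _ => if_neg (by simp only; omega)

/-- The factor of the block of size `m` that is preceded by `o` elements. -/
noncomputable def blockWeight (A : GenOps σ) (t : ℝ) (n k : ℕ × ℕ) (b : Obs σ (n.1 + n.2))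
    (x : Phase (n.1 + k.1 + (n.2 + k.2))) (o m : ℕ) : ℝ :=
  if o + m ≤ k.1 then
    (A t (m, 0) (1, 0) (unitObs σ (1 + 0)) : Phase (m + 0) → ℝ) (window o _ x)
  else if o ≤ k.1 then
    (A t (n.1 + (k.1 - o), n.2 + (o + m - (k.1 + 1))) n b :
      Phase (n.1 + (k.1 - o) + (n.2 + (o + m - (k.1 + 1)))) → ℝ) (window o _ x)
  else
    (A t (0, m) (0, 1) (unitObs σ (0 + 1)) : Phase (0 + m) → ℝ)
      (window (o - 1 + (n.1 + n.2)) _ x)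

theorem blockFactor_eq_blockWeight (A : GenOps σ) (t : ℝ) (n k : ℕ × ℕ) (b : Obs σ (n.1 + n.2))
    (c : Composition (k.1 + 1 + k.2)) (i : Fin c.length) (x : Phase (n.1 + k.1 + (n.2 + k.2))) :
    blockFactor A t n k b c i x = blockWeight A t n k b x (c.sizeUpTo i) (c.blocksFun i) := by
  rw [blockFactor, c.sizeUpTo_succ', blockWeight]

/-- If the operators of order greater than one vanish on the constant, then the cluster expansion
reduces to the sum over the blocks that contain the cluster. -/
theorem sum_prod_blockFactor (A : GenOps σ) (t : ℝ) (n k : ℕ × ℕ) (b : Obs σ (n.1 + n.2))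
    (hu : ∀ j, 1 ≤ j → j ≤ k.1 → ∀ y ∈ Allowed σ (j + 0),
      (A t (j, 0) (1, 0) (unitObs σ (1 + 0)) : Phase (j + 0) → ℝ) y = if j = 1 then 1 else 0)
    (hv : ∀ j, 1 ≤ j → j ≤ k.2 → ∀ y ∈ Allowed σ (0 + j),
      (A t (0, j) (0, 1) (unitObs σ (0 + 1)) : Phase (0 + j) → ℝ) y = if j = 1 then 1 else 0)
    {x : Phase (n.1 + k.1 + (n.2 + k.2))} (hx : x ∈ Allowed σ (n.1 + k.1 + (n.2 + k.2))) :
    ∑ c : Composition (k.1 + 1 + k.2), ∏ i : Fin c.length, blockFactor A t n k b c i x =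
      cum (opFam A t n b) (n.1 + k.1, n.2 + k.2) x := by
  simp only [blockFactor_eq_blockWeight, prod_blocks_eq_weightProd (blockWeight A t n k b x)]
  rw [sum_weightProd, cum_opFam]
  · refine sum_congr rfl fun a ha => sum_congr rfl fun c hc => ?_
    have ha' := mem_range.1 ha
    rw [blockWeight, if_neg (by omega), if_pos (by omega)]
    refine apply_window_congr (fun s y => (A t s n b : Phase (s.1 + s.2) → ℝ) y)
      (s := (n.1 + (k.1 - (k.1 - a)), n.2 + (k.1 - a + (a + 1 + c) - (k.1 + 1))))
      (s' := (n.1 + a, n.2 + c)) (Prod.ext ?_ ?_) rfl x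
    · simp only
      omega
    · simp only
      omega
  · intro o m hm h
    rw [blockWeight, if_pos h]
    exact hu m hm (by omega) _ (window_mem_allowed (by omega) hx)
  · intro o m ho hm h
    rw [blockWeight, if_neg (by omega), if_neg (by omega)]
    exact hv m hm (by omega) _ (window_mem_allowed (by omega) hx)

theorem S_window_eq (n k : ℕ × ℕ) (b : Obs σ (n.1 + n.2)) (t : ℝ)
    {x : Phase (n.1 + k.1 + (n.2 + k.2))} (hx : x ∈ Allowed σ (n.1 + k.1 + (n.2 + k.2))) :
    S Φ σ t (fun y => (b : Phase (n.1 + n.2) → ℝ) (window k.1 (n.1 + n.2) y)) x =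
      evolve Φ σ (extend n b) t (n.1 + k.1, n.2 + k.2) x := by
  rw [S, SStar, if_pos hx, neg_neg, evolve, extend, if_pos (by simp)]
  simp only
  rw [Nat.add_sub_cancel_left]

theorem unitObs_apply {N : ℕ} {x : Phase N} (hx : x ∈ Allowed σ N) :
    (unitObs σ N : Phase N → ℝ) x = 1 := if_pos hx

theorem evolve_extend_unitObs (hΦ : IsPotential Φ σ R) (n : ℕ × ℕ) (t : ℝ) (s : ℕ × ℕ)
    {x : Phase (s.1 + s.2)} (hx : x ∈ Allowed σ (s.1 + s.2)) :
    evolve Φ σ (extend n (unitObs σ (n.1 + n.2))) t s x =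
      if n.1 ≤ s.1 ∧ n.2 ≤ s.2 then 1 else 0 := by
  rw [evolve, extend]
  split_ifs with h
  · exact unitObs_apply (window_mem_allowed (by omega) ((isCompleteFlow_flow hΦ _).mem t x hx))
  · rfl

theorem diff_evolve_extend_of_not_le (n : ℕ × ℕ) (b : Phase (n.1 + n.2) → ℝ) (t : ℝ) {s : ℕ × ℕ}
    (h : ¬(n.1 ≤ s.1 ∧ n.2 ≤ s.2)) (x : Phase (s.1 + s.2)) :
    diff (evolve Φ σ (extend n b) t) s x = 0 := by
  have h1 : ¬(n.1 ≤ s.1 - 1 ∧ n.2 ≤ s.2) := by omega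
  have h2 : ¬(n.1 ≤ s.1 ∧ n.2 ≤ s.2 - 1) := by omega
  have h3 : ¬(n.1 ≤ s.1 - 1 ∧ n.2 ≤ s.2 - 1) := by omega
  simp [diff, am, ap, evolve, extend, h, h1, h2, h3]

theorem cum_opFam_of_not_le (A : GenOps σ) (t : ℝ) (n : ℕ × ℕ) (b : Obs σ (n.1 + n.2)) {s : ℕ × ℕ}
    (h : ¬(n.1 ≤ s.1 ∧ n.2 ≤ s.2)) (x : Phase (s.1 + s.2)) : cum (opFam A t n b) s x = 0 := by
  refine sum_eq_zero fun c hc => sum_eq_zero fun m hm => if_neg ?_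
  have h1 := mem_range.1 hc
  have h2 := mem_range.1 hm
  simp only
  omega

theorem clusterExpansionAt_iff (A : GenOps σ) (t : ℝ) (n k : ℕ × ℕ) (b : Obs σ (n.1 + n.2))
    (hu : ∀ j, 1 ≤ j → j ≤ k.1 → ∀ y ∈ Allowed σ (j + 0),
      (A t (j, 0) (1, 0) (unitObs σ (1 + 0)) : Phase (j + 0) → ℝ) y = if j = 1 then 1 else 0)
    (hv : ∀ j, 1 ≤ j → j ≤ k.2 → ∀ y ∈ Allowed σ (0 + j),
      (A t (0, j) (0, 1) (unitObs σ (0 + 1)) : Phase (0 + j) → ℝ) y = if j = 1 then 1 else 0) :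
    ClusterExpansionAt Φ A t n k b ↔ ∀ x ∈ Allowed σ (n.1 + k.1 + (n.2 + k.2)),
      evolve Φ σ (extend n b) t (n.1 + k.1, n.2 + k.2) x =
        cum (opFam A t n b) (n.1 + k.1, n.2 + k.2) x := by
  refine forall₂_congr fun x hx => ?_
  rw [S_window_eq n k b t hx, sum_prod_blockFactor A t n k b hu hv hx]

/-- Induction on the order. In the expansion for one particle as the cluster and the constant 1, the
other blocks have smaller order and are known, so it reads 1 = A₁1 + … + A_{1+m}1. For m = 0 this
gives A₁1 = 1; for m > 0 the first term already accounts for the left side, so the last one must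
vanish. -/
theorem left_operator_unitObs (hΦ : IsPotential Φ σ R) {A : GenOps σ} {t : ℝ}
    (h : ∀ k, ClusterExpansionAt Φ A t (1, 0) k (unitObs σ (1 + 0))) {j : ℕ} (hj : 1 ≤ j)
    {y : Phase (j + 0)} (hy : y ∈ Allowed σ (j + 0)) :
    (A t (j, 0) (1, 0) (unitObs σ (1 + 0)) : Phase (j + 0) → ℝ) y = if j = 1 then 1 else 0 := by
  obtain ⟨m, rfl⟩ := Nat.exists_eq_add_of_le hj
  induction m using Nat.strong_induction_on with
  | _ m ih =>
    have h1 := (clusterExpansionAt_iff A t (1, 0) (m, 0) (unitObs σ (1 + 0))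
      (fun j hj hjm y hy => by
        obtain ⟨i, rfl⟩ := Nat.exists_eq_add_of_le hj
        exact ih i (by simp only at hjm; omega) hj hy)
      (fun j hj hj0 => by simp only at hj0; omega)).1 (h _) y hy
    have h2 := cum_opFam A t (1, 0) (m, 0) (unitObs σ (1 + 0)) y
    rw [← h1, evolve_extend_unitObs hΦ (1, 0) t (1 + m, 0 + 0) hy, if_pos (by simp)] at h2
    simp only [sum_range_one, zero_add] at h2
    rw [sum_range_succ, Nat.sub_self] at h2
    have h3 : ∑ a ∈ range m, (A t (1 + a, 0) (1, 0) (unitObs σ (1 + 0)) : Phase (1 + a + 0) → ℝ)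
        (window (m - a) (1 + a + 0) y) = ∑ a ∈ range m, if a = 0 then 1 else 0 := by
      refine sum_congr rfl fun a ha => ?_
      have ha' := mem_range.1 ha
      rw [ih a ha' (by omega) (window_mem_allowed (by omega) hy)]
      simp
    have h4 : window 0 (1 + m + 0) y = y := window_zero_self y
    have h5 := h2.trans (congrArg₂ (· + ·) h3 (congrArg _ h4))
    simp only [Finset.sum_ite_eq', mem_range] at h5
    rcases Nat.eq_zero_or_pos m with rfl | hm
    · simpa using h5.symm
    · rw [if_pos hm] at h5
      rw [if_neg (by omega)]
      linarith

theorem right_operator_unitObs (hΦ : IsPotential Φ σ R) {A : GenOps σ} {t : ℝ}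
    (h : ∀ k, ClusterExpansionAt Φ A t (0, 1) k (unitObs σ (0 + 1))) {j : ℕ} (hj : 1 ≤ j)
    {y : Phase (0 + j)} (hy : y ∈ Allowed σ (0 + j)) :
    (A t (0, j) (0, 1) (unitObs σ (0 + 1)) : Phase (0 + j) → ℝ) y = if j = 1 then 1 else 0 := by
  obtain ⟨m, rfl⟩ := Nat.exists_eq_add_of_le hj
  induction m using Nat.strong_induction_on with
  | _ m ih =>
    have h1 := (clusterExpansionAt_iff A t (0, 1) (0, m) (unitObs σ (0 + 1))
      (fun j hj hj0 => by simp only at hj0; omega)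
      (fun j hj hjm y hy => by
        obtain ⟨i, rfl⟩ := Nat.exists_eq_add_of_le hj
        exact ih i (by simp only at hjm; omega) hj hy)).1 (h _) y hy
    have h2 := cum_opFam A t (0, 1) (0, m) (unitObs σ (0 + 1)) y
    rw [← h1, evolve_extend_unitObs hΦ (0, 1) t (0 + 0, 1 + m) hy, if_pos (by simp)] at h2
    replace h2 := (h2.trans (sum_range_one _)).trans (sum_range_succ _ _)
    have h3 : ∑ a ∈ range m, (A t (0, 1 + a) (0, 1) (unitObs σ (0 + 1)) : Phase (0 + (1 + a)) → ℝ)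
        (window 0 (0 + (1 + a)) y) = ∑ a ∈ range m, if a = 0 then 1 else 0 := by
      refine sum_congr rfl fun a ha => ?_
      have ha' := mem_range.1 ha
      rw [ih a ha' (by omega) (window_mem_allowed (by omega) hy)]
      simp
    have h4 : window 0 (0 + (1 + m)) y = y := window_zero_self y
    have h5 := h2.trans (congrArg₂ (· + ·) h3 (congrArg _ h4))
    simp only [Finset.sum_ite_eq', mem_range] at h5
    rcases Nat.eq_zero_or_pos m with rfl | hm
    · simpa using h5.symm
    · rw [if_pos hm] at h5
      rw [if_neg (by omega)]
      linarith

/-- The solution of the cluster expansions. -/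
theorem clusterExpansions_iff (hΦ : IsPotential Φ σ R) (A : GenOps σ) (t : ℝ)
    {P : (n : ℕ × ℕ) → Obs σ (n.1 + n.2) → Prop} (hP₁ : P (1, 0) (unitObs σ (1 + 0)))
    (hP₂ : P (0, 1) (unitObs σ (0 + 1))) :
    (∀ (n k : ℕ × ℕ) (b : Obs σ (n.1 + n.2)), P n b → ClusterExpansionAt Φ A t n k b) ↔
      ∀ (n : ℕ × ℕ) (b : Obs σ (n.1 + n.2)), P n b → ∀ s : ℕ × ℕ, n.1 ≤ s.1 → n.2 ≤ s.2 →
        ∀ x ∈ Allowed σ (s.1 + s.2), (A t s n b : Phase (s.1 + s.2) → ℝ) x =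
          diff (evolve Φ σ (extend n b) t) s x := by
  constructor
  · intro h n b hb
    have key : ∀ s : ℕ × ℕ, ∀ x ∈ Allowed σ (s.1 + s.2),
        evolve Φ σ (extend n b) t s x = cum (opFam A t n b) s x := by
      intro s x hx
      by_cases hs : n.1 ≤ s.1 ∧ n.2 ≤ s.2
      · obtain ⟨s₁, s₂⟩ := s
        obtain ⟨k₁, rfl⟩ := Nat.exists_eq_add_of_le hs.1
        obtain ⟨k₂, rfl⟩ := Nat.exists_eq_add_of_le hs.2
        exact (clusterExpansionAt_iff A t n (k₁, k₂) b
          (fun j hj _ y hy => left_operator_unitObs hΦ (fun k => h _ _ _ hP₁) hj hy)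
          (fun j hj _ y hy => right_operator_unitObs hΦ (fun k => h _ _ _ hP₂) hj hy)).1
          (h n _ b hb) x hx
      · rw [cum_opFam_of_not_le A t n b hs, evolve, extend, if_neg hs]
    intro s h1 h2 x hx
    rw [diff_congr key s hx, diff_cum, opFam_of_le A t b h1 h2]
  · intro h n k b hb
    -- The constant 1 is invariant, and its extension from one particle is 1 for every number j ≥ 1
    -- of particles. The formula gives 1 - 1 = 0, except for j = 1, where a₋ contributes nothing.
    have hu : ∀ j, 1 ≤ j → ∀ y ∈ Allowed σ (j + 0),
        (A t (j, 0) (1, 0) (unitObs σ (1 + 0)) : Phase (j + 0) → ℝ) y =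
          if j = 1 then 1 else 0 := fun j hj y hy => by
      rw [h (1, 0) _ hP₁ (j, 0) hj le_rfl y hy, diff, am_ap_eq_zero _ (Or.inr rfl)]
      have hj0 : j ≠ 0 := by omega
      simp only [am, ap, hj0, if_false, if_true]
      rw [evolve_extend_unitObs hΦ (1, 0) t (j, 0) hy,
        evolve_extend_unitObs hΦ (1, 0) t (j - 1, 0)
          (am_window_mem (s := (j, 0)) hj0 hy), if_pos ⟨hj, le_rfl⟩]
      by_cases hj1 : j = 1
      · simp [hj1]
      · rw [if_pos ⟨by simp only; omega, le_rfl⟩, if_neg hj1]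
        norm_num
    have hv : ∀ j, 1 ≤ j → ∀ y ∈ Allowed σ (0 + j),
        (A t (0, j) (0, 1) (unitObs σ (0 + 1)) : Phase (0 + j) → ℝ) y =
          if j = 1 then 1 else 0 := fun j hj y hy => by
      rw [h (0, 1) _ hP₂ (0, j) le_rfl hj y hy, diff, am_ap_eq_zero _ (Or.inl rfl)]
      have hj0 : j ≠ 0 := by omega
      simp only [am, ap, hj0, if_false, if_true]
      rw [evolve_extend_unitObs hΦ (0, 1) t (0, j) hy,
        evolve_extend_unitObs hΦ (0, 1) t (0, j - 1)
          (ap_window_mem (s := (0, j)) hy), if_pos ⟨le_rfl, hj⟩]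
      by_cases hj1 : j = 1
      · simp [hj1]
      · rw [if_pos ⟨le_rfl, by simp only; omega⟩, if_neg hj1]
        norm_num
    refine (clusterExpansionAt_iff A t n k b (fun j hj _ => hu j hj) fun j hj _ => hv j hj).2 ?_
    intro x hx
    refine eq_of_diff_eq (σ := σ) (fun s x hx => ?_) (n.1 + k.1, n.2 + k.2) hx
    rw [diff_cum]
    by_cases hs : n.1 ≤ s.1 ∧ n.2 ≤ s.2
    · rw [opFam_of_le A t b hs.1 hs.2, h n b hb s hs.1 hs.2 x hx]
    · rw [diff_evolve_extend_of_not_le n b t hs, opFam, if_neg hs]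

end Cluster

end TopInt

namespace TopInt

/-! ### The solution formula for the Cauchy problem -/

section Solution

variable {Φ : ℝ → ℝ} {σ R : ℝ}

/-- The double sequence of functions underlying a double sequence of observables. -/
def ObsSeq.toFam (B : ObsSeq σ) : Fam := fun s => (B s : Phase (s.1 + s.2) → ℝ)

/-- Observables vanish on forbidden configurations, so the pointwise results on allowed ones yield
equality of initial data as sequences. -/
theorem ObsSeq.ext_allowed {B B' : ObsSeq σ}
    (h : ∀ s : ℕ × ℕ, ∀ x ∈ Allowed σ (s.1 + s.2), B.toFam s x = B'.toFam s x) : B = B' := by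
  funext s
  refine Subtype.ext (funext fun x => ?_)
  by_cases hx : x ∈ Allowed σ (s.1 + s.2)
  · exact h s x hx
  · rw [(B s).2.2.2 x hx, (B' s).2.2.2 x hx]

theorem contDiffOn_cum {n : WithTop ℕ∞} {B : Fam}
    (hB : ∀ s : ℕ × ℕ, ContDiffOn ℝ n (B s) (Allowed σ (s.1 + s.2))) (s : ℕ × ℕ) :
    ContDiffOn ℝ n (cum B s) (Allowed σ (s.1 + s.2)) := by
  refine ContDiffOn.sum fun c hc => ContDiffOn.sum fun m hm => ?_
  have h1 := mem_range.1 hc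
  have h2 := mem_range.1 hm
  exact (hB (m, c)).comp (contDiff_window _ _).contDiffOn fun x hx =>
    window_mem_allowed (by simp only; omega) hx

theorem continuousOn_cum {B : Fam} (hB : ∀ s : ℕ × ℕ, ContinuousOn (B s) (Allowed σ (s.1 + s.2)))
    (s : ℕ × ℕ) : ContinuousOn (cum B s) (Allowed σ (s.1 + s.2)) :=
  contDiffOn_zero.1 (contDiffOn_cum (fun s => contDiffOn_zero.2 (hB s)) s)

/-- The solution of the hierarchy with the given initial data. -/
noncomputable def solution (Φ : ℝ → ℝ) (σ : ℝ) (B : Fam) (t : ℝ) : Fam :=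
  diff (evolve Φ σ (cum B) t)

theorem solution_zero (hΦ : IsPotential Φ σ R) (B : Fam) (s : ℕ × ℕ) {x : Phase (s.1 + s.2)}
    (hx : x ∈ Allowed σ (s.1 + s.2)) : solution Φ σ B 0 s x = B s x := by
  rw [solution, diff_congr (B' := cum B) (fun s x hx => ?_) s hx, diff_cum]
  rw [evolve, (flow_spec hΦ hx).2]

theorem continuousOn_solution (hΦ : IsPotential Φ σ R) {B : Fam}
    (hB : ∀ s : ℕ × ℕ, ContinuousOn (B s) (Allowed σ (s.1 + s.2))) (s : ℕ × ℕ) :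
    ContinuousOn (fun z : ℝ × Phase (s.1 + s.2) => solution Φ σ B z.1 s z.2)
      (Set.univ ×ˢ Allowed σ (s.1 + s.2)) :=
  contDiffOn_zero.1 (contDiffOn_diff_uncurry
    (fun s => contDiffOn_zero.2 (continuousOn_evolve_uncurry hΦ (continuousOn_cum hB) s)) s)

theorem contDiffOn_solution (hΦ : IsPotential Φ σ R) {B : Fam}
    (hB : ∀ s : ℕ × ℕ, ContDiffOn ℝ 1 (B s) (Allowed σ (s.1 + s.2))) (s : ℕ × ℕ) :
    ContDiffOn ℝ 1 (fun z : ℝ × Phase (s.1 + s.2) => solution Φ σ B z.1 s z.2)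
      (Set.univ ×ˢ Allowed σ (s.1 + s.2)) :=
  contDiffOn_diff_uncurry (fun s => contDiffOn_evolve hΦ (contDiffOn_cum hB) s) s

/-- Existence and uniqueness of the generalized solution. -/
theorem isGeneralizedSolution_iff (hΦ : IsPotential Φ σ R) (B₀ : ObsSeq σ) (B : ℝ → ObsSeq σ) :
    IsGeneralizedSolution Φ B₀ B ↔ ∀ (t : ℝ) (s : ℕ × ℕ), ∀ x ∈ Allowed σ (s.1 + s.2),
      (B t).toFam s x = solution Φ σ B₀.toFam t s x := by
  have hB₀ : ∀ s : ℕ × ℕ, ContinuousOn (B₀.toFam s) (Allowed σ (s.1 + s.2)) := fun s =>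
    (B₀ s).2.1
  have hw := fun (s : ℕ × ℕ) (f : Phase (s.1 + s.2) → ℝ) (h1 : ContDiff ℝ 1 f)
    (h2 : HasCompactSupport f) (h3 : tsupport f ⊆ Allowed σ (s.1 + s.2)) (t : ℝ) =>
    hasDerivAt_integral_diff_evolve hΦ (continuousOn_cum hB₀) h1 h2 h3 t
  constructor
  · intro h t s x hx
    exact eq_of_hasDerivAt_integral hΦ (B := fun t => (B t).toFam) (B' := solution Φ σ B₀.toFam)
      h.continuous (continuousOn_solution hΦ hB₀)
      (fun s x hx => by rw [solution_zero hΦ _ s hx, h.initial]) h.equation hw s t hx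
  · intro h
    refine ⟨fun s => ?_, ?_, fun s f h1 h2 h3 t => ?_⟩
    · exact (continuousOn_solution hΦ hB₀ s).congr fun z hz => h z.1 s z.2 hz.2
    · exact ObsSeq.ext_allowed fun s x hx => by rw [h 0 s x hx, solution_zero hΦ _ s hx]
    · have e : (fun τ => ∫ x, (B τ s : Phase (s.1 + s.2) → ℝ) x * f x) =
          fun τ => ∫ x, solution Φ σ B₀.toFam τ s x * f x := funext fun τ =>
        integral_mul_congr (h τ s) fun x hx =>
          image_eq_zero_of_notMem_tsupport fun hx' => hx (h3 hx')
      rw [e]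
      refine (hw s f h1 h2 h3 t).congr_deriv ?_
      exact (weakGenerator_congr (h t) h3).symm

/-- Existence and uniqueness of the classical solution. -/
theorem isClassicalSolution_iff (hΦ : IsPotential Φ σ R) {B₀ : ObsSeq σ} (hB₀ : B₀.IsC1)
    (B : ℝ → ObsSeq σ) :
    IsClassicalSolution Φ B₀ B ↔ ∀ (t : ℝ) (s : ℕ × ℕ), ∀ x ∈ Allowed σ (s.1 + s.2),
      (B t).toFam s x = solution Φ σ B₀.toFam t s x := by
  replace hB₀ : ∀ s : ℕ × ℕ, ContDiffOn ℝ 1 (B₀.toFam s) (Allowed σ (s.1 + s.2)) := hB₀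
  have hw := fun (s : ℕ × ℕ) (t : ℝ) (x : Phase (s.1 + s.2)) (hx : x ∈ Allowed σ (s.1 + s.2)) =>
    hasDerivAt_diff_evolve hΦ (contDiffOn_cum hB₀) hx t
  constructor
  · intro h t s x hx
    exact eq_of_hasDerivAt_classical hΦ (B := fun t => (B t).toFam) (B' := solution Φ σ B₀.toFam)
      h.smooth (contDiffOn_solution hΦ hB₀)
      (fun s x hx => by rw [solution_zero hΦ _ s hx, h.initial]) h.equation hw s t hx
  · intro h
    refine ⟨fun s => ?_, ?_, fun s t x hx => ?_⟩
    · exact (contDiffOn_solution hΦ hB₀ s).congr fun z hz => h z.1 s z.2 hz.2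
    · exact ObsSeq.ext_allowed fun s x hx => by rw [h 0 s x hx, solution_zero hΦ _ s hx]
    · have e : (fun τ => (B τ s : Phase (s.1 + s.2) → ℝ) x) =
          fun τ => solution Φ σ B₀.toFam τ s x := funext fun τ => h τ s x hx
      rw [e]
      refine (hw s t x hx).congr_deriv ?_
      exact (classicalGenerator_congr (h t) hx).symm

end Solution

/-! ### Comparison of the expansions with the solution formula -/

section Expansion

variable {Φ : ℝ → ℝ} {σ R : ℝ}

theorem diff_congr_of_le {D D' : Fam} {s : ℕ × ℕ}
    (h : ∀ s' : ℕ × ℕ, s'.1 ≤ s.1 → s'.2 ≤ s.2 → D s' = D' s') : diff D s = diff D' s := by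
  funext x
  simp only [diff, am, ap, h s le_rfl le_rfl, h (s.1 - 1, s.2) (Nat.sub_le _ _) le_rfl,
    h (s.1, s.2 - 1) le_rfl (Nat.sub_le _ _), h (s.1 - 1, s.2 - 1) (Nat.sub_le _ _) (Nat.sub_le _ _)]

theorem am_sum {ι : Type*} (F : Finset ι) (D : ι → Fam) :
    am (fun s x => ∑ i ∈ F, D i s x) = fun s x => ∑ i ∈ F, am (D i) s x := by
  funext s x
  by_cases h : s.1 = 0 <;> simp [am, h]

theorem ap_sum {ι : Type*} (F : Finset ι) (D : ι → Fam) :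
    ap (fun s x => ∑ i ∈ F, D i s x) = fun s x => ∑ i ∈ F, ap (D i) s x := by
  funext s x
  by_cases h : s.2 = 0 <;> simp [ap, h]

theorem diff_sum {ι : Type*} (F : Finset ι) (D : ι → Fam) :
    diff (fun s x => ∑ i ∈ F, D i s x) = fun s x => ∑ i ∈ F, diff (D i) s x := by
  funext s x
  simp only [diff, ap_sum, am_sum, sum_add_distrib, sum_sub_distrib]

/-- One index set, fixed by s, serves all members s' ≤ s, since `extend` is zero where it does not
apply. This allows `diff`, which involves several members, to be exchanged with the sum. -/
theorem cum_eq_sum_extend (B : Fam) {s s' : ℕ × ℕ} (h1 : s'.1 ≤ s.1) (h2 : s'.2 ≤ s.2) :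
    cum B s' = fun x =>
      ∑ p ∈ range (s.1 + 1) ×ˢ range (s.2 + 1), extend p (B p) s' x := by
  funext x
  rw [sum_product, sum_comm, cum]
  rw [← sum_subset (range_mono (Nat.add_le_add_right h2 1))]
  · refine sum_congr rfl fun c hc => ?_
    rw [← sum_subset (range_mono (Nat.add_le_add_right h1 1))]
    · refine sum_congr rfl fun m hm => ?_
      have hc' := mem_range.1 hc
      have hm' := mem_range.1 hm
      rw [extend, if_pos ⟨by simp only; omega, by simp only; omega⟩]
    · intro m _ hm
      rw [mem_range] at hm
      exact if_neg (by simp only; omega)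
  · intro c _ hc
    rw [mem_range] at hc
    exact sum_eq_zero fun m _ => if_neg (by simp only; omega)

theorem solution_eq_sum (B : Fam) (t : ℝ) (s : ℕ × ℕ) (x : Phase (s.1 + s.2)) :
    solution Φ σ B t s x = ∑ n₁ ∈ range (s.1 + 1), ∑ n₂ ∈ range (s.2 + 1),
      diff (evolve Φ σ (extend (n₁, n₂) (B (n₁, n₂))) t) s x := by
  rw [← sum_product' (f := fun n₁ n₂ => diff (evolve Φ σ (extend (n₁, n₂) (B (n₁, n₂))) t) s x)]
  have := congrFun (congrFun (diff_sum (range (s.1 + 1) ×ˢ range (s.2 + 1))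
    fun p => evolve Φ σ (extend p (B p)) t) s) x
  rw [← this, solution]
  refine congrFun (diff_congr_of_le fun s' h1 h2 => ?_) x
  funext y
  simp only [evolve]
  rw [cum_eq_sum_extend B h1 h2]

theorem expansion_apply (A : GenOps σ) (B₀ : ObsSeq σ) (t : ℝ) (s : ℕ × ℕ)
    (x : Phase (s.1 + s.2)) :
    (expansion A B₀ t).toFam s x = ∑ n₁ ∈ range (s.1 + 1), ∑ n₂ ∈ range (s.2 + 1),
      (A t s (n₁, n₂) (B₀ (n₁, n₂)) : Phase (s.1 + s.2) → ℝ) x := by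
  simp [ObsSeq.toFam, expansion]

/-- The expansions are given by the solution formula if and only if the generating operators are. -/
theorem expansion_eq_solution_iff (A : GenOps σ) {P : (n : ℕ × ℕ) → Obs σ (n.1 + n.2) → Prop}
    (hP : ∀ n, P n 0) :
    (∀ B₀ : ObsSeq σ, (∀ n, P n (B₀ n)) → ∀ (t : ℝ) (s : ℕ × ℕ), ∀ x ∈ Allowed σ (s.1 + s.2),
      (expansion A B₀ t).toFam s x = solution Φ σ B₀.toFam t s x) ↔
    ∀ (t : ℝ) (n : ℕ × ℕ) (b : Obs σ (n.1 + n.2)), P n b → ∀ s : ℕ × ℕ, n.1 ≤ s.1 → n.2 ≤ s.2 →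
      ∀ x ∈ Allowed σ (s.1 + s.2), (A t s n b : Phase (s.1 + s.2) → ℝ) x =
        diff (evolve Φ σ (extend n b) t) s x := by
  constructor
  · intro h t n b hb s h1 h2 x hx
    -- A sequence with the single nonzero member b isolates one operator: by linearity the other
    -- operators are applied to 0 and give 0.
    have := h (Pi.single n b) (fun m => ?_) t s x hx
    · rw [expansion_apply, solution_eq_sum,
        ← sum_product' (f := fun n₁ n₂ => (A t s (n₁, n₂)
          ((Pi.single n b : ObsSeq σ) (n₁, n₂)) : Phase (s.1 + s.2) → ℝ) x),
        ← sum_product' (f := fun n₁ n₂ => diff (evolve Φ σ (extend (n₁, n₂)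
          (ObsSeq.toFam (Pi.single n b) (n₁, n₂))) t) s x)] at this
      have hn : n ∈ range (s.1 + 1) ×ˢ range (s.2 + 1) := by
        simp only [mem_product, mem_range]
        omega
      rw [sum_eq_single_of_mem n hn, sum_eq_single_of_mem n hn] at this
      · simpa only [ObsSeq.toFam, Pi.single_eq_same] using this
      · intro m _ hm
        simp [ObsSeq.toFam, Pi.single_eq_of_ne hm, diff, evolve, extend, am, ap]
      · intro m _ hm
        simp [Pi.single_eq_of_ne hm]
    · by_cases hm : m = n
      · subst hm
        rwa [Pi.single_eq_same]
      · rw [Pi.single_eq_of_ne hm]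
        exact hP m
  · intro h B₀ hB₀ t s x hx
    rw [expansion_apply, solution_eq_sum]
    refine sum_congr rfl fun n₁ h1 => sum_congr rfl fun n₂ h2 => ?_
    exact h t (n₁, n₂) _ (hB₀ _) s (Nat.lt_succ_iff.1 (mem_range.1 h1))
      (Nat.lt_succ_iff.1 (mem_range.1 h2)) x hx

theorem contDiffOn_unitObs {n : WithTop ℕ∞} (N : ℕ) :
    ContDiffOn ℝ n (unitObs σ N : Phase N → ℝ) (Allowed σ N) :=
  contDiffOn_const.congr fun _ hx => unitObs_apply hx

end Expansion

end TopInt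

theorem mainTheorem6 (Φ : ℝ → ℝ) (σ R : ℝ) (hΦ : TopInt.IsPotential Φ σ R)
    (A : TopInt.GenOps σ) :
    ((∀ B₀ : TopInt.ObsSeq σ,
        TopInt.IsGeneralizedSolution Φ B₀ (TopInt.expansion A B₀)) ↔
      ∀ (t : ℝ) (n k : ℕ × ℕ) (b : TopInt.Obs σ (n.1 + n.2)),
        TopInt.ClusterExpansionAt Φ A t n k b) ∧
    ((∀ B₀ : TopInt.ObsSeq σ, B₀.IsC1 →
        TopInt.IsClassicalSolution Φ B₀ (TopInt.expansion A B₀)) ↔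
      ∀ (t : ℝ) (n k : ℕ × ℕ) (b : TopInt.Obs σ (n.1 + n.2)),
        ContDiffOn ℝ 1 (b : TopInt.Phase (n.1 + n.2) → ℝ) (TopInt.Allowed σ (n.1 + n.2)) →
        TopInt.ClusterExpansionAt Φ A t n k b) := by
  constructor
  · have h1 := TopInt.expansion_eq_solution_iff (Φ := Φ) A (P := fun _ _ => True) fun _ => trivial
    have h2 := fun t => TopInt.clusterExpansions_iff hΦ A t (P := fun _ _ => True) trivial trivial
    simp only [forall_const] at h1 h2
    simp only [TopInt.isGeneralizedSolution_iff hΦ, h1, h2]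
  -- For classical solutions the same argument is confined to continuously differentiable
  -- observables. This class contains 0, needed for sequences with one nonzero member, and the
  -- constant 1, needed to determine the blocks without the cluster.
  · have h1 := TopInt.expansion_eq_solution_iff (Φ := Φ) A
      (P := fun n b => ContDiffOn ℝ 1 (b : TopInt.Phase (n.1 + n.2) → ℝ)
        (TopInt.Allowed σ (n.1 + n.2))) fun _ => contDiffOn_const
    have h2 := fun t => TopInt.clusterExpansions_iff hΦ A t
      (P := fun n b => ContDiffOn ℝ 1 (b : TopInt.Phase (n.1 + n.2) → ℝ)
        (TopInt.Allowed σ (n.1 + n.2))) (TopInt.contDiffOn_unitObs _) (TopInt.contDiffOn_unitObs _)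
    have h3 : (∀ B₀ : TopInt.ObsSeq σ, B₀.IsC1 →
        TopInt.IsClassicalSolution Φ B₀ (TopInt.expansion A B₀)) ↔
        ∀ B₀ : TopInt.ObsSeq σ, B₀.IsC1 → ∀ (t : ℝ) (s : ℕ × ℕ),
          ∀ x ∈ TopInt.Allowed σ (s.1 + s.2), (TopInt.expansion A B₀ t).toFam s x =
            TopInt.solution Φ σ B₀.toFam t s x :=
      forall₂_congr fun B₀ hB₀ => TopInt.isClassicalSolution_iff hΦ hB₀ _
    rw [h3]
    exact h1.trans (forall_congr' fun t => (h2 t).symm)
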